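/- Let $\mathbb R^{2,1}$ be $\mathbb R^3$ with $\langle x,y\rangle=x_1y_1+x_2y_2-x_3y_3$, let $\mathbb H^2=\{x:\langle x,x\rangle=-1,\ x_3>0\}$, let $\mathbb D$ be the open unit disk in $\mathbb R^2$, and let $\pi:\mathbb H^2\to\mathbb D$, $\pi(x)=(x_1/x_3,x_2/x_3)$, be the identification with the Klein model, so that $\partial\mathbb H^2$ is identified with the unit circle $\partial\mathbb D$ and convex hulls of subsets of $\partial\mathbb H^2$ are Euclidean convex hulls in $\overline{\mathbb D}$. For $1\le k\le\infty$, let $\Sigma\subset\mathbb R^{2,1}$ be a connected, properly embedded spacelike surface of class $C^{k+1}$ (smooth if $k=\infty$), whose Gaussian curvature (the determinant of the shape operator $B=D\mathbf n$, where $\mathbf n$ is the future-directed unit normal field) satisfies $a\le\det B\le b$ for some constants $0<a\le b$. Let $G_\Sigma:\Sigma\to\mathbb H^2$, $p\mapsto\mathbf n(p)$, be its Gauss map, and let $u_\Sigma(y)=\sup_{x\in\Sigma}\langle x,(y,1)\rangle\in\mathbb R\cup\{+\infty\}$, for $y\in\overline{\mathbb D}$, be its support function. (1) Let $\varphi:\partial\mathbb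 D\to\mathbb R\cup\{+\infty\}$ be a lower semicontinuous function such that the domain of dependence of $\Sigma$ (the set of points $p$ such that every inextendable causal curve through $p$ meets $\Sigma$) is $\mathcal D_\varphi$, the intersection of the futures of the null planes $\{x:\langle x,(\xi,1)\rangle=z\}$ with $\xi\in\partial\mathbb D$, $z\in\mathbb R$, $z\ge\varphi(\xi)$. Then $G_\Sigma$ is a $C^k$-diffeomorphism from $\Sigma$ onto the interior of the convex hull of $\partial\mathbb H^2\setminus\varphi^{-1}(+\infty)$. (2) The essential domain $\{y\in\overline{\mathbb D}: u_\Sigma(y)<+\infty\}$ of $u_\Sigma$ is the convex hull of $\{\xi\in\partial\mathbb D: u_\Sigma(\xi)<+\infty\}$. (3) Let $\Omega_\Sigma=\pi(G_\Sigma(\Sigma))$. For every segment $[\xi_1,\xi_2]\subset\partial\Omega_\Sigma$ with endpoints $\xi_1,\xi_2\in\partial\mathbb D$, the restriction of $u_\Sigma$ to $[\xi_1,\xi_2]$ is the convex envelope of $u_\Sigma|_{\{\xi_1,\xi_2\}}$; that is, it agrees there with the function whose supergraph is the closed convex hull of the supergraph of the function that equals $u_\Sigma$ at $\xi_1$ and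 $\xi_2$ and $+\infty$ elsewhere. (So $u_\Sigma$ is affine on the segment if both endpoint values are finite, and infinite on the open segment if one of them is infinite.) -/

import Mathlib

open scoped Topology

noncomputable section

/-! ## Minkowski 3-space -/

/-- The underlying vector space of Minkowski space, with coordinates `x 0, x 1, x 2`;
the last one is the time coordinate. -/
abbrev Mink : Type := EuclideanSpace ℝ (Fin 3)

/-- The plane containing the closed unit disk, the Klein model of the closed hyperbolic plane. -/
abbrev Plane : Type := EuclideanSpace ℝ (Fin 2)

/-- The Minkowski product, of signature `(2, 1)`. -/
def mink (x y : Mink) : ℝ := x 0 * y 0 + x 1 * y 1 - x 2 * y 2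

/-- Nonzero vectors which are timelike or lightlike. -/
def IsCausalVector (v : Mink) : Prop := v ≠ 0 ∧ mink v v ≤ 0

/-- Future-directed timelike vectors. -/
def IsFutureTimelike (v : Mink) : Prop := mink v v < 0 ∧ 0 < v 2

/-- The future `I⁺(A)` of a set `A`. -/
def chronFuture (A : Set Mink) : Set Mink := {x | ∃ q ∈ A, IsFutureTimelike (x - q)}

/-- The hyperbolic plane: the set of future-directed unit timelike vectors. -/
def hyperbolicPlane : Set Mink := {x | mink x x = -1 ∧ 0 < x 2}

/-- The vector `(y, 1)`. -/
def liftVec (y : Plane) : Mink := !₂[y 0, y 1, 1]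

/-- The radial projection of the hyperboloid to the disk at height one (Klein model). -/
def kleinProj (x : Mink) : Plane := !₂[x 0 / x 2, x 1 / x 2]

/-! ## Surfaces -/

/-- `S` is an embedded surface (without boundary) of class `C^n`, `1 ≤ n`: it is locally a regular
level set of a function of class `C^n`. -/
def IsEmbeddedSurface (n : WithTop ℕ∞) (S : Set Mink) : Prop :=
  ∀ p ∈ S, ∃ U : Set Mink, IsOpen U ∧ p ∈ U ∧ ∃ F : Mink → ℝ, ContDiffOn ℝ n F U ∧
    (∀ x ∈ U, F x = 0 → fderiv ℝ F x ≠ 0) ∧ S ∩ U = {x | x ∈ U ∧ F x = 0}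

/-- The tangent space of `S` at `p`. -/
def tangentPlane (S : Set Mink) (p : Mink) : Submodule ℝ Mink :=
  Submodule.span ℝ (tangentConeAt ℝ S p)

/-- Properly embedded spacelike surfaces of class `C^n`: connected embedded surfaces, closed as
subsets, on whose tangent spaces the Minkowski product is positive definite. -/
structure IsProperSpacelikeSurface (n : WithTop ℕ∞) (S : Set Mink) : Prop where
  embedded : IsEmbeddedSurface n S
  closed : IsClosed S
  connected : IsConnected S
  spacelike : ∀ p ∈ S, ∀ v ∈ tangentPlane S p, v ≠ 0 → 0 < mink v v

/-- The Gauss map of `S`: the future-directed unit normal vector, as a point of the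
hyperbolic plane. -/
def gaussMap (S : Set Mink) (p : Mink) : Mink :=
  Classical.epsilon fun n => n ∈ hyperbolicPlane ∧ ∀ v ∈ tangentPlane S p, mink n v = 0

open Classical in
/-- The Gaussian curvature of `S` at `p`: the determinant of the shape operator, that is of the
derivative of the unit normal along `S`, as an endomorphism of the tangent space. (On the
tangent space the derivative within `S` is uniquely determined, and for a `C²` spacelike surface
it maps the tangent space to itself.) -/
def gaussianCurvature (S : Set Mink) (p : Mink) : ℝ :=
  if h : ∀ v ∈ tangentPlane S p,
      (fderivWithin ℝ (gaussMap S) S p : Mink →ₗ[ℝ] Mink) v ∈ tangentPlane S p then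
    LinearMap.det ((fderivWithin ℝ (gaussMap S) S p : Mink →ₗ[ℝ] Mink).restrict h)
  else 0

/-- `f` restricts to a diffeomorphism of class `C^n` from `A` onto `B`, for submanifolds `A` and
`B` of Euclidean spaces. -/
def IsDiffeoOnto {E F : Type*} [NormedAddCommGroup E] [NormedSpace ℝ E] [NormedAddCommGroup F]
    [NormedSpace ℝ F] (n : WithTop ℕ∞) (f : E → F) (A : Set E) (B : Set F) : Prop :=
  Set.BijOn f A B ∧ ContDiffOn ℝ n f A ∧
    ∃ g : F → E, Set.InvOn g f A B ∧ ContDiffOn ℝ n g B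

/-! ## Domains of dependence and regular domains -/

/-- `γ`, restricted to the interval `I`, is a causal curve. -/
def IsCausalCurve (I : Set ℝ) (γ : ℝ → Mink) : Prop :=
  I.Nonempty ∧ I.OrdConnected ∧ ContinuousOn γ I ∧
    ∀ s ∈ I, ∀ t ∈ I, s ≠ t → IsCausalVector (γ t - γ s)

/-- A causal curve is inextendable if it is not a proper part of another causal curve. -/
def IsInextendableCausalCurve (I : Set ℝ) (γ : ℝ → Mink) : Prop :=
  IsCausalCurve I γ ∧
    ∀ (J : Set ℝ) (δ : ℝ → Mink), IsCausalCurve J δ → γ '' I ⊆ δ '' J → δ '' J ⊆ γ '' I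

/-- The domain of dependence of `S`: the points such that every inextendable causal curve through
them meets `S`. -/
def domainOfDependence (S : Set Mink) : Set Mink :=
  {p | ∀ (I : Set ℝ) (γ : ℝ → Mink), IsInextendableCausalCurve I γ → p ∈ γ '' I →
    (γ '' I ∩ S).Nonempty}

/-- The null plane with parameters `(ξ, z)`, for `ξ` in the unit circle. -/
def nullPlane (ξ : Plane) (z : ℝ) : Set Mink := {x | mink x (liftVec ξ) = z}

/-- The domain `𝓓_φ`: the intersection of the futures of the null planes whose parameters belong
to the supergraph of `φ`. -/
def domainOf (φ : Metric.sphere (0 : Plane) 1 → EReal) : Set Mink :=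
  {x | ∀ (ξ : Metric.sphere (0 : Plane) 1) (z : ℝ), φ ξ ≤ (z : EReal) →
    x ∈ chronFuture (nullPlane ξ z)}

/-! ## Convex functions and support functions -/

/-- The essential domain of an extended-valued function: the set on which it is finite. -/
def essDomain (u : Plane → EReal) : Set Plane := {y | u y ≠ ⊥ ∧ u y ≠ ⊤}

/-- The supergraph of an extended-valued function. -/
def supergraph (u : Plane → EReal) : Set (Plane × ℝ) := {q | u q.1 ≤ (q.2 : EReal)}

/-- The convex envelope: the function whose supergraph is the closure of the convex hull of the
supergraph of `u`. -/
def convEnvelope (u : Plane → EReal) (y : Plane) : EReal :=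
  sInf {w : EReal | ∃ z : ℝ, w = (z : EReal) ∧ (y, z) ∈ closure (convexHull ℝ (supergraph u))}

open Classical in
/-- The restriction of `u` to `A`, as a function with value `+∞` outside `A`. -/
def restrictTo (u : Plane → EReal) (A : Set Plane) (y : Plane) : EReal :=
  if y ∈ A then u y else ⊤

open Classical in
/-- The support function of `S`, on the closed unit disk; as a function on the plane it has the
value `+∞` outside the closed disk. -/
def supportFunction (S : Set Mink) (y : Plane) : EReal :=
  if y ∈ Metric.closedBall (0 : Plane) 1 then ⨆ x ∈ S, ((mink x (liftVec y) : ℝ) : EReal) else ⊤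

end

noncomputable section

open scoped InnerProductSpace
open Set Filter

/-! ## Convex functions on the plane and their Legendre transforms -/

/-! A properly embedded spacelike surface is an entire graph `x₃ = f(x₁, x₂)` with `‖∇f‖ < 1`
(`IsProperSpacelikeSurface.exists_eq_graph`): horizontal projection is a local homeomorphism, and
segments lift because the slope is at most 1 and the surface is closed. In this picture the support
function is the Legendre transform `u` of `f`, and the Gauss map read in the Klein model is `∇f`.
The curvature is the determinant of the Hessian of `-√(1 - ‖y‖²)` at `y = ∇f`, composed with the
Hessian of `f`. Its positivity makes `f` convex or concave (`isConvexSpacelike_or`).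

In the convex case `det D²u ≤ 1 / (a (1 - ‖y‖²)²)`, in the following weak sense: if `w` touches `u`
from below with Hessian `W` at `∇f(q)`, then `W` is at most the inverse of the Hessian of `f` at `q`
(`hessian_le_of_touching`). Hence a function with larger Monge–Ampère determinant that lies below
`u` on the boundary of a region lies below it inside (`le_legendre_of_comparison`).

Two barriers exploit this. A multiple of `-√(1 - ‖y‖²)` plus an arbitrarily steep affine function
shows that `u` is infinite on a circular cap as soon as it is infinite on its arc
(`legendre_eq_top_of_arc`). A quadratic function, slightly bent along a chord and strongly bent
across it, shows that `u` is at least the affine interpolation of its endpoint values on a chord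
with `u = ∞` on one side (`le_legendre_on_chord`). Separation by lines then gives (2) in
`finiteDisk_eq`, and (3) is the chord estimate combined with convexity of `u`.

For (1), `∇f` is injective, its image is open and lies where `u` is finite, and it contains the
interior of that set because `f - ⟪·, y⟫` is coercive for `y` there (`range_grad_eq`). Null lines
are inextendable causal curves, so they must meet the surface when they start in the domain of
dependence; this shows that `φ` and `u` are finite at the same points of the circle
(`image_ne_top_eq`). In the concave case `u` is identically infinite, which makes (2) and (3)
trivial, and the hypothesis of (1) cannot hold. -/

/-- The derivative at `y` of `z ↦ z / √(1 - ‖z‖²)`, which is also the Hessian of `-√(1 - ‖z‖²)`. -/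
def hyperboloidHessian (y : Plane) : Plane →L[ℝ] Plane :=
  (√(1 - ‖y‖ ^ 2))⁻¹ • ContinuousLinearMap.id ℝ Plane +
    ((√(1 - ‖y‖ ^ 2))⁻¹ ^ 3) • (innerSL ℝ y).smulRight y

/-- `f` is a `C²` function on the plane with gradient `g` and positive definite Hessian `H`, whose
graph is spacelike, with Gaussian curvature at least `a`. -/
structure IsConvexSpacelike (a : ℝ) (f : Plane → ℝ) (g : Plane → Plane)
    (H : Plane → Plane →L[ℝ] Plane) : Prop where
  grad : ∀ x, HasGradientAt f (g x) x
  hess : ∀ x, HasFDerivAt g (H x) x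
  symm : ∀ x v w, ⟪H x v, w⟫_ℝ = ⟪v, H x w⟫_ℝ
  pos : ∀ x v, v ≠ 0 → 0 < ⟪H x v, v⟫_ℝ
  lt_one : ∀ x, ‖g x‖ < 1
  curv : ∀ x, a ≤ (hyperboloidHessian (g x) ∘L H x).det

theorem hasDerivAt_line (x v : Plane) (t : ℝ) : HasDerivAt (fun s : ℝ => x + s • v) v t := by
  simpa using ((hasDerivAt_id t).smul_const v).const_add x

theorem HasGradientAt.hasDerivAt_line {f : Plane → ℝ} {g x v : Plane} {t : ℝ}
    (h : HasGradientAt f g (x + t • v)) :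
    HasDerivAt (fun s : ℝ => f (x + s • v)) ⟪g, v⟫_ℝ t := by
  have := HasFDerivAt.comp_hasDerivAt t (f := fun s : ℝ => x + s • v) h.hasFDerivAt
    (_root_.hasDerivAt_line x v t)
  exact this.congr_deriv (by simp)

theorem HasFDerivAt.hasDerivAt_inner_line {g : Plane → Plane} {H : Plane →L[ℝ] Plane}
    {x v w : Plane} {t : ℝ} (h : HasFDerivAt g H (x + t • v)) :
    HasDerivAt (fun s : ℝ => ⟪g (x + s • v), w⟫_ℝ) ⟪H v, w⟫_ℝ t := by
  have h1 := HasFDerivAt.comp_hasDerivAt t (f := fun s : ℝ => x + s • v) h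
    (_root_.hasDerivAt_line x v t)
  simpa using h1.inner ℝ (hasDerivAt_const t w)

/-- Second order Taylor expansion with Peano remainder. -/
theorem eventually_taylor_two {f : Plane → ℝ} {g : Plane → Plane} {H : Plane →L[ℝ] Plane}
    {x : Plane} (hf : ∀ᶠ z in 𝓝 x, HasGradientAt f (g z) z) (hg : HasFDerivAt g H x)
    {ε : ℝ} (hε : 0 < ε) :
    ∀ᶠ v in 𝓝 (0 : Plane),
      |f (x + v) - f x - ⟪g x, v⟫_ℝ - ⟪H v, v⟫_ℝ / 2| ≤ ε * ‖v‖ ^ 2 := by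
  have h1 : ∀ᶠ v in 𝓝 (0 : Plane), ‖g (x + v) - g x - H v‖ ≤ ε * ‖v‖ := by
    have := (hasFDerivAt_iff_isLittleO_nhds_zero.1 hg).def hε
    exact this
  have h2 : ∀ᶠ v in 𝓝 (0 : Plane), HasGradientAt f (g (x + v)) (x + v) := by
    have : Tendsto (fun v : Plane => x + v) (𝓝 0) (𝓝 x) := by
      have : Continuous (fun v : Plane => x + v) := by fun_prop
      simpa using this.tendsto 0
    exact this.eventually hf
  obtain ⟨r, hr, hball⟩ := Metric.eventually_nhds_iff_ball.1 (h1.and h2)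
  filter_upwards [Metric.ball_mem_nhds _ hr] with v hv
  have hin : ∀ t ∈ Icc (0 : ℝ) 1, t • v ∈ Metric.ball (0 : Plane) r := by
    intro t ht
    rw [mem_ball_zero_iff] at hv ⊢
    rw [norm_smul, Real.norm_of_nonneg ht.1]
    nlinarith [norm_nonneg v, ht.2]
  have hd : ∀ t ∈ Icc (0 : ℝ) 1, HasDerivAt
      (fun t : ℝ => f (x + t • v) - f x - t * ⟪g x, v⟫_ℝ - t ^ 2 * (⟪H v, v⟫_ℝ / 2))
      ⟪g (x + t • v) - g x - H (t • v), v⟫_ℝ t := by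
    intro t ht
    have e1 := (hball _ (hin t ht)).2.hasDerivAt_line
    have e2 : HasDerivAt (fun t : ℝ => t * ⟪g x, v⟫_ℝ) (⟪g x, v⟫_ℝ) t := by
      simpa using (hasDerivAt_id t).mul_const ⟪g x, v⟫_ℝ
    have e3 : HasDerivAt (fun t : ℝ => t ^ 2 * (⟪H v, v⟫_ℝ / 2)) (t * ⟪H v, v⟫_ℝ) t := by
      have := (hasDerivAt_pow 2 t).mul_const (⟪H v, v⟫_ℝ / 2)
      refine this.congr_deriv ?_
      push_cast; ring
    refine (((e1.sub_const _).sub e2).sub e3).congr_deriv ?_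
    simp only [inner_sub_left, map_smul, real_inner_smul_left]
  obtain ⟨t, ht, hslope⟩ := exists_hasDerivAt_eq_slope
    (fun t : ℝ => f (x + t • v) - f x - t * ⟪g x, v⟫_ℝ - t ^ 2 * (⟪H v, v⟫_ℝ / 2))
    (fun t => ⟪g (x + t • v) - g x - H (t • v), v⟫_ℝ) zero_lt_one
    (fun t ht => (hd t ht).continuousAt.continuousWithinAt)
    (fun t ht => hd t (Ioo_subset_Icc_self ht))
  have hb := (hball _ (hin t (Ioo_subset_Icc_self ht))).1
  have hval : f (x + v) - f x - ⟪g x, v⟫_ℝ - ⟪H v, v⟫_ℝ / 2 =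
      ⟪g (x + t • v) - g x - H (t • v), v⟫_ℝ := by
    rw [hslope]; simp
  rw [hval]
  calc |⟪g (x + t • v) - g x - H (t • v), v⟫_ℝ| ≤ ‖g (x + t • v) - g x - H (t • v)‖ * ‖v‖ :=
        abs_real_inner_le_norm _ _
    _ ≤ (ε * ‖t • v‖) * ‖v‖ := by gcongr
    _ ≤ (ε * ‖v‖) * ‖v‖ := by
        gcongr
        rw [norm_smul, Real.norm_of_nonneg ht.1.le]
        nlinarith [norm_nonneg v, ht.2]
    _ = ε * ‖v‖ ^ 2 := by ring

namespace IsConvexSpacelike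

variable {a : ℝ} {f : Plane → ℝ} {g : Plane → Plane} {H : Plane → Plane →L[ℝ] Plane}

theorem continuous_grad (h : IsConvexSpacelike a f g H) : Continuous g :=
  continuous_iff_continuousAt.2 fun x => (h.hess x).continuousAt

theorem continuous (h : IsConvexSpacelike a f g H) : Continuous f :=
  continuous_iff_continuousAt.2 fun x => (h.grad x).continuousAt

theorem strictMono_inner_grad (h : IsConvexSpacelike a f g H) (x : Plane) {v : Plane}
    (hv : v ≠ 0) : StrictMono fun t : ℝ => ⟪g (x + t • v), v⟫_ℝ := by
  refine strictMono_of_deriv_pos fun t => ?_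
  rw [((h.hess (x + t • v)).hasDerivAt_inner_line (w := v)).deriv]
  exact h.pos _ _ hv

theorem grad_injective (h : IsConvexSpacelike a f g H) : Function.Injective g := by
  intro x y hxy
  by_contra hne
  have h1 := h.strictMono_inner_grad x (sub_ne_zero.2 (Ne.symm hne)) zero_lt_one
  simp [hxy] at h1

/-- The graph lies above its tangent planes. -/
theorem tangent_le (h : IsConvexSpacelike a f g H) (x z : Plane) :
    f x + ⟪g x, z - x⟫_ℝ ≤ f z := by
  rcases eq_or_ne z x with rfl | hne
  · simp
  set v := z - x with hv
  have hd : ∀ t : ℝ, HasDerivAt (fun t : ℝ => f (x + t • v)) ⟪g (x + t • v), v⟫_ℝ t :=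
    fun t => (h.grad _).hasDerivAt_line
  obtain ⟨t, ht, hslope⟩ := exists_hasDerivAt_eq_slope (fun t : ℝ => f (x + t • v))
    (fun t => ⟪g (x + t • v), v⟫_ℝ) zero_lt_one
    (fun t _ => (hd t).continuousAt.continuousWithinAt) (fun t _ => hd t)
  have hm := (h.strictMono_inner_grad x (sub_ne_zero.2 hne)).monotone ht.1.le
  simp only [zero_smul, add_zero, one_smul, sub_zero, div_one] at hm hslope
  rw [hslope] at hm
  rw [← hv] at hm
  have : x + v = z := by rw [hv]; abel
  rw [this] at hm
  linarith

theorem legendre_le (h : IsConvexSpacelike a f g H) (x z : Plane) :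
    ⟪z, g x⟫_ℝ - f z ≤ ⟪x, g x⟫_ℝ - f x := by
  have := h.tangent_le x z
  rw [inner_sub_right, real_inner_comm z, real_inner_comm x] at this
  linarith

/-- A critical point of `z ↦ ⟪z, y⟫ - f z`. -/
theorem grad_eq_of_isMax (h : IsConvexSpacelike a f g H) {x y : Plane}
    (hmax : ∀ z, ⟪z, y⟫_ℝ - f z ≤ ⟪x, y⟫_ℝ - f x) : g x = y := by
  have hd : HasDerivAt (fun t : ℝ => ⟪x + t • (y - g x), y⟫_ℝ - f (x + t • (y - g x)))
      (⟪y - g x, y⟫_ℝ - ⟪g x, y - g x⟫_ℝ) 0 := by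
    have e1 := (_root_.hasDerivAt_line x (y - g x) 0).inner ℝ (hasDerivAt_const (0 : ℝ) y)
    have e2 : HasDerivAt (fun t : ℝ => f (x + t • (y - g x))) ⟪g x, y - g x⟫_ℝ 0 :=
      HasGradientAt.hasDerivAt_line (by simpa using h.grad x)
    exact (e1.sub e2).congr_deriv (by simp)
  have hloc : IsLocalMax (fun t : ℝ => ⟪x + t • (y - g x), y⟫_ℝ - f (x + t • (y - g x))) 0 :=
    Eventually.of_forall fun t => by simpa using hmax (x + t • (y - g x))
  have h0 := hloc.hasDerivAt_eq_zero hd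
  rw [real_inner_comm, ← inner_sub_left, real_inner_self_eq_norm_sq] at h0
  have : y - g x = 0 := by simpa using h0
  exact (sub_eq_zero.1 this).symm

end IsConvexSpacelike

/-! ## Determinants in the plane -/

/-- Multiplied by `p`, the quantity is the second form at `(-q, p)` plus `p' * (p * r - q ^ 2)`.
Only `p = 0` needs separate treatment, and there `q = 0`. Taking both forms equal gives twice the
discriminant. -/
theorem mixed_discriminant_nonneg {p q r p' q' r' : ℝ}
    (h : ∀ x y : ℝ, 0 ≤ p * x ^ 2 + 2 * q * x * y + r * y ^ 2)
    (h' : ∀ x y : ℝ, 0 ≤ p' * x ^ 2 + 2 * q' * x * y + r' * y ^ 2) :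
    0 ≤ p * r' + r * p' - 2 * q * q' := by
  have hp : 0 ≤ p := by simpa using h 1 0
  have hr : 0 ≤ r := by simpa using h 0 1
  have hp' : 0 ≤ p' := by simpa using h' 1 0
  have hdet : q ^ 2 ≤ p * r := by
    rcases hp.eq_or_lt with h0 | h0
    · have h1 := h (-(r + 1) * q) (q ^ 2)
      -- For `p = 0` the form takes the value `-(r + 2) * q ^ 2` here, which forces `q = 0`.
      have h2 := h (-(r + 1)) q
      rw [← h0] at h2 ⊢
      nlinarith [sq_nonneg q]
    · have := h (-q) p
      have h3 : 0 ≤ p * (p * r - q ^ 2) := by nlinarith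
      have := nonneg_of_mul_nonneg_right h3 h0
      linarith
  rcases hp.eq_or_lt with h0 | h0
  · rw [← h0] at hdet ⊢
    have : q = 0 := by nlinarith
    rw [this]
    nlinarith [mul_nonneg hr hp']
  · have h1 := h' (-q) p
    have h3 : 0 ≤ p * (p * r' + r * p' - 2 * q * q') := by
      nlinarith [mul_nonneg hp' (sub_nonneg.2 hdet)]
    exact nonneg_of_mul_nonneg_right h3 h0

theorem discriminant_nonneg {p q r : ℝ}
    (h : ∀ x y : ℝ, 0 ≤ p * x ^ 2 + 2 * q * x * y + r * y ^ 2) : 0 ≤ p * r - q ^ 2 := by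
  have := mixed_discriminant_nonneg h h
  linarith

theorem det_plane (A : Plane →L[ℝ] Plane) :
    A.det = A (EuclideanSpace.single 0 1) 0 * A (EuclideanSpace.single 1 1) 1 -
      A (EuclideanSpace.single 1 1) 0 * A (EuclideanSpace.single 0 1) 1 := by
  rw [ContinuousLinearMap.det, ← LinearMap.det_toMatrix (EuclideanSpace.basisFun (Fin 2) ℝ).toBasis,
    Matrix.det_fin_two]
  simp [LinearMap.toMatrix_apply]

theorem det_comp_plane (A B : Plane →L[ℝ] Plane) : (A ∘L B).det = A.det * B.det := by
  simp [ContinuousLinearMap.det]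

theorem plane_eq (v : Plane) :
    v = v 0 • EuclideanSpace.single 0 1 + v 1 • EuclideanSpace.single 1 1 := by
  ext i; fin_cases i <;> simp

theorem inner_plane (v w : Plane) : ⟪v, w⟫_ℝ = v 0 * w 0 + v 1 * w 1 := by
  simp [PiLp.inner_apply, Fin.sum_univ_two, mul_comm]

theorem norm_sq_plane (v : Plane) : ‖v‖ ^ 2 = v 0 ^ 2 + v 1 ^ 2 := by
  rw [← real_inner_self_eq_norm_sq, inner_plane]; ring

theorem quadratic_form_plane {A : Plane →L[ℝ] Plane} (hA : ∀ v w, ⟪A v, w⟫_ℝ = ⟪v, A w⟫_ℝ)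
    (x y : ℝ) : ⟪A !₂[x, y], !₂[x, y]⟫_ℝ =
      A (EuclideanSpace.single 0 1) 0 * x ^ 2 + 2 * A (EuclideanSpace.single 0 1) 1 * x * y
        + A (EuclideanSpace.single 1 1) 1 * y ^ 2 := by
  have h01 := hA (EuclideanSpace.single 0 1) (EuclideanSpace.single 1 1)
  simp only [inner_plane, PiLp.single_apply] at h01
  have : (!₂[x, y] : Plane) = x • EuclideanSpace.single 0 1 + y • EuclideanSpace.single 1 1 := by
    ext i; fin_cases i <;> simp
  rw [inner_plane]
  simp only [this, map_add, map_smul]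
  simp at h01 ⊢
  rw [← h01]
  ring

theorem symm_entry_plane {A : Plane →L[ℝ] Plane} (hA : ∀ v w, ⟪A v, w⟫_ℝ = ⟪v, A w⟫_ℝ) :
    A (EuclideanSpace.single 1 1) 0 = A (EuclideanSpace.single 0 1) 1 := by
  have h01 := hA (EuclideanSpace.single 0 1) (EuclideanSpace.single 1 1)
  simp only [inner_plane, PiLp.single_apply] at h01
  simpa using h01.symm

theorem det_nonneg_plane {A : Plane →L[ℝ] Plane} (hA : ∀ v w, ⟪A v, w⟫_ℝ = ⟪v, A w⟫_ℝ)
    (hpos : ∀ v, 0 ≤ ⟪A v, v⟫_ℝ) : 0 ≤ A.det := by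
  have := discriminant_nonneg fun x y => (quadratic_form_plane hA x y) ▸ hpos !₂[x, y]
  rw [det_plane, symm_entry_plane hA]
  linarith

/-- `det B` is `det A`, plus the mixed discriminant of `A` and `B - A`, plus `det (B - A)`; the last
two terms are nonnegative. -/
theorem det_mono_plane {A B : Plane →L[ℝ] Plane} (hA : ∀ v w, ⟪A v, w⟫_ℝ = ⟪v, A w⟫_ℝ)
    (hB : ∀ v w, ⟪B v, w⟫_ℝ = ⟪v, B w⟫_ℝ) (hpos : ∀ v, 0 ≤ ⟪A v, v⟫_ℝ)
    (hle : ∀ v, ⟪A v, v⟫_ℝ ≤ ⟪B v, v⟫_ℝ) : A.det ≤ B.det := by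
  have h1 := fun x y => (quadratic_form_plane hA x y) ▸ hpos !₂[x, y]
  have h2 : ∀ x y : ℝ, 0 ≤
      (B (EuclideanSpace.single 0 1) 0 - A (EuclideanSpace.single 0 1) 0) * x ^ 2
      + 2 * (B (EuclideanSpace.single 0 1) 1 - A (EuclideanSpace.single 0 1) 1) * x * y
      + (B (EuclideanSpace.single 1 1) 1 - A (EuclideanSpace.single 1 1) 1) * y ^ 2 := by
    intro x y
    have := hle !₂[x, y]
    rw [quadratic_form_plane hA, quadratic_form_plane hB] at this
    linarith
  have h3 := mixed_discriminant_nonneg h1 h2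
  have h4 := discriminant_nonneg h2
  rw [det_plane, det_plane, symm_entry_plane hA, symm_entry_plane hB]
  linarith

/-- The hypothesis says `H W H ≤ H` as quadratic forms, so `det H * det (W H) ≤ det H`. This is how
`W ≤ H⁻¹` is used without inverting `H`. -/
theorem det_comp_le_one {H W : Plane →L[ℝ] Plane} (hH : ∀ v w, ⟪H v, w⟫_ℝ = ⟪v, H w⟫_ℝ)
    (hW : ∀ v w, ⟪W v, w⟫_ℝ = ⟪v, W w⟫_ℝ) (hWpos : ∀ v, 0 ≤ ⟪W v, v⟫_ℝ)
    (hle : ∀ v, ⟪W (H v), H v⟫_ℝ ≤ ⟪H v, v⟫_ℝ) : (W ∘L H).det ≤ 1 := by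
  have h1 : (H ∘L (W ∘L H)).det ≤ H.det := by
    refine det_mono_plane (fun v w => ?_) hH (fun v => ?_) (fun v => ?_)
    · simp [hH, hW]
    · simpa [hH] using hWpos (H v)
    · simpa [hH] using hle v
  have h0 : 0 ≤ H.det := by
    refine det_nonneg_plane hH fun v => (hWpos (H v)).trans (hle v)
  rw [det_comp_plane, det_comp_plane] at *
  rcases h0.eq_or_lt with h0 | h0
  · rw [← h0]; simp
  · nlinarith

/-! ## The Legendre transform and the comparison principle -/

/-- The Legendre transform of `f`. -/
def legendre (f : Plane → ℝ) (y : Plane) : EReal := ⨆ x, ((⟪x, y⟫_ℝ - f x : ℝ) : EReal)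

theorem le_legendre (f : Plane → ℝ) (x y : Plane) :
    ((⟪x, y⟫_ℝ - f x : ℝ) : EReal) ≤ legendre f y :=
  le_iSup (fun x => ((⟪x, y⟫_ℝ - f x : ℝ) : EReal)) x

theorem legendre_le_coe {f : Plane → ℝ} {y : Plane} {t : ℝ} :
    legendre f y ≤ t ↔ ∀ x, ⟪x, y⟫_ℝ - f x ≤ t := by
  simp only [legendre, iSup_le_iff, EReal.coe_le_coe_iff]

theorem coe_lt_legendre {f : Plane → ℝ} {y : Plane} {t : ℝ} :
    (t : EReal) < legendre f y ↔ ∃ x, t < ⟪x, y⟫_ℝ - f x := by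
  simp only [legendre, lt_iSup_iff, EReal.coe_lt_coe_iff]

theorem legendre_ne_bot (f : Plane → ℝ) (y : Plane) : legendre f y ≠ ⊥ :=
  ne_bot_of_le_ne_bot (EReal.coe_ne_bot _) (le_legendre f 0 y)

theorem exists_legendre_eq_coe {f : Plane → ℝ} {y : Plane} (h : legendre f y ≠ ⊤) :
    ∃ t : ℝ, legendre f y = t :=
  ⟨_, (EReal.coe_toReal h (legendre_ne_bot f y)).symm⟩

/-- A lower semicontinuous function attains its minimum on a compact set. The minimum `m` of
`legendre f - w` is recorded through real inequalities on the affine functions defining the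
supremum, because the Legendre transform may be infinite at other points of `R`. -/
theorem exists_isMinOn_legendre_sub {f w : Plane → ℝ} {R : Set Plane} (hR : IsCompact R)
    (hw : ContinuousOn w R) {z : Plane} (hz : z ∈ R) (hlt : legendre f z < w z) :
    ∃ y ∈ R, ∃ m < 0, (∀ x, ⟪x, y⟫_ℝ - f x ≤ w y + m) ∧
      ∀ z ∈ R, ∀ s < m, ∃ x, s < ⟪x, z⟫_ℝ - f x - w z := by
  -- Moving `w` inside the supremum avoids subtraction in `EReal` and exhibits a supremum of
  -- continuous functions.
  set Φ : Plane → EReal := fun y => ⨆ x, ((⟪x, y⟫_ℝ - f x - w y : ℝ) : EReal) with hΦ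
  have hlsc : LowerSemicontinuousOn Φ R := by
    refine lowerSemicontinuousOn_iSup fun x => ContinuousOn.lowerSemicontinuousOn ?_
    refine continuous_coe_real_ereal.comp_continuousOn ?_
    fun_prop
  obtain ⟨y, hyR, hmin⟩ := LowerSemicontinuousOn.exists_isMinOn ⟨z, hz⟩ hR hlsc
  obtain ⟨t, ht⟩ := exists_legendre_eq_coe (ne_top_of_lt hlt)
  have hzt : Φ z ≤ ((t - w z : ℝ) : EReal) := by
    refine iSup_le fun x => ?_
    have := legendre_le_coe.1 ht.le x
    exact_mod_cast by linarith
  have hyt : Φ y ≤ ((t - w z : ℝ) : EReal) := (hmin hz).trans hzt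
  have hbot : Φ y ≠ ⊥ := ne_bot_of_le_ne_bot (EReal.coe_ne_bot _)
    (le_iSup (fun x => ((⟪x, y⟫_ℝ - f x - w y : ℝ) : EReal)) 0)
  have htop : Φ y ≠ ⊤ := ne_top_of_le_ne_top (EReal.coe_ne_top _) hyt
  obtain ⟨m, hm⟩ : ∃ m : ℝ, Φ y = m := ⟨_, (EReal.coe_toReal htop hbot).symm⟩
  refine ⟨y, hyR, m, ?_, fun x => ?_, fun z' hz' s hs => ?_⟩
  · rw [hm] at hyt
    rw [ht] at hlt
    have h1 : m ≤ t - w z := by exact_mod_cast hyt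
    have h2 : t < w z := by exact_mod_cast hlt
    linarith
  · have h1 : ((⟪x, y⟫_ℝ - f x - w y : ℝ) : EReal) ≤ m :=
      hm ▸ le_iSup (fun x => ((⟪x, y⟫_ℝ - f x - w y : ℝ) : EReal)) x
    have h2 : ⟪x, y⟫_ℝ - f x - w y ≤ m := by exact_mod_cast h1
    linarith
  · have h1 : (s : EReal) < Φ z' :=
      lt_of_lt_of_le (by rw [hm]; exact_mod_cast hs) (hmin hz')
    obtain ⟨x, hx⟩ := lt_iSup_iff.1 h1
    exact ⟨x, by exact_mod_cast hx⟩

/-- `W` is a Hessian, in the sense of Peano lower bounds, of `w` at `y`, with gradient `q`. -/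
structure HasLowerTaylor (w : Plane → ℝ) (q : Plane) (W : Plane →L[ℝ] Plane) (y : Plane) :
    Prop where
  symm : ∀ v u, ⟪W v, u⟫_ℝ = ⟪v, W u⟫_ℝ
  nonneg : ∀ v, 0 ≤ ⟪W v, v⟫_ℝ
  le : ∀ ε > 0, ∀ᶠ v in 𝓝 (0 : Plane),
    w y + ⟪q, v⟫_ℝ + ⟪W v, v⟫_ℝ / 2 - ε * ‖v‖ ^ 2 ≤ w (y + v)

/-! ### Functions touching the Legendre transform from below. -/

namespace IsConvexSpacelike

variable {a : ℝ} {f : Plane → ℝ} {g : Plane → Plane} {H : Plane → Plane →L[ℝ] Plane}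

/-- If `legendre f - w` has a local minimum at `y`, then the gradient of `w` at `y` is a
subgradient of the Legendre transform. -/
theorem grad_eq_of_touching (h : IsConvexSpacelike a f g H) {R : Set Plane} {w : Plane → ℝ}
    {q y : Plane} {W : Plane →L[ℝ] Plane} {m : ℝ} (hR : R ∈ 𝓝 y) (hT : HasLowerTaylor w q W y)
    (hle : ∀ x, ⟪x, y⟫_ℝ - f x ≤ w y + m)
    (hge : ∀ z ∈ R, ∀ s < m, ∃ x, s < ⟪x, z⟫_ℝ - f x - w z) :
    w y + m = ⟪q, y⟫_ℝ - f q ∧ g q = y := by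
  -- The test direction points to `g q`, where the supremum defining the Legendre transform is
  -- attained at `q`. Comparing slopes on the segment from `y` to `g q` shows that `q` also attains
  -- the supremum at `y`, hence is a critical point there.
  set d := g q - y with hd
  have hline : Tendsto (fun t : ℝ => t • d) (𝓝[>] 0) (𝓝 0) := by
    have : Continuous (fun t : ℝ => t • d) := by fun_prop
    have h1 := this.tendsto 0
    rw [zero_smul] at h1
    exact h1.mono_left nhdsWithin_le_nhds
  have hline' : Tendsto (fun t : ℝ => y + t • d) (𝓝[>] 0) (𝓝 y) := by
    simpa using hline.const_add y
  have hev : ∀ᶠ t : ℝ in 𝓝[>] 0,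
      ⟪q, d⟫_ℝ - t * ‖d‖ ^ 2 ≤ ⟪q, g q⟫_ℝ - f q - w y - m := by
    have hsmall : ∀ᶠ t : ℝ in 𝓝[>] 0, t < 1 :=
      nhdsWithin_le_nhds (Iio_mem_nhds zero_lt_one)
    filter_upwards [hline.eventually (hT.le 1 one_pos), hline'.eventually hR, self_mem_nhdsWithin,
      hsmall] with t h1 h2 h3 h4
    have h3 : 0 < t := h3
    -- Convexity of the Legendre transform on that segment, in terms of the affine functions
    -- defining it.
    have hup : w (y + t • d) + m ≤ (1 - t) * (w y + m) + t * (⟪q, g q⟫_ℝ - f q) := by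
      by_contra hcon
      push Not at hcon
      obtain ⟨x, hx⟩ := hge _ h2
        ((1 - t) * (w y + m) + t * (⟪q, g q⟫_ℝ - f q) - w (y + t • d)) (by linarith)
      have e1 : ⟪x, y + t • d⟫_ℝ - f x =
          (1 - t) * (⟪x, y⟫_ℝ - f x) + t * (⟪x, g q⟫_ℝ - f x) := by
        rw [inner_add_right, inner_smul_right, hd, inner_sub_right]; ring
      have e2 := mul_le_mul_of_nonneg_left (hle x) (by linarith : 0 ≤ 1 - t)
      have e3 := mul_le_mul_of_nonneg_left (h.legendre_le q x) h3.le
      linarith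
    have hn := hT.nonneg (t • d)
    rw [norm_smul, Real.norm_of_nonneg h3.le, inner_smul_right] at h1
    have : t * (⟪q, d⟫_ℝ - t * ‖d‖ ^ 2) ≤ t * (⟪q, g q⟫_ℝ - f q - w y - m) := by nlinarith
    exact le_of_mul_le_mul_left this h3
  have hlim : Tendsto (fun t : ℝ => ⟪q, d⟫_ℝ - t * ‖d‖ ^ 2) (𝓝[>] 0) (𝓝 ⟪q, d⟫_ℝ) := by
    have : Continuous (fun t : ℝ => ⟪q, d⟫_ℝ - t * ‖d‖ ^ 2) := by fun_prop
    have h1 := this.tendsto 0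
    simp only [zero_mul, sub_zero] at h1
    exact h1.mono_left nhdsWithin_le_nhds
  have hfin := le_of_tendsto hlim hev
  rw [hd, inner_sub_right] at hfin
  have heq : w y + m = ⟪q, y⟫_ℝ - f q := le_antisymm (by linarith) (hle q)
  exact ⟨heq, h.grad_eq_of_isMax fun z => heq ▸ hle z⟩

/-- Along the curve `t ↦ g (q + t • v)` the Legendre transform is known exactly, since the supremum
is attained at `q + t • v`. Comparing its expansion with that of `w` to second order gives the
inequality, which stands for `W ≤ (H q)⁻¹` tested on `H q v`. No second derivative of the Legendre
transform is needed. -/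
theorem hessian_le_of_touching (h : IsConvexSpacelike a f g H) {R : Set Plane} {w : Plane → ℝ}
    {q y : Plane} {W : Plane →L[ℝ] Plane} {m : ℝ} (hR : R ∈ 𝓝 y) (hT : HasLowerTaylor w q W y)
    (hle : ∀ x, ⟪x, y⟫_ℝ - f x ≤ w y + m)
    (hge : ∀ z ∈ R, ∀ s < m, ∃ x, s < ⟪x, z⟫_ℝ - f x - w z) (v : Plane) :
    ⟪W (H q v), H q v⟫_ℝ ≤ ⟪H q v, v⟫_ℝ := by
  obtain ⟨heq, hgq⟩ := h.grad_eq_of_touching hR hT hle hge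
  set η : ℝ → Plane := fun t => t⁻¹ • (g (q + t • v) - g q) with hη
  have hηlim : Tendsto η (𝓝[≠] 0) (𝓝 (H q v)) := by
    have h1 : HasFDerivAt g (H q) (q + (0 : ℝ) • v) := by simpa using h.hess q
    have := (h1.comp_hasDerivAt (0 : ℝ) (_root_.hasDerivAt_line q v 0)).tendsto_slope_zero
    simpa [hη] using this
  have hv0 : Tendsto (fun t : ℝ => t • v) (𝓝[≠] 0) (𝓝 0) := by
    have : Continuous (fun t : ℝ => t • v) := by fun_prop
    have h1 := this.tendsto 0
    rw [zero_smul] at h1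
    exact h1.mono_left nhdsWithin_le_nhds
  have hg0 : Tendsto (fun t : ℝ => g (q + t • v)) (𝓝[≠] 0) (𝓝 y) := by
    have : Continuous (fun t : ℝ => g (q + t • v)) := h.continuous_grad.comp (by fun_prop)
    have h1 := this.tendsto 0
    rw [zero_smul, add_zero, hgq] at h1
    exact h1.mono_left nhdsWithin_le_nhds
  have hη0 : Tendsto (fun t : ℝ => g (q + t • v) - y) (𝓝[≠] 0) (𝓝 0) := by
    simpa using hg0.sub_const y
  have key : ∀ ε > 0, ⟪W (H q v), H q v⟫_ℝ / 2 ≤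
      ⟪v, H q v⟫_ℝ - ⟪H q v, v⟫_ℝ / 2 + ε * ‖v‖ ^ 2 + ε * ‖H q v‖ ^ 2 := by
    intro ε hε
    have htay := eventually_taylor_two (Eventually.of_forall h.grad) (h.hess q) hε
    have hev : ∀ᶠ t : ℝ in 𝓝[≠] 0, ⟪W (η t), η t⟫_ℝ / 2 ≤
        ⟪v, η t⟫_ℝ - ⟪H q v, v⟫_ℝ / 2 + ε * ‖v‖ ^ 2 + ε * ‖η t‖ ^ 2 := by
      filter_upwards [hv0.eventually htay, hη0.eventually (hT.le ε hε), hg0.eventually hR,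
        self_mem_nhdsWithin] with t h1 h2 h3 h4
      have h4 : t ≠ 0 := h4
      have hgt : g (q + t • v) = y + t • η t := by
        simp [hη, smul_inv_smul₀ h4, hgq]
      rw [hgt, add_sub_cancel_left] at h2
      have h5 : w (y + t • η t) + m ≤ ⟪q + t • v, y + t • η t⟫_ℝ - f (q + t • v) := by
        by_contra hcon
        push Not at hcon
        rw [← hgt] at hcon
        obtain ⟨x, hx⟩ := hge _ h3
          (⟪q + t • v, g (q + t • v)⟫_ℝ - f (q + t • v) - w (g (q + t • v))) (by linarith)
        have := h.legendre_le (q + t • v) x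
        linarith
      have h6 := (abs_le.1 h1).1
      rw [hgq] at h6
      simp only [inner_add_left, inner_add_right, inner_smul_right, real_inner_smul_left, map_smul,
        norm_smul, Real.norm_eq_abs, mul_pow, sq_abs] at h2 h5 h6
      rw [real_inner_comm v y] at h6
      -- The terms of orders zero and one cancel by `heq` and `hgq`, so what remains can be divided
      -- by `t ^ 2`.
      have h7 : t ^ 2 * (⟪W (η t), η t⟫_ℝ / 2) ≤ t ^ 2 *
          (⟪v, η t⟫_ℝ - ⟪H q v, v⟫_ℝ / 2 + ε * ‖v‖ ^ 2 + ε * ‖η t‖ ^ 2) := by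
        nlinarith
      exact le_of_mul_le_mul_left h7 (by positivity)
    refine le_of_tendsto_of_tendsto ?_ ?_ hev
    · exact (((W.continuous.tendsto _).comp hηlim).inner hηlim).div_const 2
    · exact ((((tendsto_const_nhds.inner hηlim).sub_const _).add_const _)).add
        ((hηlim.norm.pow 2).const_mul ε)
  have hlim : Tendsto (fun ε : ℝ => ⟪v, H q v⟫_ℝ - ⟪H q v, v⟫_ℝ / 2 + ε * ‖v‖ ^ 2 +
      ε * ‖H q v‖ ^ 2) (𝓝[>] 0) (𝓝 (⟪v, H q v⟫_ℝ - ⟪H q v, v⟫_ℝ / 2)) := by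
    have : Continuous (fun ε : ℝ => ⟪v, H q v⟫_ℝ - ⟪H q v, v⟫_ℝ / 2 + ε * ‖v‖ ^ 2 +
      ε * ‖H q v‖ ^ 2) := by fun_prop
    have h1 := this.tendsto 0
    simp only [zero_mul, add_zero] at h1
    exact h1.mono_left nhdsWithin_le_nhds
  have := ge_of_tendsto hlim (by filter_upwards [self_mem_nhdsWithin] with ε hε using key ε hε)
  rw [real_inner_comm (H q v) v] at this
  linarith

/-- The comparison principle for the Monge–Ampère inequality satisfied by the Legendre
transform. -/
theorem le_legendre_of_comparison (h : IsConvexSpacelike a f g H) {R P : Set Plane}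
    {w : Plane → ℝ} (hR : IsCompact R) (hw : ContinuousOn w R)
    (hout : ∀ y ∈ R, y ∉ P → (w y : EReal) ≤ legendre f y)
    (hP : ∀ y ∈ P, R ∈ 𝓝 y ∧ ∃ q W, HasLowerTaylor w q W y ∧
      ∀ x, g x = y → 1 < (W ∘L H x).det) {y : Plane} (hy : y ∈ R) :
    (w y : EReal) ≤ legendre f y := by
  by_contra hcon
  push Not at hcon
  obtain ⟨z, hzR, m, hm, hle, hge⟩ := exists_isMinOn_legendre_sub hR hw hy hcon
  -- The minimum `m` of the difference is negative, whereas the difference is nonnegative on `R`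
  -- outside `P`.
  have hzP : z ∈ P := by
    by_contra hzP
    have h1 : (w z : EReal) ≤ ((w z + m : ℝ) : EReal) :=
      (hout z hzR hzP).trans (legendre_le_coe.2 hle)
    have h2 : w z ≤ w z + m := by exact_mod_cast h1
    linarith
  obtain ⟨hRz, q, W, hT, hdet⟩ := hP z hzP
  have hgq := (h.grad_eq_of_touching hRz hT hle hge).2
  exact absurd (hdet q hgq) (not_lt.2 (det_comp_le_one (h.symm q) hT.symm hT.nonneg
    (h.hessian_le_of_touching hRz hT hle hge)))

end IsConvexSpacelike

/-! ## The hyperboloid -/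

theorem one_sub_norm_sq_pos {y : Plane} (hy : ‖y‖ < 1) : 0 < 1 - ‖y‖ ^ 2 := by
  nlinarith [norm_nonneg y]

theorem hasFDerivAt_norm_sq_plane (y : Plane) :
    HasFDerivAt (fun z : Plane => 1 - ‖z‖ ^ 2) (-((2 : ℝ) • innerSL ℝ y)) y := by
  have := (hasStrictFDerivAt_norm_sq y).hasFDerivAt.const_sub 1
  refine this.congr_fderiv ?_
  ext; simp

theorem hasFDerivAt_sqrt_one_sub {y : Plane} (hy : ‖y‖ < 1) :
    HasFDerivAt (fun z : Plane => √(1 - ‖z‖ ^ 2)) (-((√(1 - ‖y‖ ^ 2))⁻¹ • innerSL ℝ y)) y := by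
  have hs := one_sub_norm_sq_pos hy
  refine ((hasFDerivAt_norm_sq_plane y).sqrt hs.ne').congr_fderiv ?_
  have : √(1 - ‖y‖ ^ 2) ≠ 0 := (Real.sqrt_pos.2 hs).ne'
  ext v
  simp
  field_simp

theorem hasGradientAt_neg_sqrt {y : Plane} (hy : ‖y‖ < 1) :
    HasGradientAt (fun z : Plane => -√(1 - ‖z‖ ^ 2)) ((√(1 - ‖y‖ ^ 2))⁻¹ • y) y := by
  rw [hasGradientAt_iff_hasFDerivAt]
  refine (hasFDerivAt_sqrt_one_sub hy).neg.congr_fderiv ?_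
  ext v
  simp

theorem hasFDerivAt_inv_sqrt_smul {y : Plane} (hy : ‖y‖ < 1) :
    HasFDerivAt (fun z : Plane => (√(1 - ‖z‖ ^ 2))⁻¹ • z) (hyperboloidHessian y) y := by
  have hs := one_sub_norm_sq_pos hy
  have hs' : √(1 - ‖y‖ ^ 2) ≠ 0 := (Real.sqrt_pos.2 hs).ne'
  have h1 := ((hasDerivAt_inv hs').comp_hasFDerivAt y (hasFDerivAt_sqrt_one_sub hy)).smul
    (hasFDerivAt_id y)
  refine h1.congr_fderiv ?_
  ext v i
  simp [hyperboloidHessian]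
  field_simp

theorem hyperboloidHessian_symm (y v w : Plane) :
    ⟪hyperboloidHessian y v, w⟫_ℝ = ⟪v, hyperboloidHessian y w⟫_ℝ := by
  simp [hyperboloidHessian, inner_add_left, inner_add_right, real_inner_smul_left,
    inner_smul_right, real_inner_comm v y]
  left; ring

theorem hyperboloidHessian_nonneg (y v : Plane) : 0 ≤ ⟪hyperboloidHessian y v, v⟫_ℝ := by
  simp only [hyperboloidHessian, inner_add_left, real_inner_smul_left,
    add_apply, smul_apply, ContinuousLinearMap.id_apply,
    ContinuousLinearMap.smulRight_apply, innerSL_apply_apply]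
  have h1 : 0 ≤ (√(1 - ‖y‖ ^ 2))⁻¹ := by positivity
  have h2 : 0 ≤ ⟪v, v⟫_ℝ := real_inner_self_nonneg
  have h3 := mul_self_nonneg ⟪y, v⟫_ℝ
  positivity

/-- With `s = √(1 - ‖y‖²)`, the eigenvalues are `s⁻¹` across `y` and `s⁻¹ + s⁻³ ‖y‖² = s⁻³` along
`y`. -/
theorem det_hyperboloidHessian {y : Plane} (hy : ‖y‖ < 1) :
    (hyperboloidHessian y).det = ((1 - ‖y‖ ^ 2) ^ 2)⁻¹ := by
  have hs := one_sub_norm_sq_pos hy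
  set s := √(1 - ‖y‖ ^ 2) with hsdef
  have hs' : 0 < s := Real.sqrt_pos.2 hs
  have hss : s ^ 2 = 1 - ‖y‖ ^ 2 := Real.sq_sqrt hs.le
  have hn := norm_sq_plane y
  rw [← hss, det_plane]
  simp [hyperboloidHessian, ← hsdef, inner_plane]
  field_simp
  nlinarith

theorem hyperboloidHessian_neg (y : Plane) : hyperboloidHessian (-y) = hyperboloidHessian y := by
  ext v i; simp [hyperboloidHessian]

/-! ## Boundary behaviour of the Legendre transform -/

theorem HasLowerTaylor.of_hasGradientAt {w : Plane → ℝ} {gw : Plane → Plane}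
    {W : Plane →L[ℝ] Plane} {y : Plane} (hw : ∀ᶠ z in 𝓝 y, HasGradientAt w (gw z) z)
    (hgw : HasFDerivAt gw W y) (hsymm : ∀ v u, ⟪W v, u⟫_ℝ = ⟪v, W u⟫_ℝ)
    (hpos : ∀ v, 0 ≤ ⟪W v, v⟫_ℝ) : HasLowerTaylor w (gw y) W y where
  symm := hsymm
  nonneg := hpos
  le ε hε := by
    filter_upwards [eventually_taylor_two hw hgw hε] with v hv
    have := (abs_le.1 hv).1
    linarith

theorem EReal.eq_top_of_forall_affine_le {u : EReal} {A B : ℝ} (hB : 0 < B)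
    (h : ∀ N : ℝ, 0 ≤ N → ((A + N * B : ℝ) : EReal) ≤ u) : u = ⊤ := by
  rw [EReal.eq_top_iff_forall_lt]
  intro t
  refine lt_of_lt_of_le ?_ (h ((|t| + |A| + 1) / B) (by positivity))
  rw [EReal.coe_lt_coe_iff, div_mul_cancel₀ _ hB.ne']
  linarith [le_abs_self t, neg_abs_le A]

/-! ### The barrier over a circular cap. -/

namespace IsConvexSpacelike

variable {a : ℝ} {f : Plane → ℝ} {g : Plane → Plane} {H : Plane → Plane →L[ℝ] Plane}

theorem neg_le_legendre (f : Plane → ℝ) (y : Plane) : ((-f 0 : ℝ) : EReal) ≤ legendre f y := by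
  simpa using le_legendre f 0 y

/-- If the Legendre transform is infinite on an arc of the unit circle, it is infinite on the
circular segment cut by the arc. -/
theorem legendre_eq_top_of_arc (h : IsConvexSpacelike a f g H) (ha : 0 < a) {e : Plane} {c : ℝ}
    (harc : ∀ ξ : Plane, ‖ξ‖ = 1 → c < ⟪ξ, e⟫_ℝ → legendre f ξ = ⊤) {y : Plane} (hy : ‖y‖ ≤ 1)
    (hyc : c < ⟪y, e⟫_ℝ) : legendre f y = ⊤ := by
  -- Scaling the hyperboloid by `r` multiplies its Monge–Ampère determinant by `r ^ 2`; `r ^ 2 * a >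
  -- 1` is what the comparison principle asks for.
  obtain ⟨r, hr0, hr⟩ : ∃ r : ℝ, 0 < r ∧ 1 < r ^ 2 * a := by
    refine ⟨√(2 / a), by positivity, ?_⟩
    rw [Real.sq_sqrt (by positivity), div_mul_cancel₀ _ ha.ne']
    norm_num
  refine EReal.eq_top_of_forall_affine_le (A := r * -√(1 - ‖y‖ ^ 2) - f 0) (sub_pos.2 hyc)
    fun N hN => ?_
  -- The affine term does not change the Hessian, so `N` is free. On the chord this term vanishes
  -- and `w ≤ -f 0`, a lower bound of the Legendre transform; on the arc the transform is infinite.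
  set w : Plane → ℝ := fun z => r * -√(1 - ‖z‖ ^ 2) - f 0 + N * (⟪z, e⟫_ℝ - c) with hw
  have hnhds : ∀ z : Plane, ‖z‖ < 1 → ∀ᶠ z' in 𝓝 z, ‖z'‖ < 1 := fun z hz =>
    (continuous_norm.isOpen_preimage _ isOpen_Iio).mem_nhds hz
  have hgrad : ∀ z : Plane, ‖z‖ < 1 →
      HasGradientAt w (r • ((√(1 - ‖z‖ ^ 2))⁻¹ • z) + N • e) z := by
    intro z hz
    rw [hasGradientAt_iff_hasFDerivAt]
    have h1 := ((hasGradientAt_neg_sqrt hz).hasFDerivAt.const_mul r).sub_const (f 0)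
    have h2 : HasFDerivAt (fun z : Plane => N * (⟪z, e⟫_ℝ - c)) (N • innerSL ℝ e) z := by
      have := (((innerSL ℝ e).hasFDerivAt (x := z)).sub_const c).const_mul N
      simpa [real_inner_comm] using this
    refine (h1.add h2).congr_fderiv ?_
    ext v; simp
  refine h.le_legendre_of_comparison (R := Metric.closedBall 0 1 ∩ {z | c ≤ ⟪z, e⟫_ℝ})
    (P := {z | ‖z‖ < 1 ∧ c < ⟪z, e⟫_ℝ}) (w := w) ?_ ?_ ?_ ?_ ⟨by simpa using hy, hyc.le⟩
  · exact (isCompact_closedBall _ _).inter_right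
      (isClosed_le continuous_const (by fun_prop))
  · exact Continuous.continuousOn (by fun_prop)
  · rintro z ⟨hz1, hz2⟩ hzP
    rw [mem_closedBall_zero_iff] at hz1
    rcases (show c ≤ ⟪z, e⟫_ℝ from hz2).eq_or_lt with heq | hlt
    · refine le_trans ?_ (neg_le_legendre f z)
      rw [EReal.coe_le_coe_iff, hw]
      simp only [← heq]
      have : 0 ≤ r * √(1 - ‖z‖ ^ 2) := by positivity
      linarith
    · have : ‖z‖ = 1 := le_antisymm hz1 (not_lt.1 fun h1 => hzP ⟨h1, hlt⟩)
      rw [harc z this hlt]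
      exact le_top
  · rintro z ⟨hz1, hz2⟩
    refine ⟨?_, _, r • hyperboloidHessian z, HasLowerTaylor.of_hasGradientAt
      ((hnhds z hz1).mono hgrad) ?_ ?_ ?_, ?_⟩
    · have : IsOpen {z : Plane | ‖z‖ < 1 ∧ c < ⟪z, e⟫_ℝ} :=
        (isOpen_lt continuous_norm continuous_const).inter
          (isOpen_lt continuous_const (by fun_prop : Continuous fun z : Plane => ⟪z, e⟫_ℝ))
      refine mem_of_superset (this.mem_nhds ⟨hz1, hz2⟩) fun z' hz' => ⟨?_, hz'.2.le⟩
      simpa using hz'.1.le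
    · exact ((hasFDerivAt_inv_sqrt_smul hz1).const_smul r).add_const _
    · intro v u
      simp [real_inner_smul_left, inner_smul_right, hyperboloidHessian_symm]
    · intro v
      simp only [smul_apply, real_inner_smul_left]
      exact mul_nonneg hr0.le (hyperboloidHessian_nonneg z v)
    · intro x hx
      have h1 := h.curv x
      rw [hx] at h1
      have h2 : ((r • hyperboloidHessian z) ∘L H x).det =
          r ^ 2 * (hyperboloidHessian z ∘L H x).det := by
        rw [det_plane, det_plane]; simp; ring
      rw [h2]
      exact lt_of_lt_of_le hr (mul_le_mul_of_nonneg_left h1 (by positivity))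

theorem det_hess_ge (h : IsConvexSpacelike a f g H) (x : Plane) :
    a * (1 - ‖g x‖ ^ 2) ^ 2 ≤ (H x).det := by
  have h1 := h.curv x
  have h2 := one_sub_norm_sq_pos (h.lt_one x)
  rw [det_comp_plane, det_hyperboloidHessian (h.lt_one x), inv_mul_eq_div,
    le_div_iff₀ (by positivity)] at h1
  exact h1

end IsConvexSpacelike

/-! ### Orthonormal frames -/

theorem frame_det_sq {e v : Plane} (he : ‖e‖ = 1) (hv : ‖v‖ = 1) (hev : ⟪e, v⟫_ℝ = 0) :
    (e 0 * v 1 - e 1 * v 0) ^ 2 = 1 := by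
  have h1 := norm_sq_plane e
  have h2 := norm_sq_plane v
  rw [inner_plane] at hev
  rw [he] at h1
  rw [hv] at h2
  have : (e 0 * v 1 - e 1 * v 0) ^ 2 =
    (e 0 ^ 2 + e 1 ^ 2) * (v 0 ^ 2 + v 1 ^ 2) - (e 0 * v 0 + e 1 * v 1) ^ 2 := by ring
  rw [this, ← h1, ← h2, hev]; norm_num

theorem frame_expand {e v : Plane} (he : ‖e‖ = 1) (hv : ‖v‖ = 1) (hev : ⟪e, v⟫_ℝ = 0)
    (z : Plane) : z = ⟪z, e⟫_ℝ • e + ⟪z, v⟫_ℝ • v := by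
  have hon : Orthonormal ℝ ![e, v] := by
    constructor
    · intro i; fin_cases i <;> simp [he, hv]
    · intro i j hij
      fin_cases i <;> fin_cases j <;> simp_all [real_inner_comm]
  have hcard : Fintype.card (Fin 2) = Module.finrank ℝ Plane := by simp
  let b := basisOfOrthonormalOfCardEqFinrank hon hcard
  have hb : ⇑b = ![e, v] := coe_basisOfOrthonormalOfCardEqFinrank hon hcard
  let ob := b.toOrthonormalBasis (by rw [hb]; exact hon)
  have := (ob.sum_repr' z).symm
  simpa [ob, hb, Fin.sum_univ_two, real_inner_comm] using this

theorem frame_norm_sq {e v : Plane} (he : ‖e‖ = 1) (hv : ‖v‖ = 1) (hev : ⟪e, v⟫_ℝ = 0)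
    (z : Plane) : ‖z‖ ^ 2 = ⟪z, e⟫_ℝ ^ 2 + ⟪z, v⟫_ℝ ^ 2 := by
  rw [← real_inner_self_eq_norm_sq]
  conv_lhs => rw [frame_expand he hv hev z]
  simp only [inner_add_left, inner_add_right, inner_smul_right, real_inner_smul_left,
    real_inner_self_eq_norm_sq, he, hv, hev, real_inner_comm e v]
  ring

/-- This is the barrier near a chord with direction `v` and normal `e`: affine plus a bending `η`
along the chord, with slope `N` and bending `Q` across it. The expansion of a quadratic polynomial
is exact, so the error term is merely discarded. -/
theorem hasLowerTaylor_quadratic {e v : Plane} {α β c η N Q : ℝ} (hη : 0 ≤ η) (hQ : 0 ≤ Q)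
    (y : Plane) :
    HasLowerTaylor
      (fun z => α + β * ⟪z, v⟫_ℝ + η * (⟪z, v⟫_ℝ ^ 2 - 1) + N * (⟪z, e⟫_ℝ - c)
        + Q * (⟪z, e⟫_ℝ - c) ^ 2)
      ((β + 2 * η * ⟪y, v⟫_ℝ) • v + (N + 2 * Q * (⟪y, e⟫_ℝ - c)) • e)
      ((2 * η) • (innerSL ℝ v).smulRight v + (2 * Q) • (innerSL ℝ e).smulRight e) y where
  symm u u' := by
    simp [inner_add_left, inner_add_right, real_inner_smul_left, inner_smul_right,
      real_inner_comm u]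
    ring
  nonneg u := by
    simp only [add_apply, smul_apply, ContinuousLinearMap.smulRight_apply, innerSL_apply_apply,
      inner_add_left, real_inner_smul_left]
    have h1 := mul_self_nonneg ⟪v, u⟫_ℝ
    have h2 := mul_self_nonneg ⟪e, u⟫_ℝ
    positivity
  le ε hε := by
    refine Eventually.of_forall fun u => ?_
    simp only [add_apply, smul_apply, ContinuousLinearMap.smulRight_apply, innerSL_apply_apply,
      inner_add_left, inner_add_right, inner_smul_right, real_inner_comm u]
    have : 0 ≤ ε * ‖u‖ ^ 2 := by positivity
    nlinarith

theorem det_quadratic {e v : Plane} (he : ‖e‖ = 1) (hv : ‖v‖ = 1) (hev : ⟪e, v⟫_ℝ = 0)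
    (s t : ℝ) : (s • (innerSL ℝ v).smulRight v + t • (innerSL ℝ e).smulRight e :
      Plane →L[ℝ] Plane).det = s * t := by
  have h := frame_det_sq he hv hev
  rw [det_plane]
  simp [inner_plane]
  linear_combination (s * t) * h

/-- Points of the closed disk which are close to a chord, but away from its endpoints, are away
from the circle. -/
theorem exists_strip {e v : Plane} (he : ‖e‖ = 1) (hv : ‖v‖ = 1) (hev : ⟪e, v⟫_ℝ = 0)
    {c s : ℝ} (hcs : c ^ 2 + s ^ 2 = 1) {V : Set Plane} (hV : IsOpen V)
    (hp : c • e + s • v ∈ V) (hm : c • e - s • v ∈ V) :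
    ∃ κ > 0, ∀ z : Plane, ‖z‖ ≤ 1 → z ∉ V → |⟪z, e⟫_ℝ - c| ≤ κ → κ ≤ 1 - ‖z‖ ^ 2 := by
  set Z : Set Plane := Metric.closedBall 0 1 \ V
  have hZ : IsCompact Z := (isCompact_closedBall _ _).diff hV
  rcases Z.eq_empty_or_nonempty with hZe | hZne
  · refine ⟨1, one_pos, fun z hz hzV _ => ?_⟩
    have : z ∈ Z := ⟨by simpa using hz, hzV⟩
    rw [hZe] at this
    exact this.elim
  -- In the closed disk this function vanishes only at the two endpoints of the chord, and these lie
  -- in `V`; hence its minimum off `V` is positive.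
  obtain ⟨z₀, hz₀, hmin⟩ := hZ.exists_isMinOn hZne
    (f := fun z => |⟪z, e⟫_ℝ - c| + (1 - ‖z‖ ^ 2)) (by fun_prop)
  have hz₀1 : ‖z₀‖ ≤ 1 := by simpa using hz₀.1
  have hpos : 0 < |⟪z₀, e⟫_ℝ - c| + (1 - ‖z₀‖ ^ 2) := by
    have h1 : 0 ≤ 1 - ‖z₀‖ ^ 2 := by nlinarith [norm_nonneg z₀]
    rcases h1.eq_or_lt with h2 | h2
    · refine add_pos_of_pos_of_nonneg (abs_pos.2 fun h3 => ?_) h1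
      have h4 := frame_norm_sq he hv hev z₀
      have h5 : ⟪z₀, e⟫_ℝ = c := by linarith
      have h6 : ⟪z₀, v⟫_ℝ ^ 2 = s ^ 2 := by rw [h5] at h4; linarith
      have h7 := frame_expand he hv hev z₀
      rw [h5] at h7
      rcases sq_eq_sq_iff_eq_or_eq_neg.1 h6 with h8 | h8
      · rw [h8] at h7
        exact hz₀.2 (h7 ▸ hp)
      · rw [h8, neg_smul, ← sub_eq_add_neg] at h7
        exact hz₀.2 (h7 ▸ hm)
    · positivity
  -- Half the minimum: if the first summand is at most this, the second is at least this.
  refine ⟨(|⟪z₀, e⟫_ℝ - c| + (1 - ‖z₀‖ ^ 2)) / 2, by positivity, fun z hz hzV habs => ?_⟩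
  have : |⟪z₀, e⟫_ℝ - c| + (1 - ‖z₀‖ ^ 2) ≤ |⟪z, e⟫_ℝ - c| + (1 - ‖z‖ ^ 2) :=
    hmin (show z ∈ Z from ⟨by simpa using hz, hzV⟩)
  linarith

/-! ### The barrier on a chord. -/

namespace IsConvexSpacelike

variable {a : ℝ} {f : Plane → ℝ} {g : Plane → Plane} {H : Plane → Plane →L[ℝ] Plane}

/-- The comparison is made on the part of the disk beyond a parallel chord at distance `δ`. Near the
endpoints supporting affine functions dominate the barrier; elsewhere in the strip the circle is at
a definite distance, so the curvature bound gives a positive lower bound for the Hessian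
determinant. The bending `η` makes the barrier strictly violate the Monge–Ampère inequality. -/
theorem le_legendre_on_chord_aux (h : IsConvexSpacelike a f g H) (ha : 0 < a) {e v : Plane}
    (he : ‖e‖ = 1) (hv : ‖v‖ = 1) (hev : ⟪e, v⟫_ℝ = 0) {c s : ℝ} (hcs : c ^ 2 + s ^ 2 = 1)
    (htop : ∀ y : Plane, ‖y‖ ≤ 1 → c < ⟪y, e⟫_ℝ → legendre f y = ⊤) {α β : ℝ}
    (hp : ((α + β * s : ℝ) : EReal) < legendre f (c • e + s • v))
    (hm : ((α - β * s : ℝ) : EReal) < legendre f (c • e - s • v)) {η : ℝ} (hη : 0 < η)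
    {y : Plane} (hy : ‖y‖ ≤ 1) (hyc : ⟪y, e⟫_ℝ = c) :
    ((α + β * ⟪y, v⟫_ℝ + η * (⟪y, v⟫_ℝ ^ 2 - 1) : ℝ) : EReal) ≤ legendre f y := by
  have hcoord : ∀ t : ℝ, ⟪c • e + t • v, v⟫_ℝ = t := fun t => by
    simp [inner_add_left, real_inner_smul_left, hev, hv]
  -- Each strict inequality at an endpoint is witnessed by a single affine minorant of the Legendre
  -- transform, so it persists on a neighbourhood.
  obtain ⟨x₁, hx₁⟩ := coe_lt_legendre.1 hp
  obtain ⟨x₂, hx₂⟩ := coe_lt_legendre.1 hm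
  set V : Set Plane := {z | α + β * ⟪z, v⟫_ℝ < ⟪x₁, z⟫_ℝ - f x₁} ∪
    {z | α + β * ⟪z, v⟫_ℝ < ⟪x₂, z⟫_ℝ - f x₂} with hVdef
  have hV : IsOpen V :=
    (isOpen_lt (by fun_prop) (by fun_prop)).union (isOpen_lt (by fun_prop) (by fun_prop))
  have hVle : ∀ z ∈ V, ((α + β * ⟪z, v⟫_ℝ : ℝ) : EReal) ≤ legendre f z := by
    rintro z (hz | hz)
    · exact (coe_lt_legendre.2 ⟨x₁, hz⟩).le
    · exact (coe_lt_legendre.2 ⟨x₂, hz⟩).le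
  obtain ⟨δ, hδ, hstrip⟩ := exists_strip he hv hev hcs hV
    (Or.inl (by rw [mem_ofPred_eq, hcoord]; exact hx₁))
    (Or.inr (by
      rw [mem_ofPred_eq, sub_eq_add_neg, ← neg_smul, hcoord, neg_smul, ← sub_eq_add_neg]
      linarith))
  -- The barrier has Hessian determinant `(2 * η) * (2 * Q)`, while `det H ≥ a * δ ^ 2` where `δ ≤ 1
  -- - ‖z‖ ^ 2`; this `Q` makes the product equal to 2.
  set Q : ℝ := 1 / (2 * η * (a * δ ^ 2)) with hQdef
  have hQ : 0 < Q := by positivity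
  have hQη : 1 < 2 * η * (2 * Q) * (a * δ ^ 2) := by
    have : 2 * η * (2 * Q) * (a * δ ^ 2) = 2 := by rw [hQdef]; field_simp
    linarith
  -- The first summand pushes the barrier below `-f 0` on the inner edge of the strip. The second
  -- makes the transverse part nonpositive between that edge and the chord, despite the term in `Q`.
  set N : ℝ := (|α| + |β| + |f 0|) / δ + Q * δ with hNdef
  have hNδ : N * δ = |α| + |β| + |f 0| + Q * δ ^ 2 := by rw [hNdef]; field_simp
  have hNQ : Q * δ ≤ N := by
    have : 0 ≤ (|α| + |β| + |f 0|) / δ := by positivity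
    linarith
  set w : Plane → ℝ := fun z => α + β * ⟪z, v⟫_ℝ + η * (⟪z, v⟫_ℝ ^ 2 - 1) + N * (⟪z, e⟫_ℝ - c)
        + Q * (⟪z, e⟫_ℝ - c) ^ 2 with hw
  have hzv : ∀ z : Plane, ‖z‖ ≤ 1 → |⟪z, v⟫_ℝ| ≤ 1 := fun z hz =>
    (abs_real_inner_le_norm z v).trans (by rw [hv, mul_one]; exact hz)
  have hwy : w y = α + β * ⟪y, v⟫_ℝ + η * (⟪y, v⟫_ℝ ^ 2 - 1) := by
    simp [hw, hyc]
  rw [← hwy]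
  refine h.le_legendre_of_comparison (R := Metric.closedBall 0 1 ∩ {z | c - δ ≤ ⟪z, e⟫_ℝ})
    (P := {z | ‖z‖ < 1 ∧ c - δ < ⟪z, e⟫_ℝ ∧ δ ≤ 1 - ‖z‖ ^ 2}) ?_ ?_ ?_ ?_
    ⟨by simpa using hy, by rw [mem_ofPred_eq, hyc]; linarith⟩
  · exact (isCompact_closedBall _ _).inter_right
      (isClosed_le continuous_const (by fun_prop))
  · exact Continuous.continuousOn (by fun_prop)
  · rintro z ⟨hz1, hz2⟩ hzP
    rw [mem_closedBall_zero_iff] at hz1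
    have hz2 : c - δ ≤ ⟪z, e⟫_ℝ := hz2
    have hzv1 := abs_le.1 (hzv z hz1)
    have hsq : η * (⟪z, v⟫_ℝ ^ 2 - 1) ≤ 0 := by
      have : ⟪z, v⟫_ℝ ^ 2 ≤ 1 := by nlinarith
      nlinarith
    rcases lt_or_ge c ⟪z, e⟫_ℝ with h1 | h1
    · rw [htop z hz1 h1]; exact le_top
    by_cases hzV : z ∈ V
    · refine le_trans ?_ (hVle z hzV)
      rw [EReal.coe_le_coe_iff, hw]
      have : (⟪z, e⟫_ℝ - c) * (N + Q * (⟪z, e⟫_ℝ - c)) ≤ 0 :=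
        mul_nonpos_of_nonpos_of_nonneg (by linarith) (by nlinarith)
      simp only
      nlinarith
    · have h2 : δ ≤ 1 - ‖z‖ ^ 2 :=
        hstrip z hz1 hzV (abs_le.2 ⟨by linarith, by linarith⟩)
      have h3 : ‖z‖ < 1 := by nlinarith [norm_nonneg z]
      have h4 : ⟪z, e⟫_ℝ = c - δ := by
        by_contra hne
        exact hzP ⟨h3, lt_of_le_of_ne hz2 (Ne.symm hne), h2⟩
      refine le_trans ?_ (neg_le_legendre f z)
      rw [EReal.coe_le_coe_iff, hw]
      simp only [h4]
      have h5 : β * ⟪z, v⟫_ℝ ≤ |β| := by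
        calc β * ⟪z, v⟫_ℝ ≤ |β * ⟪z, v⟫_ℝ| := le_abs_self _
          _ = |β| * |⟪z, v⟫_ℝ| := abs_mul _ _
          _ ≤ |β| * 1 := by gcongr; exact hzv z hz1
          _ = |β| := mul_one _
      have h6 : N * (c - δ - c) = -(N * δ) := by ring
      have h7 : Q * (c - δ - c) ^ 2 = Q * δ ^ 2 := by ring
      rw [h6, h7, hNδ]
      linarith [le_abs_self α, le_abs_self (f 0)]
  · rintro z ⟨hz1, hz2, hz3⟩
    refine ⟨?_, _, _, hasLowerTaylor_quadratic hη.le hQ.le z, fun x hx => ?_⟩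
    · have : IsOpen {z : Plane | ‖z‖ < 1 ∧ c - δ < ⟪z, e⟫_ℝ} :=
        (isOpen_lt continuous_norm continuous_const).inter
          (isOpen_lt continuous_const (by fun_prop : Continuous fun z : Plane => ⟪z, e⟫_ℝ))
      refine mem_of_superset (this.mem_nhds ⟨hz1, hz2⟩) fun z' hz' => ⟨?_, hz'.2.le⟩
      simpa using hz'.1.le
    · rw [det_comp_plane, det_quadratic he hv hev]
      refine hQη.trans_le (mul_le_mul_of_nonneg_left ?_ (by positivity))
      have h1 := h.det_hess_ge x
      rw [hx] at h1
      refine le_trans (mul_le_mul_of_nonneg_left ?_ ha.le) h1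
      exact pow_le_pow_left₀ hδ.le hz3 2

/-- If the Legendre transform is infinite on one side of a chord, then on the chord it is bounded
from below by the affine functions which are smaller at the endpoints. -/
theorem le_legendre_on_chord (h : IsConvexSpacelike a f g H) (ha : 0 < a) {e v : Plane}
    (he : ‖e‖ = 1) (hv : ‖v‖ = 1) (hev : ⟪e, v⟫_ℝ = 0) {c s : ℝ} (hcs : c ^ 2 + s ^ 2 = 1)
    (htop : ∀ y : Plane, ‖y‖ ≤ 1 → c < ⟪y, e⟫_ℝ → legendre f y = ⊤) {α β : ℝ}
    (hp : ((α + β * s : ℝ) : EReal) < legendre f (c • e + s • v))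
    (hm : ((α - β * s : ℝ) : EReal) < legendre f (c • e - s • v))
    {y : Plane} (hy : ‖y‖ ≤ 1) (hyc : ⟪y, e⟫_ℝ = c) :
    ((α + β * ⟪y, v⟫_ℝ : ℝ) : EReal) ≤ legendre f y := by
  by_contra hcon
  push Not at hcon
  obtain ⟨t, ht⟩ := exists_legendre_eq_coe (ne_top_of_lt hcon)
  rw [ht, EReal.coe_lt_coe_iff] at hcon
  -- The bending costs at most `η`, and `η` is half of the supposed gap.
  have h1 := h.le_legendre_on_chord_aux ha he hv hev hcs htop hp hm
    (η := (α + β * ⟪y, v⟫_ℝ - t) / 2) (by linarith) hy hyc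
  rw [ht, EReal.coe_le_coe_iff] at h1
  nlinarith [sq_nonneg ⟪y, v⟫_ℝ]

end IsConvexSpacelike

/-! ### Weak separation and the finiteness set of the Legendre transform. -/

/-- A point outside the convex hull of a set in a finite dimensional space can be weakly separated
from the set, even if the convex hull is not closed. -/
theorem exists_norm_eq_one_inner_le {E : Type*} [NormedAddCommGroup E] [InnerProductSpace ℝ E]
    [FiniteDimensional ℝ E] [Nontrivial E] {A : Set E} {y : E} (hy : y ∉ convexHull ℝ A) :
    ∃ e : E, ‖e‖ = 1 ∧ ∀ z ∈ A, ⟪z, e⟫_ℝ ≤ ⟪y, e⟫_ℝ := by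
  -- Compactness of the sphere of directions reduces to finite subsets of `A`, whose convex hulls
  -- are closed, so that Hahn–Banach applies.
  have key : (Metric.sphere (0 : E) 1 ∩ ⋂ z : A, {e : E | ⟪(z : E), e⟫_ℝ ≤ ⟪y, e⟫_ℝ}).Nonempty := by
    refine (isCompact_sphere (0 : E) 1).inter_iInter_nonempty _
      (fun z => isClosed_le (by fun_prop) (by fun_prop)) fun F => ?_
    set F' : Set E := Subtype.val '' (F : Set A) with hF'
    have hfin : F'.Finite := F.finite_toSet.image _
    have hyF : y ∉ convexHull ℝ F' := fun h => hy (convexHull_mono (by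
      rintro _ ⟨z, -, rfl⟩; exact z.2) h)
    obtain ⟨l, u, hl1, hl2⟩ := geometric_hahn_banach_closed_point (convex_convexHull ℝ F')
      (hfin.isClosed_convexHull ℝ) hyF
    set q := (InnerProductSpace.toDual ℝ E).symm l with hq
    have hlq : ∀ z, l z = ⟪z, q⟫_ℝ := fun z => by
      rw [real_inner_comm, hq, InnerProductSpace.toDual_symm_apply]
    rcases F.eq_empty_or_nonempty with hF | ⟨z₀, hz₀⟩
    · obtain ⟨e, he⟩ := exists_norm_eq E zero_le_one
      exact ⟨e, by simpa using he, by simp [hF]⟩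
    have hlt : ∀ z ∈ F, ⟪(z : E), q⟫_ℝ < ⟪y, q⟫_ℝ := fun z hz => by
      rw [← hlq, ← hlq]
      exact (hl1 _ (subset_convexHull ℝ _ ⟨z, hz, rfl⟩)).trans hl2
    have hq0 : q ≠ 0 := by
      intro h0
      have := hlt z₀ hz₀
      simp [h0] at this
    refine ⟨‖q‖⁻¹ • q, by simp [norm_smul, hq0], mem_iInter₂.2 fun z hz => ?_⟩
    simp only [mem_ofPred_eq, inner_smul_right]
    exact mul_le_mul_of_nonneg_left (hlt z hz).le (by positivity)
  obtain ⟨e, he1, he2⟩ := key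
  exact ⟨e, by simpa using he1, fun z hz => mem_iInter.1 he2 ⟨z, hz⟩⟩

theorem exists_orthogonal_plane {e : Plane} (he : ‖e‖ = 1) :
    ∃ v : Plane, ‖v‖ = 1 ∧ ⟪e, v⟫_ℝ = 0 := by
  refine ⟨!₂[-e 1, e 0], ?_, ?_⟩
  · have h1 := norm_sq_plane e
    have h2 := norm_sq_plane !₂[-e 1, e 0]
    simp only [he] at h1
    simp at h2
    have h3 : ‖(!₂[-e 1, e 0] : Plane)‖ ^ 2 = 1 := by rw [h2]; linarith
    exact (pow_eq_one_iff_of_nonneg (norm_nonneg _) two_ne_zero).1 h3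
  · rw [inner_plane]; simp; ring

/-- The points of the unit circle at which the Legendre transform is finite. -/
def finiteCircle (f : Plane → ℝ) : Set Plane := {ξ | ‖ξ‖ = 1 ∧ legendre f ξ < ⊤}

/-- The points of the closed unit disk at which the Legendre transform is finite. -/
def finiteDisk (f : Plane → ℝ) : Set Plane := {y | ‖y‖ ≤ 1 ∧ legendre f y < ⊤}

theorem legendre_combination_le {f : Plane → ℝ} {y z : Plane} {A B s t : ℝ} (hs : 0 ≤ s)
    (ht : 0 ≤ t) (hst : s + t = 1) (hy : legendre f y ≤ A) (hz : legendre f z ≤ B) :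
    legendre f (s • y + t • z) ≤ ((s * A + t * B : ℝ) : EReal) := by
  rw [legendre_le_coe] at *
  intro x
  have h1 := mul_le_mul_of_nonneg_left (hy x) hs
  have h2 := mul_le_mul_of_nonneg_left (hz x) ht
  rw [inner_add_right, inner_smul_right, inner_smul_right]
  have : f x = s * f x + t * f x := by rw [← add_mul, hst, one_mul]
  linarith

theorem convex_finiteDisk (f : Plane → ℝ) : Convex ℝ (finiteDisk f) := by
  intro y hy z hz s t hs ht hst
  obtain ⟨A, hA⟩ := exists_legendre_eq_coe hy.2.ne
  obtain ⟨B, hB⟩ := exists_legendre_eq_coe hz.2.ne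
  refine ⟨?_, (legendre_combination_le hs ht hst hA.le hB.le).trans_lt (EReal.coe_lt_top _)⟩
  have := convex_closedBall (0 : Plane) 1 (by simpa using hy.1) (by simpa using hz.1) hs ht hst
  simpa using this

theorem convexHull_finiteCircle_subset (f : Plane → ℝ) :
    convexHull ℝ (finiteCircle f) ⊆ finiteDisk f :=
  convexHull_min (fun _ hξ => ⟨hξ.1.le, hξ.2⟩) (convex_finiteDisk f)

namespace IsConvexSpacelike

variable {a : ℝ} {f : Plane → ℝ} {g : Plane → Plane} {H : Plane → Plane →L[ℝ] Plane}

/-- The interpolation inequality on a chord such that the Legendre transform is infinite on one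
side of it. -/
theorem le_legendre_combination (h : IsConvexSpacelike a f g H) (ha : 0 < a) {e : Plane}
    (he : ‖e‖ = 1) {c : ℝ} (htop : ∀ y : Plane, ‖y‖ ≤ 1 → c < ⟪y, e⟫_ℝ → legendre f y = ⊤)
    {ξ₁ ξ₂ : Plane} (hne : ξ₁ ≠ ξ₂) (h1 : ‖ξ₁‖ = 1) (h2 : ‖ξ₂‖ = 1) (hc1 : ⟪ξ₁, e⟫_ℝ = c)
    (hc2 : ⟪ξ₂, e⟫_ℝ = c) {A B : ℝ} (hA : (A : EReal) < legendre f ξ₁)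
    (hB : (B : EReal) < legendre f ξ₂) {s t : ℝ} (hs : 0 ≤ s) (ht : 0 ≤ t) (hst : s + t = 1) :
    ((s * A + t * B : ℝ) : EReal) ≤ legendre f (s • ξ₁ + t • ξ₂) := by
  obtain ⟨v, hv, hev⟩ := exists_orthogonal_plane he
  set r := ⟪ξ₁, v⟫_ℝ with hr
  have e1 := frame_expand he hv hev ξ₁
  have e2 := frame_expand he hv hev ξ₂
  have n1 := frame_norm_sq he hv hev ξ₁
  have n2 := frame_norm_sq he hv hev ξ₂
  rw [hc1, ← hr] at e1 n1
  rw [hc2] at e2 n2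
  rw [h1] at n1
  rw [h2] at n2
  have hr2 : ⟪ξ₂, v⟫_ℝ = -r := by
    rcases sq_eq_sq_iff_eq_or_eq_neg.1 (show ⟪ξ₂, v⟫_ℝ ^ 2 = r ^ 2 by linarith) with h3 | h3
    · rw [h3, ← e1] at e2
      exact absurd e2.symm hne
    · exact h3
  have hr0 : r ≠ 0 := by
    intro h0
    rw [hr2, h0, neg_zero] at e2
    rw [h0] at e1
    exact hne (e1.trans e2.symm)
  rw [hr2, neg_smul, ← sub_eq_add_neg] at e2
  have hmem : ‖s • ξ₁ + t • ξ₂‖ ≤ 1 := by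
    have := convex_closedBall (0 : Plane) 1 (show ξ₁ ∈ _ by simp [h1])
      (show ξ₂ ∈ _ by simp [h2]) hs ht hst
    simpa using this
  have hin : ⟪s • ξ₁ + t • ξ₂, e⟫_ℝ = c := by
    rw [inner_add_left, real_inner_smul_left, real_inner_smul_left, hc1, hc2, ← add_mul, hst,
      one_mul]
  -- The endpoints have coordinates `r` and `-r` along `v`; `α` and `β` are the coefficients of the
  -- affine function with values `A` and `B` there.
  have key := h.le_legendre_on_chord ha he hv hev (c := c) (s := r) (by linarith) htop
    (α := (A + B) / 2) (β := (A - B) / (2 * r)) (y := s • ξ₁ + t • ξ₂) ?_ ?_ hmem hin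
  · convert key using 2
    rw [inner_add_left, real_inner_smul_left, real_inner_smul_left, hr2, ← hr]
    have : s = 1 - t := by linarith
    rw [this]
    field_simp
    ring
  · rw [← e1]
    convert hA using 2
    field_simp
    ring
  · rw [← e2]
    convert hB using 2
    field_simp
    ring

/-- An infinite value at `ξ₁` allows arbitrarily large `A` in the interpolation inequality, and the
positive weight `s` carries this to the point of the chord. -/
theorem legendre_lt_top_of_combination (h : IsConvexSpacelike a f g H) (ha : 0 < a) {e : Plane}
    (he : ‖e‖ = 1) {c : ℝ} (htop : ∀ y : Plane, ‖y‖ ≤ 1 → c < ⟪y, e⟫_ℝ → legendre f y = ⊤)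
    {ξ₁ ξ₂ : Plane} (hne : ξ₁ ≠ ξ₂) (h1 : ‖ξ₁‖ = 1) (h2 : ‖ξ₂‖ = 1) (hc1 : ⟪ξ₁, e⟫_ℝ = c)
    (hc2 : ⟪ξ₂, e⟫_ℝ = c) {s t : ℝ} (hs : 0 < s) (ht : 0 ≤ t) (hst : s + t = 1)
    (hfin : legendre f (s • ξ₁ + t • ξ₂) < ⊤) : legendre f ξ₁ < ⊤ := by
  by_contra hcon
  rw [not_lt, top_le_iff] at hcon
  refine hfin.ne (EReal.eq_top_of_forall_affine_le (A := t * (-f 0 - 1)) hs fun N _ => ?_)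
  have := h.le_legendre_combination ha he htop hne h1 h2 hc1 hc2 (A := N) (B := -f 0 - 1)
    (by rw [hcon]; exact EReal.coe_lt_top _)
    (lt_of_lt_of_le (by rw [EReal.coe_lt_coe_iff]; linarith) (neg_le_legendre f ξ₂)) hs.le ht hst
  convert this using 2
  ring

/-- A point `y` outside the hull can be separated from it weakly by a line through `y`. The Legendre
transform is infinite on the arc beyond the line, hence on the cap. A finite value at an interior
point `y` of the resulting chord makes both endpoints finite, so `y` is in the hull after all. Weak
separation suffices, and the hull need not be closed. -/
theorem finiteDisk_subset (h : IsConvexSpacelike a f g H) (ha : 0 < a) :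
    finiteDisk f ⊆ convexHull ℝ (finiteCircle f) := by
  rintro y ⟨hy, hfin⟩
  by_contra hcon
  obtain ⟨e, he, hsep⟩ := exists_norm_eq_one_inner_le hcon
  have htop : ∀ z : Plane, ‖z‖ ≤ 1 → ⟪y, e⟫_ℝ < ⟪z, e⟫_ℝ → legendre f z = ⊤ := fun z hz hlt =>
    h.legendre_eq_top_of_arc ha (fun ξ hξ hlt' => by
      by_contra hne
      exact absurd (hsep ξ ⟨hξ, lt_top_iff_ne_top.2 hne⟩) (not_le.2 hlt')) hz hlt
  rcases hy.eq_or_lt with hy1 | hy1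
  · exact hcon (subset_convexHull ℝ _ ⟨hy1, hfin⟩)
  obtain ⟨v, hv, hev⟩ := exists_orthogonal_plane he
  set c := ⟪y, e⟫_ℝ with hc
  set τ := ⟪y, v⟫_ℝ with hτ
  have hn := frame_norm_sq he hv hev y
  have hexp := frame_expand he hv hev y
  rw [← hc, ← hτ] at hn hexp
  have hlt : c ^ 2 + τ ^ 2 < 1 := by nlinarith [norm_nonneg y]
  have hpos : 0 < 1 - c ^ 2 := by nlinarith [sq_nonneg τ]
  set s := √(1 - c ^ 2) with hs
  have hs0 : 0 < s := Real.sqrt_pos.2 hpos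
  have hss : s ^ 2 = 1 - c ^ 2 := Real.sq_sqrt hpos.le
  have hτs : |τ| < s := abs_lt_of_sq_lt_sq (by linarith) hs0.le
  rw [abs_lt] at hτs
  have hinner : ∀ r : ℝ, ⟪c • e + r • v, e⟫_ℝ = c := fun r => by
    rw [inner_add_left, real_inner_smul_left, real_inner_smul_left, real_inner_comm e v, hev,
      real_inner_self_eq_norm_sq, he]; ring
  have hinner' : ∀ r : ℝ, ⟪c • e + r • v, v⟫_ℝ = r := fun r => by
    rw [inner_add_left, real_inner_smul_left, real_inner_smul_left, hev,
      real_inner_self_eq_norm_sq, hv]; ring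
  have hnorm : ∀ r : ℝ, r ^ 2 = s ^ 2 → ‖c • e + r • v‖ = 1 := fun r hr => by
    have h1 := frame_norm_sq he hv hev (c • e + r • v)
    rw [hinner, hinner', hr, hss] at h1
    have h2 : ‖c • e + r • v‖ ^ 2 = 1 := by rw [h1]; ring
    exact (pow_eq_one_iff_of_nonneg (norm_nonneg _) two_ne_zero).1 h2
  have hne : c • e + s • v ≠ c • e + (-s) • v := fun heq => by
    have := hinner' s
    rw [heq, hinner'] at this
    linarith
  -- The endpoints of the chord are `c • e ± s • v`, and `y = c • e + τ • v` with `|τ| < s`.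
  have hcomb : ((s + τ) / (2 * s)) • (c • e + s • v) + ((s - τ) / (2 * s)) • (c • e + (-s) • v)
      = y := by
    rw [hexp, smul_add, smul_add, smul_smul, smul_smul, smul_smul, smul_smul,
      add_add_add_comm, ← add_smul, ← add_smul]
    congr 2 <;> field_simp <;> ring
  have hsum : (s + τ) / (2 * s) + (s - τ) / (2 * s) = 1 := by field_simp; ring
  have hp : 0 < (s + τ) / (2 * s) := div_pos (by linarith) (by linarith)
  have hm : 0 < (s - τ) / (2 * s) := div_pos (by linarith) (by linarith)
  have h1 := h.legendre_lt_top_of_combination ha he htop hne (hnorm s rfl) (hnorm (-s) (by ring))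
    (hinner s) (hinner (-s)) hp hm.le hsum (by rw [hcomb]; exact hfin)
  have h2 := h.legendre_lt_top_of_combination ha he htop hne.symm (hnorm (-s) (by ring))
    (hnorm s rfl) (hinner (-s)) (hinner s) hm hp.le (by rw [add_comm]; exact hsum)
    (by rw [add_comm, hcomb]; exact hfin)
  have m1 : c • e + s • v ∈ finiteCircle f := ⟨hnorm s rfl, h1⟩
  have m2 : c • e + (-s) • v ∈ finiteCircle f := ⟨hnorm (-s) (by ring), h2⟩
  refine hcon ?_
  rw [← hcomb]
  exact convex_convexHull ℝ _ (subset_convexHull ℝ _ m1) (subset_convexHull ℝ _ m2) hp.le hm.le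
    hsum

theorem finiteDisk_eq (h : IsConvexSpacelike a f g H) (ha : 0 < a) :
    finiteDisk f = convexHull ℝ (finiteCircle f) :=
  (h.finiteDisk_subset ha).antisymm (convexHull_finiteCircle_subset f)

/-! ### The image of the gradient. -/

theorem range_grad_subset (h : IsConvexSpacelike a f g H) : range g ⊆ finiteDisk f := by
  rintro _ ⟨x, rfl⟩
  exact ⟨(h.lt_one x).le,
    (legendre_le_coe.2 fun z => h.legendre_le x z).trans_lt (EReal.coe_lt_top _)⟩

/-- The Hessian as an automorphism of the plane. -/
def hessEquiv (h : IsConvexSpacelike a f g H) (x : Plane) : Plane ≃L[ℝ] Plane :=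
  (LinearEquiv.ofInjectiveEndo (H x : Plane →ₗ[ℝ] Plane) (by
    rw [← LinearMap.ker_eq_bot, LinearMap.ker_eq_bot']
    intro v hv
    by_contra hne
    have := h.pos x v hne
    simp only [ContinuousLinearMap.coe_coe] at hv
    simp [hv] at this)).toContinuousLinearEquiv

theorem coe_hessEquiv (h : IsConvexSpacelike a f g H) (x : Plane) :
    (h.hessEquiv x : Plane →L[ℝ] Plane) = H x := by
  ext v
  simp [hessEquiv]

theorem isOpen_range_grad (h : IsConvexSpacelike a f g H) (hg : ContDiff ℝ 1 g) :
    IsOpen (range g) := by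
  rw [← image_univ]
  refine isOpenMap_of_hasStrictFDerivAt_equiv (f' := fun x => h.hessEquiv x)
    (fun x => ?_) _ isOpen_univ
  rw [h.coe_hessEquiv]
  exact hg.contDiffAt.hasStrictFDerivAt' (h.hess x) (by norm_num)

/-- Finiteness of the Legendre transform at `y` shifted along both coordinate axes in both senses
makes `f - ⟪·, y⟫` grow at least linearly. It therefore has a minimum, and the gradient of `f`
equals `y` there. -/
theorem interior_finiteDisk_subset (h : IsConvexSpacelike a f g H) :
    interior (finiteDisk f) ⊆ range g := by
  intro y hy
  obtain ⟨ρ, hρ, hball⟩ := Metric.isOpen_iff.1 isOpen_interior y hy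
  have hfin : ∀ v : Plane, ‖v‖ = 1 → ∃ C : ℝ, ∀ x, ⟪x, y⟫_ℝ + ρ / 2 * ⟪x, v⟫_ℝ - f x ≤ C := by
    intro v hv
    have hmem : y + (ρ / 2) • v ∈ finiteDisk f := by
      refine interior_subset (hball ?_)
      rw [mem_ball_iff_norm, add_sub_cancel_left, norm_smul, hv, Real.norm_of_nonneg (by positivity)]
      linarith
    obtain ⟨C, hC⟩ := exists_legendre_eq_coe hmem.2.ne
    refine ⟨C, fun x => ?_⟩
    have := legendre_le_coe.1 hC.le x
    rwa [inner_add_right, inner_smul_right] at this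
  obtain ⟨C₁, h₁⟩ := hfin (EuclideanSpace.single 0 1) (by simp)
  obtain ⟨C₂, h₂⟩ := hfin (-EuclideanSpace.single 0 1) (by simp)
  obtain ⟨C₃, h₃⟩ := hfin (EuclideanSpace.single 1 1) (by simp)
  obtain ⟨C₄, h₄⟩ := hfin (-EuclideanSpace.single 1 1) (by simp)
  have hbound : ∀ x, ρ / 4 * ‖x‖ - (|C₁| + |C₂| + |C₃| + |C₄|) ≤ f x - ⟪x, y⟫_ℝ := by
    intro x
    have b1 := h₁ x
    have b2 := h₂ x
    have b3 := h₃ x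
    have b4 := h₄ x
    simp only [inner_neg_right, EuclideanSpace.inner_single_right] at b1 b2 b3 b4
    simp at b1 b2 b3 b4
    have habs0 : ρ / 2 * |x 0| ≤ f x - ⟪x, y⟫_ℝ + (|C₁| + |C₂| + |C₃| + |C₄|) := by
      rcases abs_cases (x 0) with ⟨hx, -⟩ | ⟨hx, -⟩ <;> rw [hx] <;>
        linarith [le_abs_self C₁, le_abs_self C₂, abs_nonneg C₁, abs_nonneg C₂, abs_nonneg C₃,
          abs_nonneg C₄]
    have habs1 : ρ / 2 * |x 1| ≤ f x - ⟪x, y⟫_ℝ + (|C₁| + |C₂| + |C₃| + |C₄|) := by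
      rcases abs_cases (x 1) with ⟨hx, -⟩ | ⟨hx, -⟩ <;> rw [hx] <;>
        linarith [le_abs_self C₃, le_abs_self C₄, abs_nonneg C₁, abs_nonneg C₂, abs_nonneg C₃,
          abs_nonneg C₄]
    have hnorm : ‖x‖ ≤ |x 0| + |x 1| := by
      refine abs_le_of_sq_le_sq' ?_ (by positivity) |>.2
      rw [norm_sq_plane, ← sq_abs (x 0), ← sq_abs (x 1)]
      nlinarith [abs_nonneg (x 0), abs_nonneg (x 1)]
    nlinarith
  have hlim : Tendsto (fun x => f x - ⟪x, y⟫_ℝ) (cocompact Plane) atTop := by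
    refine tendsto_atTop_mono hbound ?_
    exact tendsto_atTop_add_const_right _ _
      ((tendsto_norm_cocompact_atTop).const_mul_atTop (by positivity))
  obtain ⟨x, hx⟩ := Continuous.exists_forall_le (by
    have := h.continuous
    fun_prop : Continuous fun x => f x - ⟪x, y⟫_ℝ) hlim
  exact ⟨x, h.grad_eq_of_isMax fun z => by linarith [hx z]⟩

theorem range_grad_eq (h : IsConvexSpacelike a f g H) (hg : ContDiff ℝ 1 g) (ha : 0 < a) :
    range g = interior (convexHull ℝ (finiteCircle f)) := by
  rw [← h.finiteDisk_eq ha]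
  exact (interior_maximal h.range_grad_subset (h.isOpen_range_grad hg)).antisymm
    h.interior_finiteDisk_subset

theorem finiteCircle_nonempty (h : IsConvexSpacelike a f g H) (ha : 0 < a) :
    (finiteCircle f).Nonempty := by
  rw [← convexHull_nonempty_iff (𝕜 := ℝ), ← h.finiteDisk_eq ha]
  exact ⟨g 0, h.range_grad_subset ⟨0, rfl⟩⟩

/-- The chords contained in the boundary of the image of the gradient are as in
`le_legendre_combination`. -/
theorem exists_frame_of_segment_subset_frontier (h : IsConvexSpacelike a f g H)
    (hg : ContDiff ℝ 1 g) (ha : 0 < a) {ξ₁ ξ₂ : Plane}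
    (hseg : segment ℝ ξ₁ ξ₂ ⊆ frontier (range g)) :
    ∃ e : Plane, ‖e‖ = 1 ∧ ⟪ξ₁, e⟫_ℝ = ⟪ξ₂, e⟫_ℝ ∧
      ∀ y : Plane, ‖y‖ ≤ 1 → ⟪ξ₂, e⟫_ℝ < ⟪y, e⟫_ℝ → legendre f y = ⊤ := by
  set m := midpoint ℝ ξ₁ ξ₂ with hm
  have hopen := h.isOpen_range_grad hg
  have hint : range g = interior (finiteDisk f) := by
    rw [h.range_grad_eq hg ha, h.finiteDisk_eq ha]
  have hconv : Convex ℝ (range g) := hint ▸ (convex_finiteDisk f).interior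
  have hmf : m ∈ frontier (range g) := hseg (midpoint_mem_segment ξ₁ ξ₂)
  have hmnot : m ∉ range g := by
    rw [hopen.frontier_eq] at hmf
    exact hmf.2
  -- A supporting line at the midpoint: both endpoints lie on its inner side and their mean lies on
  -- it, so both lie on it.
  obtain ⟨e, he, hsep⟩ := exists_norm_eq_one_inner_le
    (A := range g) (y := m) (by rwa [hconv.convexHull_eq])
  have hcl : ∀ z ∈ closure (range g), ⟪z, e⟫_ℝ ≤ ⟪m, e⟫_ℝ := fun z hz =>
    closure_minimal (t := {z | ⟪z, e⟫_ℝ ≤ ⟪m, e⟫_ℝ}) hsep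
      (isClosed_le (by fun_prop) (by fun_prop)) hz
  have h1 := hcl ξ₁ (frontier_subset_closure (hseg (left_mem_segment ℝ ξ₁ ξ₂)))
  have h2 := hcl ξ₂ (frontier_subset_closure (hseg (right_mem_segment ℝ ξ₁ ξ₂)))
  have hmid : ⟪m, e⟫_ℝ = (⟪ξ₁, e⟫_ℝ + ⟪ξ₂, e⟫_ℝ) / 2 := by
    rw [hm, midpoint_eq_smul_add, real_inner_smul_left, inner_add_left]
    simp; ring
  refine ⟨e, he, by linarith, fun y hy hlt => ?_⟩
  by_contra hne
  -- Points where the transform is finite lie in the closure of the interior of the finiteness set,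
  -- which the supporting line bounds.
  have hyd : y ∈ closure (range g) := by
    rw [hint, (convex_finiteDisk f).closure_interior_eq_closure_of_nonempty_interior
      (hint ▸ range_nonempty g)]
    exact subset_closure ⟨hy, lt_top_iff_ne_top.2 hne⟩
  linarith [hcl y hyd]

end IsConvexSpacelike

/-! ## Coordinates on Minkowski space -/

/-- The horizontal part of a vector. -/
def horiz : Mink →L[ℝ] Plane :=
  LinearMap.toContinuousLinearMap
    { toFun := fun x => !₂[x 0, x 1]
      map_add' := fun x y => by ext i; fin_cases i <;> simp
      map_smul' := fun c x => by ext i; fin_cases i <;> simp }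

/-- The inclusion of the horizontal plane. -/
def horizIncl : Plane →L[ℝ] Mink :=
  LinearMap.toContinuousLinearMap
    { toFun := fun y => !₂[y 0, y 1, 0]
      map_add' := fun x y => by ext i; fin_cases i <;> simp
      map_smul' := fun c x => by ext i; fin_cases i <;> simp }

/-- The unit vector of the time axis. -/
def timeVec : Mink := EuclideanSpace.single 2 1

/-- The time coordinate. -/
def timeCoord : Mink →L[ℝ] ℝ := EuclideanSpace.proj 2

@[simp] theorem timeCoord_apply (x : Mink) : timeCoord x = x 2 := rfl

@[simp] theorem horiz_zero (x : Mink) : horiz x 0 = x 0 := rfl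

@[simp] theorem horiz_one (x : Mink) : horiz x 1 = x 1 := rfl

@[simp] theorem horiz_horizIncl (y : Plane) : horiz (horizIncl y) = y := by
  ext i; fin_cases i <;> rfl

@[simp] theorem horizIncl_two (y : Plane) : horizIncl y 2 = 0 := rfl

@[simp] theorem horiz_timeVec : horiz timeVec = 0 := by
  ext i; fin_cases i <;> simp [timeVec]

@[simp] theorem timeVec_two : timeVec 2 = 1 := by simp [timeVec]

theorem mink_decomp (x : Mink) : x = horizIncl (horiz x) + x 2 • timeVec := by
  ext i; fin_cases i <;> simp [timeVec, horizIncl, horiz]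

theorem mink_ext {x y : Mink} (h : horiz x = horiz y) (h2 : x 2 = y 2) : x = y := by
  rw [mink_decomp x, mink_decomp y, h, h2]

theorem mink_eq (x y : Mink) : mink x y = ⟪horiz x, horiz y⟫_ℝ - x 2 * y 2 := by
  rw [inner_plane]; rfl

theorem norm_sq_mink (x : Mink) : ‖x‖ ^ 2 = ‖horiz x‖ ^ 2 + x 2 ^ 2 := by
  rw [norm_sq_plane, EuclideanSpace.norm_sq_eq, Fin.sum_univ_three]
  simp

theorem norm_le_horiz_add (x : Mink) : ‖x‖ ≤ ‖horiz x‖ + |x 2| := by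
  refine (abs_le_of_sq_le_sq' ?_ (by positivity)).2
  rw [norm_sq_mink, ← sq_abs (x 2)]
  nlinarith [norm_nonneg (horiz x), abs_nonneg (x 2)]

theorem norm_horiz_le (x : Mink) : ‖horiz x‖ ≤ ‖x‖ := by
  refine (abs_le_of_sq_le_sq' ?_ (by positivity)).2
  rw [norm_sq_mink]
  nlinarith [sq_nonneg (x 2)]

theorem abs_two_le (x : Mink) : |x 2| ≤ ‖x‖ := by
  refine abs_le_of_sq_le_sq ?_ (norm_nonneg x)
  rw [norm_sq_mink]
  nlinarith [sq_nonneg ‖horiz x‖]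

/-! ## Spacelike surfaces are locally graphs -/

theorem mem_tangentConeAt_of_hasDerivAt {E : Type*} [NormedAddCommGroup E] [NormedSpace ℝ E]
    {S : Set E} {γ : ℝ → E} {p v : E} (h0 : γ 0 = p) (hd : HasDerivAt γ v 0)
    (hS : ∀ᶠ t in 𝓝 0, γ t ∈ S) : v ∈ tangentConeAt ℝ S p := by
  refine mem_tangentConeAt_of_seq (𝓝[≠] (0 : ℝ)) (fun t => t⁻¹) (fun t => γ t - p) ?_ ?_ ?_
  · have := (hd.continuousAt.tendsto.sub_const p)
    rw [h0, sub_self] at this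
    exact this.mono_left nhdsWithin_le_nhds
  · filter_upwards [nhdsWithin_le_nhds hS] with t ht
    simpa using ht
  · simpa [h0] using hd.tendsto_slope_zero

/-- The implicit function theorem provides a curve in the level set with velocity `v` at `p`. -/
theorem mem_tangentConeAt_of_levelSet {E : Type*} [NormedAddCommGroup E] [NormedSpace ℝ E]
    [FiniteDimensional ℝ E] {S U : Set E} (hU : IsOpen U) {F : E → ℝ} {F' : E →L[ℝ] ℝ} {p : E}
    (hpU : p ∈ U) (hF : HasStrictFDerivAt F F' p) (hF' : F' ≠ 0) (hFp : F p = 0)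
    (hSU : S ∩ U = {x | x ∈ U ∧ F x = 0}) {v : E} (hv : F' v = 0) : v ∈ tangentConeAt ℝ S p := by
  have hcomplete : CompleteSpace E := FiniteDimensional.complete ℝ E
  have hrange : F'.range = ⊤ := by
    refine LinearMap.range_eq_top.2 (LinearMap.surjective ?_)
    intro h0
    exact hF' (ContinuousLinearMap.coe_injective h0)
  set ψ := hF.implicitFunction F F' hrange (F p) with hψ
  let v' : F'.ker := ⟨v, hv⟩
  have hψd := (hF.to_implicitFunction hrange).hasFDerivAt
  have hline : HasDerivAt (fun t : ℝ => t • v') v' 0 := by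
    simpa using (hasDerivAt_id (0 : ℝ)).smul_const v'
  have hd : HasDerivAt (fun t : ℝ => ψ (t • v')) v 0 := by
    have h1 : HasFDerivAt ψ F'.ker.subtypeL ((0 : ℝ) • v') := by simpa using hψd
    exact h1.comp_hasDerivAt (0 : ℝ) hline
  have h0 : ψ ((0 : ℝ) • v') = p := by
    rw [zero_smul]
    exact hF.implicitFunction_apply_image hrange
  refine mem_tangentConeAt_of_hasDerivAt h0 hd ?_
  have hlim : Tendsto (fun t : ℝ => (F p, t • v')) (𝓝 0) (𝓝 (F p, (0 : F'.ker))) := by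
    have : Continuous fun t : ℝ => (F p, t • v') := by fun_prop
    simpa using this.tendsto 0
  have hU' : ∀ᶠ t : ℝ in 𝓝 0, ψ (t • v') ∈ U := by
    have := hd.continuousAt
    exact this.eventually_mem (hU.mem_nhds (by rw [h0]; exact hpU))
  filter_upwards [hlim.eventually (hF.map_implicitFunction_eq hrange), hU'] with t ht hUt
  have : ψ (t • v') ∈ S ∩ U := by
    rw [hSU]
    exact ⟨hUt, by rw [← hFp]; exact ht⟩
  exact this.1

/-- Near `p`, in a cylinder of radius `r`, the set `S` is the graph of `φ`. -/
structure IsLocalGraph (n : WithTop ℕ∞) (S : Set Mink) (p : Mink) (r : ℝ) (φ : Plane → ℝ) :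
    Prop where
  pos : 0 < r
  contDiffAt : ContDiffAt ℝ n φ (horiz p)
  lipschitz : ∀ y ∈ Metric.ball (horiz p) r, ∀ z ∈ Metric.ball (horiz p) r, |φ y - φ z| ≤ ‖y - z‖
  mem_iff : ∀ x : Mink, horiz x ∈ Metric.ball (horiz p) r → |x 2 - p 2| < r →
    (x ∈ S ↔ x 2 = φ (horiz x))

/-- The parametrization of the graph of `φ`. -/
def graphMap (φ : Plane → ℝ) (y : Plane) : Mink := horizIncl y + φ y • timeVec

@[simp] theorem horiz_graphMap (φ : Plane → ℝ) (y : Plane) : horiz (graphMap φ y) = y := by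
  simp [graphMap]

@[simp] theorem graphMap_two (φ : Plane → ℝ) (y : Plane) : graphMap φ y 2 = φ y := by
  simp [graphMap]

theorem graphMap_horiz {φ : Plane → ℝ} {x : Mink} (h : x 2 = φ (horiz x)) :
    graphMap φ (horiz x) = x :=
  mink_ext (by simp) (by simp [h])

theorem hasFDerivAt_graphMap {φ : Plane → ℝ} {φ' : Plane →L[ℝ] ℝ} {y : Plane}
    (h : HasFDerivAt φ φ' y) :
    HasFDerivAt (graphMap φ) (horizIncl + φ'.smulRight timeVec) y :=
  horizIncl.hasFDerivAt.add (h.smul_const timeVec)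

theorem abs_fderiv_lt_of_spacelike {S : Set Mink}
    (hS : ∀ p ∈ S, ∀ v ∈ tangentPlane S p, v ≠ 0 → 0 < mink v v) {φ : Plane → ℝ}
    {φ' : Plane →L[ℝ] ℝ} {y : Plane} (hφ : HasFDerivAt φ φ' y)
    (hgraph : ∀ᶠ z in 𝓝 y, graphMap φ z ∈ S) {v : Plane} (hv : v ≠ 0) : |φ' v| < ‖v‖ := by
  have hmem : horizIncl v + φ' v • timeVec ∈ tangentPlane S (graphMap φ y) := by
    refine Submodule.subset_span ?_
    have hc : Tendsto (fun t : ℝ => y + t • v) (𝓝 0) (𝓝 y) := by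
      have : Continuous fun t : ℝ => y + t • v := by fun_prop
      simpa using this.tendsto 0
    refine mem_tangentConeAt_of_hasDerivAt (γ := fun t : ℝ => graphMap φ (y + t • v)) (by simp) ?_
      (hc.eventually hgraph)
    have h1 : HasFDerivAt (graphMap φ) (horizIncl + φ'.smulRight timeVec) (y + (0 : ℝ) • v) := by
      simpa using hasFDerivAt_graphMap hφ
    exact h1.comp_hasDerivAt (0 : ℝ) (_root_.hasDerivAt_line y v 0)
  have hne : horizIncl v + φ' v • timeVec ≠ 0 := by
    intro h0
    have := congrArg horiz h0
    simp at this
    exact hv this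
  have := hS _ hgraph.self_of_nhds _ hmem hne
  rw [mink_eq] at this
  simp at this
  exact abs_lt_of_sq_lt_sq (by nlinarith) (norm_nonneg v)

theorem lipschitz_of_spacelike {S : Set Mink}
    (hS : ∀ p ∈ S, ∀ v ∈ tangentPlane S p, v ≠ 0 → 0 < mink v v) {φ : Plane → ℝ}
    {y₀ : Plane} {r : ℝ} (hφ : ∀ y ∈ Metric.ball y₀ r, DifferentiableAt ℝ φ y)
    (hgraph : ∀ y ∈ Metric.ball y₀ r, graphMap φ y ∈ S) {y z : Plane}
    (hy : y ∈ Metric.ball y₀ r) (hz : z ∈ Metric.ball y₀ r) : |φ y - φ z| ≤ ‖y - z‖ := by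
  have := (convex_ball y₀ r).norm_image_sub_le_of_norm_fderiv_le (𝕜 := ℝ) (f := φ) (C := 1) hφ
    (fun x hx => ?_) hz hy
  · simpa using this
  · refine ContinuousLinearMap.opNorm_le_bound _ zero_le_one fun v => ?_
    rcases eq_or_ne v 0 with rfl | hv
    · simp
    rw [one_mul]
    exact (abs_fderiv_lt_of_spacelike hS (hφ x hx).hasFDerivAt
      (eventually_of_mem (Metric.isOpen_ball.mem_nhds hx) hgraph) hv).le

/-- The time axis is timelike, hence not tangent, so the defining function `F` has nonzero time
derivative. Replacing the time coordinate by `F` gives a local diffeomorphism; the time coordinate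
of its inverse on `F = 0` is the graph function. -/
theorem IsProperSpacelikeSurface.exists_isLocalGraph {n : WithTop ℕ∞} (hn : 1 ≤ n) {S : Set Mink}
    (hS : IsProperSpacelikeSurface n S) {p : Mink} (hp : p ∈ S) :
    ∃ r φ, IsLocalGraph n S p r φ := by
  have hn0 : n ≠ 0 := fun h => by simp [h] at hn
  obtain ⟨U, hU, hpU, F, hF, hF', hSU⟩ := hS.embedded p hp
  have hFp : F p = 0 := by
    have : p ∈ S ∩ U := ⟨hp, hpU⟩
    rw [hSU] at this
    exact this.2
  have hFat : ContDiffAt ℝ n F p := hF.contDiffAt (hU.mem_nhds hpU)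
  have hFd : HasFDerivAt F (fderiv ℝ F p) p := (hFat.differentiableAt hn0).hasFDerivAt
  have htime : fderiv ℝ F p timeVec ≠ 0 := by
    intro h0
    have h1 := mem_tangentConeAt_of_levelSet hU hpU (hFat.hasStrictFDerivAt hn0) (hF' p hpU hFp)
      hFp hSU h0
    have h2 := hS.spacelike p hp timeVec (Submodule.subset_span h1) (fun h => by
      have := timeVec_two
      simp [h] at this)
    rw [mink_eq] at h2
    simp at h2
    linarith
  set Ψ : Mink → Mink := fun x => horizIncl (horiz x) + F x • timeVec with hΨ
  have hΨc : ContDiffAt ℝ n Ψ p :=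
    ((horizIncl ∘L horiz).contDiff.contDiffAt).add (hFat.smul contDiffAt_const)
  set L : Mink →L[ℝ] Mink := horizIncl ∘L horiz + (fderiv ℝ F p).smulRight timeVec with hL
  have hΨd : HasFDerivAt Ψ L p :=
    (horizIncl ∘L horiz).hasFDerivAt.add (hFd.smul_const timeVec)
  have hLinj : Function.Injective L := by
    rw [injective_iff_map_eq_zero]
    intro v hv
    have h1 : horiz v = 0 := by simpa [hL] using congrArg horiz hv
    have h2 : v = v 2 • timeVec := by
      conv_lhs => rw [mink_decomp v, h1]
      simp
    have h3 : fderiv ℝ F p v = 0 := by simpa [hL] using congrArg timeCoord hv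
    rw [h2, map_smul, smul_eq_mul] at h3
    have h4 : v 2 = 0 := (mul_eq_zero.1 h3).resolve_right htime
    rw [h2, h4, zero_smul]
  let L' : Mink ≃L[ℝ] Mink :=
    (LinearEquiv.ofInjectiveEndo (L : Mink →ₗ[ℝ] Mink) hLinj).toContinuousLinearEquiv
  have hL' : (L' : Mink →L[ℝ] Mink) = L := by ext v; simp [L']
  have hΨd' : HasFDerivAt Ψ (L' : Mink →L[ℝ] Mink) p := by rw [hL']; exact hΨd
  set Φ := hΨc.toOpenPartialHomeomorph Ψ hΨd' hn0 with hΦ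
  have hΦcoe : (Φ : Mink → Mink) = Ψ := rfl
  have hpΦ : p ∈ Φ.source := hΨc.mem_toOpenPartialHomeomorph_source hΨd' hn0
  have hΨp : Ψ p = horizIncl (horiz p) := by simp [hΨ, hFp]
  have htarget : horizIncl (horiz p) ∈ Φ.target := by
    rw [← hΨp]
    exact hΨc.image_mem_toOpenPartialHomeomorph_target hΨd' hn0
  have hsymmp : Φ.symm (horizIncl (horiz p)) = p := by
    rw [← hΨp, ← hΦcoe]
    exact Φ.left_inv hpΦ
  have hsymm : ContDiffAt ℝ n Φ.symm (horizIncl (horiz p)) := by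
    have := hΨc.to_localInverse hΨd' hn0
    rw [hΨp] at this
    exact this
  set φ : Plane → ℝ := fun y => Φ.symm (horizIncl y) 2 with hφ
  have hφc : ContDiffAt ℝ n φ (horiz p) :=
    (timeCoord.contDiff.contDiffAt.comp _ hsymm).comp (horiz p) horizIncl.contDiff.contDiffAt
  have hφd : ∀ᶠ y in 𝓝 (horiz p), DifferentiableAt ℝ φ y := by
    have h1 : ContDiffAt ℝ 1 φ (horiz p) := hφc.of_le hn
    filter_upwards [h1.eventually (by simp)] with y hy
    exact hy.differentiableAt one_ne_zero
  have hcont : ContinuousAt (fun y : Plane => Φ.symm (horizIncl y)) (horiz p) :=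
    ContinuousAt.comp (f := fun y : Plane => horizIncl y) hsymm.continuousAt
      horizIncl.continuous.continuousAt
  have hev1 : ∀ᶠ y in 𝓝 (horiz p), horizIncl y ∈ Φ.target :=
    horizIncl.continuous.continuousAt.eventually_mem (Φ.open_target.mem_nhds htarget)
  have hev2 : ∀ᶠ y in 𝓝 (horiz p), Φ.symm (horizIncl y) ∈ U :=
    hcont.eventually_mem (hU.mem_nhds (by rw [hsymmp]; exact hpU))
  have hgraph : ∀ y, horizIncl y ∈ Φ.target → Φ.symm (horizIncl y) ∈ U →
      horiz (Φ.symm (horizIncl y)) = y ∧ Φ.symm (horizIncl y) ∈ S := by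
    intro y h1 h2
    have h3 : Ψ (Φ.symm (horizIncl y)) = horizIncl y := Φ.right_inv h1
    have h4 : horiz (Φ.symm (horizIncl y)) = y := by simpa [hΨ] using congrArg horiz h3
    have h5 : F (Φ.symm (horizIncl y)) = 0 := by simpa [hΨ] using congrArg timeCoord h3
    have h6 : Φ.symm (horizIncl y) ∈ S ∩ U := by rw [hSU]; exact ⟨h2, h5⟩
    exact ⟨h4, h6.1⟩
  obtain ⟨r₁, hr₁, hb₁⟩ := Metric.eventually_nhds_iff_ball.1 (hφd.and (hev1.and hev2))
  obtain ⟨r₂, hr₂, hb₂⟩ := Metric.mem_nhds_iff.1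
    ((Φ.open_source.inter hU).mem_nhds ⟨hpΦ, hpU⟩)
  -- The half places the cylinder of radius and half-height `r` inside the ball of radius `r₂`.
  set r := min r₁ (r₂ / 2) with hr
  have hrr₁ : r ≤ r₁ := min_le_left _ _
  have hrr₂ : r ≤ r₂ / 2 := min_le_right _ _
  have hmemS : ∀ y ∈ Metric.ball (horiz p) r, graphMap φ y ∈ S := by
    intro y hy
    obtain ⟨-, h1, h2⟩ := hb₁ y (Metric.ball_subset_ball hrr₁ hy)
    obtain ⟨h3, h4⟩ := hgraph y h1 h2
    have h5 : graphMap φ y = Φ.symm (horizIncl y) := mink_ext (by simp [h3]) (by simp [hφ])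
    rw [h5]; exact h4
  refine ⟨r, φ, by positivity, hφc, fun y hy z hz => ?_, fun x hx1 hx2 => ⟨fun hxS => ?_, fun hx => ?_⟩⟩
  · exact lipschitz_of_spacelike hS.spacelike
      (fun y hy => (hb₁ y (Metric.ball_subset_ball hrr₁ hy)).1) hmemS hy hz
  · have h1 : x ∈ Metric.ball p r₂ := by
      rw [mem_ball_iff_norm]
      rw [mem_ball_iff_norm, ← map_sub] at hx1
      have := norm_le_horiz_add (x - p)
      have h2 : (x - p) 2 = x 2 - p 2 := rfl
      rw [h2] at this
      linarith
    obtain ⟨h2, h3⟩ := hb₂ h1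
    have h4 : F x = 0 := by
      have : x ∈ S ∩ U := ⟨hxS, h3⟩
      rw [hSU] at this
      exact this.2
    have h5 : Φ x = horizIncl (horiz x) := by simp [hΦcoe, hΨ, h4]
    have h6 : Φ.symm (horizIncl (horiz x)) = x := by rw [← h5, Φ.left_inv h2]
    simp [hφ, h6]
  · rw [← graphMap_horiz hx]
    exact hmemS _ hx1

/-! ## Properly embedded spacelike surfaces are entire graphs -/

namespace IsLocalGraph

variable {n : WithTop ℕ∞} {S : Set Mink} {p : Mink} {r : ℝ} {φ : Plane → ℝ}

theorem apply_horiz (h : IsLocalGraph n S p r φ) (hp : p ∈ S) : φ (horiz p) = p 2 :=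
  ((h.mem_iff p (Metric.mem_ball_self h.pos) (by simpa using h.pos)).1 hp).symm

theorem abs_sub_lt (h : IsLocalGraph n S p r φ) (hp : p ∈ S) {y : Plane}
    (hy : y ∈ Metric.ball (horiz p) r) : |φ y - p 2| < r := by
  rw [← h.apply_horiz hp]
  exact (h.lipschitz y hy _ (Metric.mem_ball_self h.pos)).trans_lt (mem_ball_iff_norm.1 hy)

theorem graphMap_mem (h : IsLocalGraph n S p r φ) (hp : p ∈ S) {y : Plane}
    (hy : y ∈ Metric.ball (horiz p) r) : graphMap φ y ∈ S := by
  rw [h.mem_iff _ (by simpa using hy) (by simpa using h.abs_sub_lt hp hy)]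
  simp

theorem continuousOn (h : IsLocalGraph n S p r φ) : ContinuousOn φ (Metric.ball (horiz p) r) := by
  have : LipschitzOnWith 1 φ (Metric.ball (horiz p) r) :=
    LipschitzOnWith.of_dist_le_mul fun y hy z hz => by
      simpa [Real.dist_eq, dist_eq_norm] using h.lipschitz y hy z hz
  exact this.continuousOn

end IsLocalGraph

theorem continuousOn_graphMap {φ : Plane → ℝ} {A : Set Plane} (h : ContinuousOn φ A) :
    ContinuousOn (graphMap φ) A :=
  horizIncl.continuous.continuousOn.add (h.smul continuousOn_const)

namespace IsProperSpacelikeSurface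

variable {n : WithTop ℕ∞} {S : Set Mink}

/-- A uniform version of `exists_isLocalGraph` on compact sets. -/
theorem exists_uniform_radius (hn : 1 ≤ n) (hS : IsProperSpacelikeSurface n S) {K : Set Mink}
    (hK : IsCompact K) (hKS : K ⊆ S) :
    ∃ δ > 0, ∀ q ∈ K, ∃ φ : Plane → ℝ, ContinuousOn φ (Metric.ball (horiz q) δ) ∧
      ∀ y ∈ Metric.ball (horiz q) δ, graphMap φ y ∈ S ∧ |φ y - q 2| ≤ ‖y - horiz q‖ := by
  choose! r φ hloc using fun p (hp : p ∈ S) => hS.exists_isLocalGraph hn hp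
  obtain ⟨δ, hδ, hleb⟩ := lebesgue_number_lemma_of_metric (s := K)
    (c := fun q : S => Metric.ball (q : Mink) (r q)) hK (fun _ => Metric.isOpen_ball)
    (fun q hq => mem_iUnion.2 ⟨⟨q, hKS hq⟩, Metric.mem_ball_self (hloc q (hKS hq)).pos⟩)
  refine ⟨δ, hδ, fun q hq => ?_⟩
  obtain ⟨⟨q', hq'⟩, hsub⟩ := hleb q hq
  have hl := hloc q' hq'
  have hball : Metric.ball (horiz q) δ ⊆ Metric.ball (horiz q') (r q') := by
    intro y hy
    have h1 : horizIncl y + q 2 • timeVec ∈ Metric.ball q δ := by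
      rw [mem_ball_iff_norm] at hy ⊢
      have : horizIncl y + q 2 • timeVec - q = horizIncl (y - horiz q) := by
        conv_lhs => rw [mink_decomp q]
        simp [map_sub]
      rw [this]
      refine (norm_le_horiz_add _).trans_lt ?_
      simpa using hy
    have h2 := hsub h1
    rw [mem_ball_iff_norm] at h2 ⊢
    refine lt_of_le_of_lt ?_ h2
    simpa using norm_horiz_le (horizIncl y + q 2 • timeVec - q')
  have hqq' : φ q' (horiz q) = q 2 := by
    refine ((hl.mem_iff q (hball (Metric.mem_ball_self hδ)) ?_).1 (hKS hq)).symm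
    have h2 := hsub (Metric.mem_ball_self hδ)
    rw [mem_ball_iff_norm] at h2
    exact lt_of_le_of_lt (abs_two_le (q - q')) h2
  refine ⟨φ q', hl.continuousOn.mono hball, fun y hy => ⟨hl.graphMap_mem hq' (hball hy), ?_⟩⟩
  rw [← hqq']
  exact hl.lipschitz y (hball hy) _ (hball (Metric.mem_ball_self hδ))

/-- Segments of the horizontal plane lift to `S`. -/
theorem exists_lift_segment (hn : 1 ≤ n) (hS : IsProperSpacelikeSurface n S) {p : Mink}
    (hp : p ∈ S) (v : Plane) :
    ∃ h : ℝ → ℝ, Continuous h ∧ h 0 = p 2 ∧ ∀ s ∈ Icc (0 : ℝ) 1,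
      horizIncl (horiz p + s • v) + h s • timeVec ∈ S ∧ |h s - p 2| ≤ s * ‖v‖ := by
  -- The lift has slope at most 1, so it stays in this ball. The set is compact because `S` is
  -- closed, and one step size `τ` serves for the whole segment.
  have hK : IsCompact (S ∩ Metric.closedBall p (2 * ‖v‖)) :=
    (isCompact_closedBall _ _).inter_left hS.closed
  obtain ⟨δ, hδ, hunif⟩ := hS.exists_uniform_radius hn hK inter_subset_left
  set τ := δ / (2 * (‖v‖ + 1)) with hτ
  have hv1 : 0 < ‖v‖ + 1 := by positivity
  have hτ0 : 0 < τ := by positivity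
  have hτv : τ * ‖v‖ < δ := by
    have : τ * (‖v‖ + 1) = δ / 2 := by rw [hτ]; field_simp
    nlinarith
  let P : ℝ → Prop := fun t => ∃ h : ℝ → ℝ, Continuous h ∧ h 0 = p 2 ∧ ∀ s ∈ Icc (0 : ℝ) t,
      horizIncl (horiz p + s • v) + h s • timeVec ∈ S ∧ |h s - p 2| ≤ s * ‖v‖
  have hmono : ∀ t t', t' ≤ t → P t → P t' := fun t t' htt' ⟨h, h1, h2, h3⟩ =>
    ⟨h, h1, h2, fun s hs => h3 s ⟨hs.1, hs.2.trans htt'⟩⟩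
  have hstep : ∀ t, 0 ≤ t → t ≤ 1 → P t → P (t + τ) := by
    rintro t ht0 ht1 ⟨h, hcont, h0, hh⟩
    set q := horizIncl (horiz p + t • v) + h t • timeVec with hq
    obtain ⟨hqS, hqt⟩ := hh t ⟨ht0, le_rfl⟩
    have hqh : horiz q = horiz p + t • v := by simp [hq]
    have hq2 : q 2 = h t := by simp [hq]
    have hqK : q ∈ S ∩ Metric.closedBall p (2 * ‖v‖) := by
      refine ⟨hqS, ?_⟩
      rw [mem_closedBall_iff_norm]
      refine (norm_le_horiz_add _).trans ?_
      have e1 : horiz (q - p) = t • v := by rw [map_sub, hqh]; abel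
      have e2 : (q - p) 2 = h t - p 2 := by rw [← hq2]; rfl
      rw [e1, e2, norm_smul, Real.norm_of_nonneg ht0]
      nlinarith [norm_nonneg v]
    obtain ⟨φ, hφc, hφ⟩ := hunif q hqK
    -- Clamping the parameter keeps the argument of `φ` in the ball where it is continuous, so the
    -- glued function is continuous on the whole line.
    set cl : ℝ → ℝ := fun s => max t (min s (t + τ)) with hcl
    have hclc : Continuous cl := by fun_prop
    have hclm : ∀ s, t ≤ cl s ∧ cl s ≤ t + τ := fun s =>
      ⟨le_max_left _ _, max_le (by linarith) (min_le_right _ _)⟩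
    have hball : ∀ s, t ≤ s → s ≤ t + τ →
        horiz p + s • v ∈ Metric.ball (horiz q) δ ∧
          ‖horiz p + s • v - horiz q‖ = (s - t) * ‖v‖ := by
      intro s hs1 hs2
      have e1 : horiz p + s • v - horiz q = (s - t) • v := by rw [hqh, sub_smul]; abel
      have e2 : ‖horiz p + s • v - horiz q‖ = (s - t) * ‖v‖ := by
        rw [e1, norm_smul, Real.norm_of_nonneg (by linarith)]
      refine ⟨?_, e2⟩
      rw [mem_ball_iff_norm, e2]
      nlinarith [norm_nonneg v]
    have hkc : Continuous fun s => φ (horiz p + cl s • v) :=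
      hφc.comp_continuous (by fun_prop) fun s => (hball _ (hclm s).1 (hclm s).2).1
    have hkt : φ (horiz p + cl t • v) = h t := by
      have e1 : cl t = t := by simp [hcl, hτ0.le]
      have := (hφ _ (hball t le_rfl (by linarith)).1).2
      rw [(hball t le_rfl (by linarith)).2, sub_self, zero_mul, hq2] at this
      rw [e1]
      exact sub_eq_zero.1 (abs_nonpos_iff.1 this)
    refine ⟨fun s => if s ≤ t then h s else φ (horiz p + cl s • v), ?_, ?_, ?_⟩
    · exact hcont.if_le hkc continuous_id continuous_const fun s hs => by rw [hs, hkt]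
    · simp [ht0, h0]
    · rintro s ⟨hs0, hs1⟩
      by_cases hst : s ≤ t
      · simp only [hst, if_true]
        exact hh s ⟨hs0, hst⟩
      · simp only [hst, if_false]
        have hts : t ≤ s := (not_le.1 hst).le
        have e1 : cl s = s := by
          simp only [hcl]
          rw [min_eq_left hs1, max_eq_right hts]
        obtain ⟨hb, hn⟩ := hball s hts hs1
        obtain ⟨m1, m2⟩ := hφ _ hb
        rw [e1]
        refine ⟨m1, ?_⟩
        rw [hn, hq2] at m2
        calc |φ (horiz p + s • v) - p 2|
            ≤ |φ (horiz p + s • v) - h t| + |h t - p 2| := abs_sub_le _ _ _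
          _ ≤ (s - t) * ‖v‖ + t * ‖v‖ := add_le_add m2 hqt
          _ = s * ‖v‖ := by ring
  have hind : ∀ m : ℕ, P (min (m * τ) 1) := by
    intro m
    induction m with
    | zero =>
      refine ⟨fun _ => p 2, continuous_const, rfl, fun s hs => ?_⟩
      have hs0 : s = 0 := le_antisymm (by simpa using hs.2) hs.1
      rw [hs0]
      refine ⟨?_, by simp⟩
      rw [zero_smul, add_zero, ← mink_decomp]
      exact hp
    | succ m ih =>
      refine hmono _ _ ?_ (hstep _ (le_min (by positivity) zero_le_one) (min_le_right _ _) ih)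
      push_cast
      rcases le_total (m * τ) 1 with h1 | h1
      · rw [min_eq_left h1]
        exact (min_le_left _ _).trans (by linarith)
      · rw [min_eq_right h1]
        exact (min_le_right _ _).trans (by linarith)
  obtain ⟨m, hm⟩ := exists_nat_ge (1 / τ)
  have := hind m
  rw [div_le_iff₀ hτ0] at hm
  rwa [min_eq_right hm] at this

theorem isLocalHomeomorph_horiz (hn : 1 ≤ n) (hS : IsProperSpacelikeSurface n S) :
    IsLocalHomeomorph (fun q : S => horiz q) := by
  classical
  refine IsLocalHomeomorph.mk _ fun ⟨p, hp⟩ => ?_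
  obtain ⟨r, φ, hl⟩ := hS.exists_isLocalGraph hn hp
  have hval : ContinuousOn (fun y => ((if hy : y ∈ Metric.ball (horiz p) r then
      ⟨graphMap φ y, hl.graphMap_mem hp hy⟩ else ⟨p, hp⟩ : S) : Mink))
        (Metric.ball (horiz p) r) := by
    refine (continuousOn_graphMap hl.continuousOn).congr fun y hy => ?_
    simp only [hy, dif_pos]
  refine ⟨{ toFun := fun q : S => horiz q
            invFun := fun y => if hy : y ∈ Metric.ball (horiz p) r then
              ⟨graphMap φ y, hl.graphMap_mem hp hy⟩ else ⟨p, hp⟩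
            source := {q : S | horiz (q : Mink) ∈ Metric.ball (horiz p) r ∧ |(q : Mink) 2 - p 2| < r}
            target := Metric.ball (horiz p) r
            map_source' := fun q hq => hq.1
            map_target' := ?_
            left_inv' := ?_
            right_inv' := ?_
            open_source := ?_
            open_target := Metric.isOpen_ball
            continuousOn_toFun := (horiz.continuous.comp continuous_subtype_val).continuousOn
            continuousOn_invFun := Topology.IsInducing.subtypeVal.continuousOn_iff.2 hval },
          ⟨Metric.mem_ball_self hl.pos, by simpa using hl.pos⟩, fun _ _ => rfl⟩
  · intro y hy
    simp only [hy, dif_pos]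
    exact ⟨by simpa using hy, by simpa using hl.abs_sub_lt hp hy⟩
  · rintro ⟨q, hq⟩ ⟨h1, h2⟩
    simp only [h1, dif_pos]
    exact Subtype.ext (graphMap_horiz ((hl.mem_iff q h1 h2).1 hq))
  · intro y hy
    simp only [hy, dif_pos, horiz_graphMap]
  · refine (Metric.isOpen_ball.preimage (horiz.continuous.comp continuous_subtype_val)).inter ?_
    exact isOpen_lt ((timeCoord.continuous.comp continuous_subtype_val).sub continuous_const).abs
      continuous_const

/-- A properly embedded spacelike surface is the graph of a function on the plane. -/
theorem exists_eq_graph (hn : 1 ≤ n) (hS : IsProperSpacelikeSurface n S) :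
    ∃ f : Plane → ℝ, ContDiff ℝ n f ∧ ∀ x, x ∈ S ↔ x 2 = f (horiz x) := by
  obtain ⟨p, hp⟩ := hS.connected.nonempty
  have hconn : PreconnectedSpace S :=
    isPreconnected_iff_preconnectedSpace.1 hS.connected.isPreconnected
  have hloc := hS.isLocalHomeomorph_horiz hn
  have hsep : IsSeparatedMap (fun q : S => horiz q) := T2Space.isSeparatedMap _
  choose h hcont h0 hh using fun x : Plane => hS.exists_lift_segment hn hp (x - horiz p)
  -- The lifted segments from `p` together lift the radial contraction of the plane. Each is
  -- continuous in time; joint continuity follows from uniqueness of lifts along a local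
  -- homeomorphism. At time 1 this is a continuous section of the projection.
  let G : unitInterval × Plane → S := fun tx =>
    ⟨horizIncl (horiz p + (tx.1 : ℝ) • (tx.2 - horiz p)) + h tx.2 tx.1 • timeVec,
      (hh tx.2 tx.1 tx.1.2).1⟩
  let Γ : C(unitInterval × Plane, Plane) :=
    ⟨fun tx => horiz p + (tx.1 : ℝ) • (tx.2 - horiz p), by fun_prop⟩
  have hG : Continuous G := by
    refine hloc.continuous_lift hsep Γ ?_ ?_ ?_
    · funext tx
      simp [G, Γ]
    · refine Continuous.subtype_mk ?_ _
      simp only [Set.Icc.coe_zero, zero_smul, add_zero, h0]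
      exact continuous_const
    · intro x
      refine Continuous.subtype_mk ?_ _
      exact (horizIncl.continuous.comp (by fun_prop)).add
        (((hcont x).comp continuous_subtype_val).smul continuous_const)
  let σ : Plane → S := fun x => G (1, x)
  have hσ : Continuous σ := hG.comp (by fun_prop)
  have hσh : ∀ x, horiz (σ x : Mink) = x := fun x => by simp [σ, G]
  have hσp : σ (horiz p) = ⟨p, hp⟩ := by
    refine Subtype.ext (mink_ext (hσh _) ?_)
    have := (hh (horiz p) 1 (by simp)).2
    simp only [sub_self, norm_zero, mul_zero] at this
    simpa [σ, G] using sub_eq_zero.1 (abs_nonpos_iff.1 this)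
  -- The section after the projection and the identity are two lifts of the same map on the
  -- connected space `S`, equal at `p`; so the section is onto.
  have hid : (fun q : S => σ (horiz (q : Mink))) = fun q => q := by
    refine hsep.eq_of_comp_eq hloc.isLocallyInjective
      (hσ.comp (horiz.continuous.comp continuous_subtype_val)) continuous_id ?_ ⟨p, hp⟩ hσp
    funext q
    simp [hσh]
  have hgr : ∀ x, x ∈ S ↔ x 2 = (σ (horiz x) : Mink) 2 := by
    refine fun x => ⟨fun hx => ?_, fun hx => ?_⟩
    · have := congrFun hid ⟨x, hx⟩
      simp only at this
      rw [this]
    · have : x = σ (horiz x) := mink_ext (hσh _).symm hx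
      rw [this]
      exact (σ (horiz x)).2
  refine ⟨fun x => (σ x : Mink) 2, ?_, hgr⟩
  have hfc : Continuous fun x => (σ x : Mink) 2 :=
    timeCoord.continuous.comp (continuous_subtype_val.comp hσ)
  refine contDiff_iff_contDiffAt.2 fun y => ?_
  obtain ⟨r, φ, hl⟩ := hS.exists_isLocalGraph hn (σ y).2
  have hc := hl.contDiffAt
  rw [hσh] at hc
  refine hc.congr_of_eventuallyEq ?_
  have h1 : ∀ᶠ z in 𝓝 y, z ∈ Metric.ball y r := Metric.ball_mem_nhds y hl.pos
  have h2 : ∀ᶠ z in 𝓝 y, |(σ z : Mink) 2 - (σ y : Mink) 2| < r := by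
    have : Continuous fun z => |(σ z : Mink) 2 - (σ y : Mink) 2| := (hfc.sub continuous_const).abs
    exact this.continuousAt.eventually_mem (Iio_mem_nhds (by simpa using hl.pos))
  filter_upwards [h1, h2] with z hz1 hz2
  have := (hl.mem_iff (σ z) (by rw [hσh, hσh]; exact hz1) hz2).1 (σ z).2
  rwa [hσh] at this

end IsProperSpacelikeSurface

/-! ## Differential geometry of spacelike graphs -/

/-- The gradient of a function on the plane, in coordinates. -/
def planeGrad (f : Plane → ℝ) (x : Plane) : Plane :=
  !₂[fderiv ℝ f x (EuclideanSpace.single 0 1), fderiv ℝ f x (EuclideanSpace.single 1 1)]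

theorem fderiv_eq_inner_planeGrad (f : Plane → ℝ) (x v : Plane) :
    fderiv ℝ f x v = ⟪planeGrad f x, v⟫_ℝ := by
  conv_lhs => rw [plane_eq v]
  rw [inner_plane, map_add, map_smul, map_smul]
  simp [planeGrad, mul_comm]

theorem hasGradientAt_planeGrad {f : Plane → ℝ} {x : Plane} (h : DifferentiableAt ℝ f x) :
    HasGradientAt f (planeGrad f x) x := by
  rw [hasGradientAt_iff_hasFDerivAt]
  refine h.hasFDerivAt.congr_fderiv ?_
  ext v
  simp [fderiv_eq_inner_planeGrad]

theorem contDiff_planeGrad {f : Plane → ℝ} {m n : WithTop ℕ∞} (h : ContDiff ℝ n f)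
    (hmn : m + 1 ≤ n) : ContDiff ℝ m (planeGrad f) := by
  have hd : ContDiff ℝ m (fderiv ℝ f) := h.fderiv_right hmn
  rw [contDiff_euclidean]
  intro i
  fin_cases i
  · exact hd.clm_apply contDiff_const
  · exact hd.clm_apply contDiff_const

theorem fderiv_planeGrad_symm {f : Plane → ℝ} (h : ContDiff ℝ 2 f) (x v w : Plane) :
    ⟪fderiv ℝ (planeGrad f) x v, w⟫_ℝ = ⟪v, fderiv ℝ (planeGrad f) x w⟫_ℝ := by
  have hg : ContDiff ℝ 1 (planeGrad f) := contDiff_planeGrad h (by norm_num)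
  have h1 : ∀ y, HasFDerivAt f (innerSL ℝ (planeGrad f y)) y := fun y =>
    ((h.differentiable (by norm_num)) y).hasFDerivAt.congr_fderiv (by
      ext v; simp [fderiv_eq_inner_planeGrad])
  have h2 : HasFDerivAt (fun y => innerSL ℝ (planeGrad f y))
      ((innerSL ℝ).comp (fderiv ℝ (planeGrad f) x)) x :=
    (innerSL ℝ).hasFDerivAt.comp x ((hg.differentiable one_ne_zero) x).hasFDerivAt
  have := second_derivative_symmetric h1 h2 v w
  simpa [real_inner_comm v] using this

/-- The future unit normal of a spacelike plane of slope `y`. -/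
def unitNormal (y : Plane) : Mink := (√(1 - ‖y‖ ^ 2))⁻¹ • (horizIncl y + timeVec)

theorem horiz_unitNormal (y : Plane) : horiz (unitNormal y) = (√(1 - ‖y‖ ^ 2))⁻¹ • y := by
  simp [unitNormal]

theorem unitNormal_two (y : Plane) : unitNormal y 2 = (√(1 - ‖y‖ ^ 2))⁻¹ := by
  simp [unitNormal]

theorem unitNormal_mem {y : Plane} (hy : ‖y‖ < 1) : unitNormal y ∈ hyperbolicPlane := by
  have hs := one_sub_norm_sq_pos hy
  refine ⟨?_, ?_⟩
  · rw [mink_eq, horiz_unitNormal, unitNormal_two, real_inner_smul_left, inner_smul_right,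
      real_inner_self_eq_norm_sq]
    have hss := Real.sq_sqrt hs.le
    have : √(1 - ‖y‖ ^ 2) ≠ 0 := (Real.sqrt_pos.2 hs).ne'
    field_simp
    linarith
  · rw [unitNormal_two]
    exact inv_pos.2 (Real.sqrt_pos.2 hs)

theorem kleinProj_eq (x : Mink) : kleinProj x = (x 2)⁻¹ • horiz x := by
  ext i; fin_cases i <;> simp [kleinProj, div_eq_inv_mul]

theorem kleinProj_unitNormal {y : Plane} (hy : ‖y‖ < 1) : kleinProj (unitNormal y) = y := by
  have hs := Real.sqrt_pos.2 (one_sub_norm_sq_pos hy)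
  rw [kleinProj_eq, horiz_unitNormal, unitNormal_two, inv_inv, smul_smul, mul_inv_cancel₀ hs.ne',
    one_smul]

theorem eq_unitNormal {x : Mink} (hx : x ∈ hyperbolicPlane) {y : Plane} (hy : ‖y‖ < 1)
    (h : horiz x = x 2 • y) : x = unitNormal y := by
  have hs := one_sub_norm_sq_pos hy
  have h1 := hx.1
  rw [mink_eq, h, real_inner_smul_left, inner_smul_right, real_inner_self_eq_norm_sq] at h1
  have h2 : x 2 = (√(1 - ‖y‖ ^ 2))⁻¹ := by
    have h3 : (x 2 * √(1 - ‖y‖ ^ 2)) ^ 2 = 1 := by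
      rw [mul_pow, Real.sq_sqrt hs.le]; linarith
    have h4 := (pow_eq_one_iff_of_nonneg
      (mul_nonneg hx.2.le (Real.sqrt_nonneg (1 - ‖y‖ ^ 2))) two_ne_zero).1 h3
    exact eq_inv_of_mul_eq_one_left h4
  refine mink_ext ?_ ?_
  · rw [h, horiz_unitNormal, h2]
  · rw [h2, unitNormal_two]

theorem norm_kleinProj_lt {x : Mink} (hx : x ∈ hyperbolicPlane) : ‖kleinProj x‖ < 1 := by
  have h1 := hx.1
  rw [mink_eq, real_inner_self_eq_norm_sq] at h1
  rw [kleinProj_eq, norm_smul, norm_inv, Real.norm_of_nonneg hx.2.le, inv_mul_lt_one₀ hx.2]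
  exact lt_of_pow_lt_pow_left₀ 2 hx.2.le (by linarith)

theorem eq_unitNormal_kleinProj {x : Mink} (hx : x ∈ hyperbolicPlane) :
    x = unitNormal (kleinProj x) :=
  eq_unitNormal hx (norm_kleinProj_lt hx) (by
    rw [kleinProj_eq, smul_smul, mul_inv_cancel₀ hx.2.ne', one_smul])

theorem contDiffAt_unitNormal {n : WithTop ℕ∞} {y : Plane} (hy : ‖y‖ < 1) :
    ContDiffAt ℝ n unitNormal y := by
  have hs := one_sub_norm_sq_pos hy
  have h1 : ContDiffAt ℝ n (fun y : Plane => √(1 - ‖y‖ ^ 2)) y :=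
    (contDiffAt_const.sub (contDiff_norm_sq ℝ).contDiffAt).sqrt hs.ne'
  exact (h1.inv (Real.sqrt_pos.2 hs).ne').smul
    (horizIncl.contDiff.contDiffAt.add contDiffAt_const)

/-- `S` is the spacelike graph of the `C²` function `f`. -/
structure IsSpacelikeGraph (S : Set Mink) (f : Plane → ℝ) : Prop where
  contDiff : ContDiff ℝ 2 f
  mem_iff : ∀ x, x ∈ S ↔ x 2 = f (horiz x)
  spacelike : ∀ p ∈ S, ∀ v ∈ tangentPlane S p, v ≠ 0 → 0 < mink v v

namespace IsSpacelikeGraph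

variable {S : Set Mink} {f : Plane → ℝ}

theorem graphMap_mem (h : IsSpacelikeGraph S f) (y : Plane) : graphMap f y ∈ S := by
  rw [h.mem_iff]; simp

theorem differentiableAt (h : IsSpacelikeGraph S f) (y : Plane) : DifferentiableAt ℝ f y :=
  (h.contDiff.differentiable (by norm_num)) y

theorem contDiff_grad (h : IsSpacelikeGraph S f) : ContDiff ℝ 1 (planeGrad f) :=
  contDiff_planeGrad h.contDiff (by norm_num)

theorem hasFDerivAt_grad (h : IsSpacelikeGraph S f) (y : Plane) :
    HasFDerivAt (planeGrad f) (fderiv ℝ (planeGrad f) y) y :=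
  ((h.contDiff_grad.differentiable one_ne_zero) y).hasFDerivAt

theorem norm_grad_lt (h : IsSpacelikeGraph S f) (y : Plane) : ‖planeGrad f y‖ < 1 := by
  rcases eq_or_ne (planeGrad f y) 0 with h0 | h0
  · rw [h0]; simp
  have := abs_fderiv_lt_of_spacelike h.spacelike (h.differentiableAt y).hasFDerivAt
    (Eventually.of_forall h.graphMap_mem) h0
  rw [fderiv_eq_inner_planeGrad, real_inner_self_eq_norm_sq, abs_of_nonneg (by positivity)] at this
  have hp : 0 < ‖planeGrad f y‖ := norm_pos_iff.2 h0
  nlinarith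

theorem mem_tangentPlane_iff (h : IsSpacelikeGraph S f) {p : Mink} (hp : p ∈ S) (v : Mink) :
    v ∈ tangentPlane S p ↔ v 2 = ⟪planeGrad f (horiz p), horiz v⟫_ℝ := by
  constructor
  · intro hv
    -- This is the derivative of a function constant on `S`, so it maps the tangent cone of `S` into
    -- that of a single point, which is zero.
    set Φ : Mink →L[ℝ] ℝ := timeCoord - (fderiv ℝ f (horiz p)).comp horiz with hΦ
    have hd : HasFDerivAt (fun x : Mink => timeCoord x - f (horiz x)) Φ p :=
      timeCoord.hasFDerivAt.sub
        ((h.differentiableAt (horiz p)).hasFDerivAt.comp p horiz.hasFDerivAt)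
    have hsub : tangentPlane S p ≤ LinearMap.ker (Φ : Mink →ₗ[ℝ] ℝ) := by
      refine Submodule.span_le.2 fun w hw => ?_
      have h1 := (hd.hasFDerivWithinAt (s := S)).mapsTo_tangent_cone hw
      have h2 : (fun x : Mink => timeCoord x - f (horiz x)) '' S ⊆ {0} := by
        rintro _ ⟨x, hx, rfl⟩
        simp [(h.mem_iff x).1 hx]
      have h3 := tangentConeAt_mono h2 h1
      have h4 := tangentConeAt_subset_zero (by
        rw [accPt_iff_nhds]
        push Not
        exact ⟨univ, univ_mem, fun y hy => by
          have h5 := (h.mem_iff p).1 hp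
          rw [timeCoord_apply, h5, sub_self]; simpa using hy.2⟩) h3
      simpa using h4
    have := hsub hv
    rw [← fderiv_eq_inner_planeGrad]
    simpa [hΦ, sub_eq_zero] using this
  · intro hv
    refine Submodule.subset_span ?_
    refine mem_tangentConeAt_of_hasDerivAt
      (γ := fun t : ℝ => graphMap f (horiz p + t • horiz v)) ?_ ?_
      (Eventually.of_forall fun t => h.graphMap_mem _)
    · simpa using graphMap_horiz ((h.mem_iff p).1 hp)
    · have h1 := hasFDerivAt_graphMap (h.differentiableAt (horiz p + (0 : ℝ) • horiz v)).hasFDerivAt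
      have h2 := h1.comp_hasDerivAt (0 : ℝ) (_root_.hasDerivAt_line (horiz p) (horiz v) 0)
      refine h2.congr_deriv ?_
      refine mink_ext (by simp) ?_
      simp [hv, fderiv_eq_inner_planeGrad]

/-- A future unit vector orthogonal to the tangent plane has horizontal part equal to its time
component times the gradient, so the choice made by `Classical.epsilon` is forced. -/
theorem gaussMap_eq (h : IsSpacelikeGraph S f) {p : Mink} (hp : p ∈ S) :
    gaussMap S p = unitNormal (planeGrad f (horiz p)) := by
  have hlt := h.norm_grad_lt (horiz p)
  have hex : ∃ n : Mink, n ∈ hyperbolicPlane ∧ ∀ v ∈ tangentPlane S p, mink n v = 0 := by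
    refine ⟨unitNormal (planeGrad f (horiz p)), unitNormal_mem hlt, fun v hv => ?_⟩
    rw [h.mem_tangentPlane_iff hp] at hv
    rw [mink_eq, horiz_unitNormal, unitNormal_two, hv, real_inner_smul_left, sub_self]
  obtain ⟨h1, h2⟩ := Classical.epsilon_spec hex
  refine eq_unitNormal h1 hlt ?_
  change horiz (gaussMap S p) = gaussMap S p 2 • planeGrad f (horiz p)
  refine ext_inner_right ℝ fun w => ?_
  have h3 := h2 (horizIncl w + ⟪planeGrad f (horiz p), w⟫_ℝ • timeVec)
    ((h.mem_tangentPlane_iff hp _).2 (by simp))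
  rw [mink_eq] at h3
  simp only [map_add, map_smul, horiz_horizIncl, horiz_timeVec, smul_zero, add_zero,
    PiLp.add_apply, PiLp.smul_apply, horizIncl_two, timeVec_two, zero_add, smul_eq_mul,
    mul_one] at h3
  rw [real_inner_smul_left]
  exact sub_eq_zero.1 h3

/-- The tangent space in the coordinates of the graph. -/
def tangentEquiv (h : IsSpacelikeGraph S f) {p : Mink} (hp : p ∈ S) :
    Plane ≃ₗ[ℝ] tangentPlane S p where
  toFun w := ⟨horizIncl w + ⟪planeGrad f (horiz p), w⟫_ℝ • timeVec,
    (h.mem_tangentPlane_iff hp _).2 (by simp)⟩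
  map_add' v w := by
    refine Subtype.ext (mink_ext (by simp) ?_)
    simp [inner_add_right]
  map_smul' c w := by
    refine Subtype.ext (mink_ext (by simp) ?_)
    simp [inner_smul_right]
  invFun v := horiz v
  left_inv w := by simp
  right_inv v := by
    refine Subtype.ext (mink_ext (by simp) ?_)
    simp [(h.mem_tangentPlane_iff hp _).1 v.2]

/-- Horizontal projection identifies the tangent plane with the horizontal plane and the normal with
`(1 - ‖∇f‖²)^(-1/2) ∇f`, whose derivative is computed by the chain rule; determinants are invariant
under conjugation. Positivity excludes the default value 0, so invariance of the tangent plane comes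
from the definition. -/
theorem gaussianCurvature_eq (h : IsSpacelikeGraph S f) {p : Mink} (hp : p ∈ S)
    (hpos : 0 < gaussianCurvature S p) :
    gaussianCurvature S p = (hyperboloidHessian (planeGrad f (horiz p)) ∘L
      fderiv ℝ (planeGrad f) (horiz p)).det := by
  unfold gaussianCurvature at hpos ⊢
  split_ifs at hpos ⊢ with hinv
  · set x := horiz p with hx
    have hpx : graphMap f x = p := graphMap_horiz ((h.mem_iff p).1 hp)
    have hlt := h.norm_grad_lt x
    have hdiff : DifferentiableWithinAt ℝ (gaussMap S) S p := by
      have h1 : DifferentiableAt ℝ (fun q : Mink => unitNormal (planeGrad f (horiz q))) p := by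
        refine DifferentiableAt.comp (g := unitNormal) p
          ((contDiffAt_unitNormal (n := 1) hlt).differentiableAt one_ne_zero) ?_
        exact DifferentiableAt.comp (g := planeGrad f) p (h.hasFDerivAt_grad x).differentiableAt
          horiz.differentiableAt
      exact h1.differentiableWithinAt.congr (fun q hq => h.gaussMap_eq hq) (h.gaussMap_eq hp)
    have hX := hasFDerivAt_graphMap (h.differentiableAt x).hasFDerivAt
    have hcomp : HasFDerivAt (fun y => gaussMap S (graphMap f y))
        ((fderivWithin ℝ (gaussMap S) S p).comp
          (horizIncl + (fderiv ℝ f x).smulRight timeVec)) x := by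
      have h1 := hdiff.hasFDerivWithinAt
      rw [← hpx] at h1 ⊢
      exact h1.comp_hasFDerivAt x hX (Eventually.of_forall h.graphMap_mem)
    have hcomp2 := horiz.hasFDerivAt.comp x hcomp
    have hother : HasFDerivAt (fun y => (√(1 - ‖planeGrad f y‖ ^ 2))⁻¹ • planeGrad f y)
        (hyperboloidHessian (planeGrad f x) ∘L fderiv ℝ (planeGrad f) x) x :=
      (hasFDerivAt_inv_sqrt_smul hlt).comp x (h.hasFDerivAt_grad x)
    have hfun : (fun y => horiz (gaussMap S (graphMap f y))) =
        fun y => (√(1 - ‖planeGrad f y‖ ^ 2))⁻¹ • planeGrad f y := by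
      funext y
      rw [h.gaussMap_eq (h.graphMap_mem y), horiz_unitNormal, horiz_graphMap]
    have huniq := (hcomp2.congr_of_eventuallyEq (Eventually.of_forall fun y =>
      (congrFun hfun y).symm)).unique hother
    have hconj : (fderivWithin ℝ (gaussMap S) S p : Mink →ₗ[ℝ] Mink).restrict hinv =
        (h.tangentEquiv hp : Plane →ₗ[ℝ] tangentPlane S p) ∘ₗ
          ((hyperboloidHessian (planeGrad f x) ∘L fderiv ℝ (planeGrad f) x :
            Plane →L[ℝ] Plane) : Plane →ₗ[ℝ] Plane) ∘ₗ
          ((h.tangentEquiv hp).symm : tangentPlane S p →ₗ[ℝ] Plane) := by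
      ext1 v
      refine (h.tangentEquiv hp).symm.injective ?_
      have e1 := congrArg (fun L : Plane →L[ℝ] Plane => L ((h.tangentEquiv hp).symm v)) huniq
      have e2 : horizIncl ((h.tangentEquiv hp).symm v) +
          fderiv ℝ f x ((h.tangentEquiv hp).symm v) • timeVec = v := by
        rw [fderiv_eq_inner_planeGrad]
        exact congrArg Subtype.val ((h.tangentEquiv hp).apply_symm_apply v)
      simp only [ContinuousLinearMap.comp_apply, add_apply,
        ContinuousLinearMap.smulRight_apply, e2] at e1
      simp only [LinearMap.comp_apply, LinearEquiv.coe_coe, LinearEquiv.symm_apply_apply]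
      exact e1
    rw [hconj, LinearMap.det_conj]
  · exact absurd hpos (lt_irrefl _)

end IsSpacelikeGraph

/-! ### Definiteness of the Hessian. -/

/-- A nonvanishing continuous real function on the plane has constant sign. -/
theorem forall_pos_or_forall_neg {ψ : Plane → ℝ} (hc : Continuous ψ) (hne : ∀ x, ψ x ≠ 0) :
    (∀ x, 0 < ψ x) ∨ ∀ x, ψ x < 0 := by
  by_contra hcon
  push Not at hcon
  obtain ⟨⟨x, hx⟩, y, hy⟩ := hcon
  obtain ⟨z, hz⟩ := mem_range_of_exists_le_of_exists_ge hc ⟨x, hx⟩ ⟨y, hy⟩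
  exact hne z hz

/-- Sylvester's criterion, by completing the square after multiplication by the first diagonal
entry. -/
theorem pos_of_det_pos {A : Plane →L[ℝ] Plane} (hA : ∀ v w, ⟪A v, w⟫_ℝ = ⟪v, A w⟫_ℝ)
    (hdet : 0 < A.det) (h0 : 0 < A (EuclideanSpace.single 0 1) 0) {v : Plane} (hv : v ≠ 0) :
    0 < ⟪A v, v⟫_ℝ := by
  have hv' : v = !₂[v 0, v 1] := by ext i; fin_cases i <;> rfl
  rw [hv', quadratic_form_plane hA]
  rw [det_plane, symm_entry_plane hA] at hdet
  set p := A (EuclideanSpace.single 0 1) 0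
  set q := A (EuclideanSpace.single 0 1) 1
  set r := A (EuclideanSpace.single 1 1) 1
  refine pos_of_mul_pos_right (a := p) ?_ h0.le
  have e : p * (p * v 0 ^ 2 + 2 * q * v 0 * v 1 + r * v 1 ^ 2) =
    (p * v 0 + q * v 1) ^ 2 + (p * r - q * q) * v 1 ^ 2 := by ring
  rw [e]
  rcases eq_or_ne (v 1) 0 with h1 | h1
  · have h2 : v 0 ≠ 0 := fun h2 => hv (by rw [hv', h1, h2]; ext i; fin_cases i <;> rfl)
    have : p * v 0 ≠ 0 := mul_ne_zero h0.ne' h2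
    simp only [h1, mul_zero, add_zero, ne_eq, OfNat.ofNat_ne_zero, not_false_eq_true, zero_pow]
    positivity
  · have : 0 < v 1 ^ 2 := by positivity
    have := mul_pos hdet this
    nlinarith [sq_nonneg (p * v 0 + q * v 1)]

/-- The Hessian has positive determinant, so its first diagonal entry never vanishes and has
constant sign on the connected plane. That sign decides whether `f` or `-f` is convex. -/
theorem IsSpacelikeGraph.isConvexSpacelike_or {S : Set Mink} {f : Plane → ℝ}
    (h : IsSpacelikeGraph S f) {a : ℝ} (ha : 0 < a)
    (hcurv : ∀ p ∈ S, a ≤ gaussianCurvature S p) :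
    IsConvexSpacelike a f (planeGrad f) (fderiv ℝ (planeGrad f)) ∨
      IsConvexSpacelike a (fun x => -f x) (fun x => -planeGrad f x)
        (fun x => -fderiv ℝ (planeGrad f) x) := by
  have hK : ∀ x, a ≤ (hyperboloidHessian (planeGrad f x) ∘L fderiv ℝ (planeGrad f) x).det := by
    intro x
    have h1 := hcurv _ (h.graphMap_mem x)
    rw [h.gaussianCurvature_eq (h.graphMap_mem x) (ha.trans_le h1), horiz_graphMap] at h1
    exact h1
  have hdet : ∀ x, 0 < (fderiv ℝ (planeGrad f) x).det := by
    intro x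
    have h1 := ha.trans_le (hK x)
    rw [det_comp_plane, det_hyperboloidHessian (h.norm_grad_lt x)] at h1
    exact pos_of_mul_pos_right h1 (by positivity)
  have hsymm := fderiv_planeGrad_symm h.contDiff
  have hcont : Continuous fun x => fderiv ℝ (planeGrad f) x (EuclideanSpace.single 0 1) 0 := by
    have h1 : Continuous fun x => fderiv ℝ (planeGrad f) x (EuclideanSpace.single 0 1) :=
      (h.contDiff_grad.continuous_fderiv one_ne_zero).clm_apply continuous_const
    fun_prop
  have hne : ∀ x, fderiv ℝ (planeGrad f) x (EuclideanSpace.single 0 1) 0 ≠ 0 := by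
    intro x h0
    have h1 := hdet x
    rw [det_plane, symm_entry_plane (hsymm x), h0] at h1
    nlinarith [sq_nonneg (fderiv ℝ (planeGrad f) x (EuclideanSpace.single 0 1) 1)]
  have hdneg : ∀ A : Plane →L[ℝ] Plane, (-A).det = A.det := fun A => by
    rw [det_plane, det_plane]; simp
  rcases forall_pos_or_forall_neg hcont hne with hp | hn
  · exact Or.inl ⟨fun x => hasGradientAt_planeGrad (h.differentiableAt x), h.hasFDerivAt_grad,
      hsymm, fun x v hv => pos_of_det_pos (hsymm x) (hdet x) (hp x) hv, h.norm_grad_lt, hK⟩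
  · have hsymm' : ∀ x v w, ⟪(-fderiv ℝ (planeGrad f) x) v, w⟫_ℝ =
        ⟪v, (-fderiv ℝ (planeGrad f) x) w⟫_ℝ := fun x v w => by simp [hsymm x v w]
    refine Or.inr ⟨fun x => ?_, fun x => (h.hasFDerivAt_grad x).neg, hsymm',
      fun x v hv => pos_of_det_pos (hsymm' x) ?_ ?_ hv, fun x => ?_, fun x => ?_⟩
    · rw [hasGradientAt_iff_hasFDerivAt, map_neg]
      exact (hasGradientAt_planeGrad (h.differentiableAt x)).hasFDerivAt.neg
    · rw [hdneg]; exact hdet x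
    · simpa using hn x
    · rw [norm_neg]; exact h.norm_grad_lt x
    · rw [hyperboloidHessian_neg, det_comp_plane, hdneg, ← det_comp_plane]
      exact hK x

/-! ## Null lines and null planes -/

theorem liftVec_eq (y : Plane) : liftVec y = horizIncl y + timeVec :=
  mink_ext (by ext i; fin_cases i <;> simp [liftVec]) (by simp [liftVec])

@[simp] theorem horiz_liftVec (y : Plane) : horiz (liftVec y) = y := by simp [liftVec_eq]

@[simp] theorem liftVec_two (y : Plane) : liftVec y 2 = 1 := by simp [liftVec_eq]

theorem mink_liftVec (x : Mink) (y : Plane) : mink x (liftVec y) = ⟪horiz x, y⟫_ℝ - x 2 := by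
  rw [mink_eq]; simp

/-- A further point `p + w` of a causal extension would be causally related to every point of the
line. As the direction is null, the condition is affine in the parameter `s`, so `w` is orthogonal
to the direction. A vector with `mink w w ≤ 0` orthogonal to a null vector is a multiple of it, so
the point was on the line. -/
theorem isInextendableCausalCurve_nullLine (p : Mink) {ξ : Plane} (hξ : ‖ξ‖ = 1) :
    IsInextendableCausalCurve univ (fun t : ℝ => p + t • liftVec ξ) := by
  have hnull : mink (liftVec ξ) (liftVec ξ) = 0 := by
    rw [mink_liftVec]; simp [hξ]
  refine ⟨⟨univ_nonempty, ordConnected_univ, by fun_prop, fun s _ t _ hst => ?_⟩, ?_⟩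
  · have e : p + t • liftVec ξ - (p + s • liftVec ξ) = (t - s) • liftVec ξ := by
      rw [sub_smul]; abel
    rw [e]
    refine ⟨fun h0 => ?_, ?_⟩
    · have := congrArg timeCoord h0
      simp [sub_eq_zero] at this
      exact hst this.symm
    · rw [mink_eq] at hnull ⊢
      simp only [map_smul, real_inner_smul_left, inner_smul_right, PiLp.smul_apply, smul_eq_mul]
      exact le_of_eq (by linear_combination (t - s) ^ 2 * hnull)
  · rintro J δ ⟨-, -, -, hδ⟩ hsub _ ⟨t₀, ht₀, rfl⟩
    by_contra hnot
    set w := δ t₀ - p with hw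
    have key : ∀ s : ℝ, mink w w - 2 * s * mink w (liftVec ξ) ≤ 0 := by
      intro s
      obtain ⟨t, ht, hts⟩ := hsub ⟨s, mem_univ s, rfl⟩
      simp only at hts
      have hne : t ≠ t₀ := fun h => hnot ⟨s, mem_univ s, by simp only; rw [← h, hts]⟩
      have h1 := (hδ t ht t₀ ht₀ hne).2
      have e : δ t₀ - δ t = w - s • liftVec ξ := by rw [hts, hw]; abel
      rw [e] at h1
      rw [mink_eq] at h1 hnull ⊢
      rw [mink_eq]
      simp only [map_sub, map_smul, inner_sub_left, inner_sub_right, real_inner_smul_left,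
        inner_smul_right, PiLp.sub_apply, PiLp.smul_apply, smul_eq_mul] at h1 hnull ⊢
      rw [real_inner_comm (horiz w) (horiz (liftVec ξ))] at h1
      linear_combination h1 - s ^ 2 * hnull
    have hwv : mink w (liftVec ξ) = 0 := by
      by_contra hne
      -- At this parameter the left side of `key` equals 1.
      have := key ((mink w w - 1) / (2 * mink w (liftVec ξ)))
      have e : 2 * ((mink w w - 1) / (2 * mink w (liftVec ξ))) * mink w (liftVec ξ) =
          mink w w - 1 := by field_simp
      rw [e] at this
      linarith
    have hww := key 0
    rw [mink_liftVec] at hwv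
    rw [mink_eq, real_inner_self_eq_norm_sq] at hww
    have h0 : ‖horiz w - w 2 • ξ‖ ^ 2 ≤ 0 := by
      rw [norm_sub_sq_real, inner_smul_right, norm_smul, hξ, Real.norm_eq_abs, mul_one, sq_abs,
        sub_eq_zero.1 hwv]
      nlinarith
    have h1 : horiz w = w 2 • ξ := by
      have : ‖horiz w - w 2 • ξ‖ = 0 := by nlinarith [norm_nonneg (horiz w - w 2 • ξ)]
      exact sub_eq_zero.1 (norm_eq_zero.1 this)
    refine hnot ⟨w 2, mem_univ _, ?_⟩
    have h2 : w = w 2 • liftVec ξ := mink_ext (by simp [h1]) (by simp)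
    simp only
    rw [← h2, hw]
    abel

/-- The null planes through points of the domain of dependence meet the surface. -/
theorem exists_mink_eq_of_mem_domainOfDependence {S : Set Mink} {p : Mink}
    (hp : p ∈ domainOfDependence S) {ξ : Plane} (hξ : ‖ξ‖ = 1) :
    ∃ q ∈ S, mink q (liftVec ξ) = mink p (liftVec ξ) := by
  obtain ⟨_, ⟨t, -, rfl⟩, hq⟩ := hp _ _ (isInextendableCausalCurve_nullLine p hξ)
    ⟨0, mem_univ _, by simp⟩
  refine ⟨_, hq, ?_⟩
  rw [mink_liftVec, mink_liftVec]
  simp [inner_add_left, real_inner_smul_left, hξ]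

theorem subset_domainOfDependence (S : Set Mink) : S ⊆ domainOfDependence S :=
  fun p hp _ _ _ hmem => ⟨p, hmem, hp⟩

/-- The product with `liftVec ξ` strictly decreases along future timelike vectors. Conversely, the
vertical line through `p` reaches the null plane below `p`. -/
theorem mem_chronFuture_nullPlane {ξ : Plane} (hξ : ‖ξ‖ = 1) {z : ℝ} {p : Mink} :
    p ∈ chronFuture (nullPlane ξ z) ↔ mink p (liftVec ξ) < z := by
  constructor
  · rintro ⟨q, hq, h1, h2⟩
    have hq' : mink q (liftVec ξ) = z := hq
    rw [mink_eq, real_inner_self_eq_norm_sq] at h1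
    have h3 : ‖horiz (p - q)‖ < (p - q) 2 := lt_of_pow_lt_pow_left₀ 2 h2.le (by linarith)
    have h4 : ⟪horiz (p - q), ξ⟫_ℝ ≤ ‖horiz (p - q)‖ := by
      simpa [hξ] using real_inner_le_norm (horiz (p - q)) ξ
    rw [← hq', mink_liftVec, mink_liftVec]
    rw [map_sub, inner_sub_left] at h4
    simp only [PiLp.sub_apply, map_sub] at h3 h4
    linarith
  · intro h
    have e : p - (p - (z - mink p (liftVec ξ)) • timeVec) = (z - mink p (liftVec ξ)) • timeVec := by
      abel
    refine ⟨p - (z - mink p (liftVec ξ)) • timeVec, ?_, ?_⟩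
    · change mink _ (liftVec ξ) = z
      rw [mink_liftVec]
      simp
      rw [mink_liftVec]
      ring
    · rw [e]
      have h0 : 0 < z - mink p (liftVec ξ) := sub_pos.2 h
      refine ⟨?_, by simpa using h0⟩
      rw [mink_eq]
      simp
      exact h0.ne'

/-- The values at `ξ₀` of the null coordinate are unbounded on `𝓓_φ` if `φ` is infinite at
`ξ₀`. -/
theorem exists_mem_domainOf {φ : Metric.sphere (0 : Plane) 1 → EReal}
    (hφ : LowerSemicontinuous φ) (hbot : ∀ ξ, φ ξ ≠ ⊥) {ξ₀ : Metric.sphere (0 : Plane) 1}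
    (htop : φ ξ₀ = ⊤) (T : ℝ) : ∃ p ∈ domainOf φ, mink p (liftVec ξ₀) = T := by
  have hunit : ∀ ξ : Metric.sphere (0 : Plane) 1, ‖(ξ : Plane)‖ = 1 := fun ξ => by simp
  obtain ⟨ξm, -, hmin⟩ := LowerSemicontinuousOn.exists_isMinOn (f := φ) ⟨ξ₀, mem_univ ξ₀⟩
    isCompact_univ (hφ.lowerSemicontinuousOn univ)
  obtain ⟨m, -, hm⟩ := EReal.lt_iff_exists_real_btwn.1 (bot_lt_iff_ne_bot.2 (hbot ξm))
  have hlow : ∀ ξ, (m : EReal) < φ ξ := fun ξ => hm.trans_le (hmin (mem_univ ξ))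
  obtain ⟨ρ, hρ, hball⟩ := Metric.eventually_nhds_iff_ball.1
    (hφ ξ₀ (T : EReal) (show (T : EReal) < φ ξ₀ by rw [htop]; exact EReal.coe_lt_top T))
  -- Sized so that at distance at least `ρ` from `ξ₀` the null coordinate of `p` is at most `T - |T
  -- - m| ≤ m`, below every value of `φ`. Within `ρ` it is at most `T`, below `φ` by semicontinuity.
  set M : ℝ := 2 * |T - m| / ρ ^ 2 with hM
  have hM0 : 0 ≤ M := by positivity
  set p : Mink := M • horizIncl ξ₀ + (M - T) • timeVec with hp
  have hval : ∀ ξ : Metric.sphere (0 : Plane) 1,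
      mink p (liftVec ξ) = T - M * (‖(ξ : Plane) - ξ₀‖ ^ 2 / 2) := by
    intro ξ
    rw [mink_liftVec, norm_sub_sq_real, hunit, hunit]
    simp [hp, real_inner_smul_left, real_inner_comm (ξ₀ : Plane)]
    ring
  refine ⟨p, fun ξ z hz => ?_, by rw [hval]; simp⟩
  rw [mem_chronFuture_nullPlane (hunit ξ), hval]
  by_cases hξ : ξ ∈ Metric.ball ξ₀ ρ
  · have h1 : T < z := by exact_mod_cast (hball ξ hξ).trans_le hz
    have : 0 ≤ M * (‖(ξ : Plane) - ξ₀‖ ^ 2 / 2) := by positivity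
    linarith
  · have h1 : m < z := by exact_mod_cast (hlow ξ).trans_le hz
    have h2 : ρ ≤ ‖(ξ : Plane) - ξ₀‖ := by
      rw [Metric.mem_ball, not_lt, Subtype.dist_eq, dist_eq_norm] at hξ
      exact hξ
    have h3 : M * (ρ ^ 2 / 2) ≤ M * (‖(ξ : Plane) - ξ₀‖ ^ 2 / 2) := by gcongr
    have h4 : M * (ρ ^ 2 / 2) = |T - m| := by rw [hM]; field_simp
    linarith [le_abs_self (T - m)]

/-! ## The support function of a graph -/

namespace IsSpacelikeGraph

variable {S : Set Mink} {f : Plane → ℝ}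

theorem mink_graphMap (f : Plane → ℝ) (x y : Plane) :
    mink (graphMap f x) (liftVec y) = ⟪x, y⟫_ℝ - f x := by
  rw [mink_liftVec]; simp

theorem eq_graphMap (h : IsSpacelikeGraph S f) {p : Mink} (hp : p ∈ S) :
    graphMap f (horiz p) = p :=
  graphMap_horiz ((h.mem_iff p).1 hp)

theorem supportFunction_eq (h : IsSpacelikeGraph S f) {y : Plane} (hy : ‖y‖ ≤ 1) :
    supportFunction S y = legendre f y := by
  rw [supportFunction, if_pos (by simpa using hy)]
  refine le_antisymm (iSup₂_le fun p hp => ?_) (iSup_le fun x => ?_)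
  · rw [← h.eq_graphMap hp, mink_graphMap]
    exact le_legendre f _ y
  · rw [← mink_graphMap]
    exact le_iSup₂ (f := fun p (_ : p ∈ S) => ((mink p (liftVec y) : ℝ) : EReal)) (graphMap f x)
      (h.graphMap_mem x)

theorem essDomain_supportFunction (h : IsSpacelikeGraph S f) :
    essDomain (supportFunction S) = finiteDisk f := by
  ext y
  by_cases hy : ‖y‖ ≤ 1
  · simp only [essDomain, finiteDisk, mem_ofPred_eq, h.supportFunction_eq hy, hy, true_and,
      lt_top_iff_ne_top]
    exact and_iff_right (legendre_ne_bot f y)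
  · simp only [essDomain, finiteDisk, mem_ofPred_eq, hy, false_and, iff_false, not_and, not_not]
    intro _
    rw [supportFunction, if_neg (by simpa using hy)]

theorem supportFunction_lt_top_iff (h : IsSpacelikeGraph S f) :
    {ξ | ξ ∈ Metric.sphere (0 : Plane) 1 ∧ supportFunction S ξ < ⊤} = finiteCircle f := by
  ext ξ
  simp only [finiteCircle, mem_ofPred_eq, mem_sphere_zero_iff_norm]
  refine and_congr_right fun hξ => ?_
  rw [h.supportFunction_eq hξ.le]

theorem kleinProj_image (h : IsSpacelikeGraph S f) :
    kleinProj '' (gaussMap S '' S) = range (planeGrad f) := by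
  ext y
  constructor
  · rintro ⟨_, ⟨p, hp, rfl⟩, rfl⟩
    rw [h.gaussMap_eq hp, kleinProj_unitNormal (h.norm_grad_lt _)]
    exact ⟨_, rfl⟩
  · rintro ⟨x, rfl⟩
    refine ⟨_, ⟨graphMap f x, h.graphMap_mem x, rfl⟩, ?_⟩
    rw [h.gaussMap_eq (h.graphMap_mem x), kleinProj_unitNormal (h.norm_grad_lt _), horiz_graphMap]

/-- The supergraph of the Legendre transform is closed and convex, being cut out by affine
inequalities, and it contains the supergraph of the restriction. -/
theorem le_convEnvelope (h : IsSpacelikeGraph S f) {ξ₁ ξ₂ y : Plane} (h1 : ‖ξ₁‖ = 1)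
    (h2 : ‖ξ₂‖ = 1) :
    legendre f y ≤ convEnvelope (restrictTo (supportFunction S) {ξ₁, ξ₂}) y := by
  set E : Set (Plane × ℝ) := {q | ∀ x, ⟪x, q.1⟫_ℝ - f x ≤ q.2} with hE
  have hEc : IsClosed E := by
    simp only [hE, ofPred_forall]
    exact isClosed_iInter fun x => isClosed_le (by fun_prop) (by fun_prop)
  have hEconv : Convex ℝ E := by
    intro q hq q' hq' s t hs ht hst x
    have e1 := mul_le_mul_of_nonneg_left (hq x) hs
    have e2 := mul_le_mul_of_nonneg_left (hq' x) ht
    have e3 : f x = s * f x + t * f x := by rw [← add_mul, hst, one_mul]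
    simp only [Prod.fst_add, Prod.smul_fst, Prod.snd_add, Prod.smul_snd, inner_add_right,
      inner_smul_right, smul_eq_mul]
    linarith
  have hsub : supergraph (restrictTo (supportFunction S) {ξ₁, ξ₂}) ⊆ E := by
    rintro ⟨z, t⟩ hz
    have hz' : restrictTo (supportFunction S) {ξ₁, ξ₂} z ≤ (t : EReal) := hz
    unfold restrictTo at hz'
    split_ifs at hz' with hmem
    · have hz1 : ‖z‖ = 1 := by
        rcases hmem with rfl | hmem
        · exact h1
        · rw [mem_singleton_iff] at hmem; rw [hmem]; exact h2
      rw [h.supportFunction_eq hz1.le, legendre_le_coe] at hz'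
      exact hz'
    · exact absurd hz' (by simp)
  refine le_sInf ?_
  rintro w ⟨z, rfl, hz⟩
  exact legendre_le_coe.2 (closure_minimal (convexHull_min hsub hEconv) hEc hz)

theorem convEnvelope_le (h : IsSpacelikeGraph S f) {ξ₁ ξ₂ : Plane} (h1 : ‖ξ₁‖ = 1)
    (h2 : ‖ξ₂‖ = 1) {A B s t : ℝ} (hA : legendre f ξ₁ ≤ A) (hB : legendre f ξ₂ ≤ B) (hs : 0 ≤ s)
    (ht : 0 ≤ t) (hst : s + t = 1) :
    convEnvelope (restrictTo (supportFunction S) {ξ₁, ξ₂}) (s • ξ₁ + t • ξ₂) ≤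
      ((s * A + t * B : ℝ) : EReal) := by
  refine sInf_le ⟨s * A + t * B, rfl, subset_closure ?_⟩
  have m1 : ((ξ₁, A) : Plane × ℝ) ∈ supergraph (restrictTo (supportFunction S) {ξ₁, ξ₂}) := by
    change restrictTo (supportFunction S) {ξ₁, ξ₂} ξ₁ ≤ (A : EReal)
    rw [restrictTo, if_pos (by simp), h.supportFunction_eq h1.le]
    exact hA
  have m2 : ((ξ₂, B) : Plane × ℝ) ∈ supergraph (restrictTo (supportFunction S) {ξ₁, ξ₂}) := by
    change restrictTo (supportFunction S) {ξ₁, ξ₂} ξ₂ ≤ (B : EReal)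
    rw [restrictTo, if_pos (by simp), h.supportFunction_eq h2.le]
    exact hB
  exact convex_convexHull ℝ _ (subset_convexHull ℝ _ m1) (subset_convexHull ℝ _ m2) hs ht hst

theorem convEnvelope_le_left (h : IsSpacelikeGraph S f) {ξ₁ ξ₂ : Plane} (h1 : ‖ξ₁‖ = 1) :
    convEnvelope (restrictTo (supportFunction S) {ξ₁, ξ₂}) ξ₁ ≤ legendre f ξ₁ := by
  rcases eq_or_ne (legendre f ξ₁) ⊤ with ht | ht
  · rw [ht]; exact le_top
  obtain ⟨A, hA⟩ := exists_legendre_eq_coe ht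
  rw [hA]
  refine sInf_le ⟨A, rfl, subset_closure (subset_convexHull ℝ _ ?_)⟩
  change restrictTo (supportFunction S) {ξ₁, ξ₂} ξ₁ ≤ (A : EReal)
  rw [restrictTo, if_pos (by simp), h.supportFunction_eq h1.le, hA]

/-- The restriction of the support function to a chord in the boundary of the Gauss image. -/
theorem supportFunction_eq_convEnvelope (h : IsSpacelikeGraph S f) {a : ℝ} (ha : 0 < a)
    (hconv : IsConvexSpacelike a f (planeGrad f) (fderiv ℝ (planeGrad f))) {ξ₁ ξ₂ : Plane}
    (h1 : ‖ξ₁‖ = 1) (h2 : ‖ξ₂‖ = 1) (hseg : segment ℝ ξ₁ ξ₂ ⊆ frontier (range (planeGrad f)))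
    {y : Plane} (hy : y ∈ segment ℝ ξ₁ ξ₂) :
    supportFunction S y = convEnvelope (restrictTo (supportFunction S) {ξ₁, ξ₂}) y := by
  have hyb : ‖y‖ ≤ 1 := by
    have := (convex_closedBall (0 : Plane) 1).segment_subset (by simp [h1]) (by simp [h2]) hy
    simpa using this
  rw [h.supportFunction_eq hyb]
  refine le_antisymm (h.le_convEnvelope h1 h2) ?_
  obtain ⟨s, t, hs, ht, hst, rfl⟩ := hy
  rcases eq_or_ne ξ₁ ξ₂ with rfl | hne
  · rw [← add_smul, hst, one_smul]
    exact h.convEnvelope_le_left h1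
  rcases hs.eq_or_lt with rfl | hs'
  · rw [zero_add] at hst
    rw [hst, zero_smul, one_smul, zero_add, pair_comm]
    exact h.convEnvelope_le_left h2
  rcases ht.eq_or_lt with rfl | ht'
  · rw [add_zero] at hst
    rw [hst, zero_smul, one_smul, add_zero]
    exact h.convEnvelope_le_left h1
  rcases eq_or_ne (legendre f (s • ξ₁ + t • ξ₂)) ⊤ with hinf | hfin
  · rw [hinf]; exact le_top
  obtain ⟨e, he, hc, htop⟩ :=
    hconv.exists_frame_of_segment_subset_frontier h.contDiff_grad ha hseg
  have f1 := hconv.legendre_lt_top_of_combination ha he htop hne h1 h2 hc rfl hs' ht hst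
    (lt_top_iff_ne_top.2 hfin)
  have f2 := hconv.legendre_lt_top_of_combination ha he htop hne.symm h2 h1 rfl hc ht' hs
    (by rw [add_comm]; exact hst) (by rw [add_comm]; exact lt_top_iff_ne_top.2 hfin)
  obtain ⟨A, hA⟩ := exists_legendre_eq_coe f1.ne
  obtain ⟨B, hB⟩ := exists_legendre_eq_coe f2.ne
  obtain ⟨C, hC⟩ := exists_legendre_eq_coe hfin
  refine (h.convEnvelope_le h1 h2 hA.le hB.le hs ht hst).trans ?_
  rw [hC, EReal.coe_le_coe_iff]
  -- The chord estimate needs values strictly below those at the endpoints, hence the loss of `ε`.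
  refine le_of_forall_pos_le_add fun ε hε => ?_
  have := hconv.le_legendre_combination ha he htop hne h1 h2 hc rfl (A := A - ε) (B := B - ε)
    (by rw [hA, EReal.coe_lt_coe_iff]; linarith) (by rw [hB, EReal.coe_lt_coe_iff]; linarith)
    hs ht hst
  rw [hC, EReal.coe_le_coe_iff] at this
  have e : s * (A - ε) + t * (B - ε) = s * A + t * B - (s + t) * ε := by ring
  rw [e, hst] at this
  linarith

/-! ## Past-convex graphs -/

/-- For concave `f`, the function `z ↦ ⟪z, y⟫ - f z` lies above an affine function with gradient `y
- g x` for each `x`. Injectivity of `g` yields an `x` for which this gradient is nonzero. -/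
theorem legendre_eq_top_of_concave {a : ℝ} {f : Plane → ℝ} {g : Plane → Plane}
    {H : Plane → Plane →L[ℝ] Plane}
    (h : IsConvexSpacelike a (fun x => -f x) (fun x => -g x) H) (y : Plane) :
    legendre f y = ⊤ := by
  by_contra hne
  obtain ⟨T, hT⟩ := exists_legendre_eq_coe hne
  have hle := legendre_le_coe.1 hT.le
  obtain ⟨x, hx⟩ : ∃ x, g x ≠ y := by
    by_contra hcon
    push Not at hcon
    have h0 : (0 : Plane) = EuclideanSpace.single 0 1 :=
      h.grad_injective (by simp only [hcon])
    have := congrArg (fun v : Plane => v 0) h0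
    simp at this
  set q := y - g x with hq
  have hq0 : 0 < ‖q‖ ^ 2 := by
    have : q ≠ 0 := sub_ne_zero.2 (Ne.symm hx)
    positivity
  set s := (T - (⟪x, y⟫_ℝ - f x) + 1) / ‖q‖ ^ 2 with hs
  have hsq : s * ‖q‖ ^ 2 = T - (⟪x, y⟫_ℝ - f x) + 1 := div_mul_cancel₀ _ hq0.ne'
  have h1 := h.tangent_le x (x + s • q)
  have h2 := hle (x + s • q)
  rw [add_sub_cancel_left, inner_neg_left, inner_smul_right] at h1
  rw [inner_add_left, real_inner_smul_left] at h2
  have h3 : ⟪q, y⟫_ℝ - ⟪g x, q⟫_ℝ = ‖q‖ ^ 2 := by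
    rw [real_inner_comm q (g x), ← inner_sub_right, ← hq, real_inner_self_eq_norm_sq]
  have h4 : s * ⟪q, y⟫_ℝ - s * ⟪g x, q⟫_ℝ = s * ‖q‖ ^ 2 := by rw [← mul_sub, h3]
  linarith

/-- The finiteness result applied to `-f` gives `ξ` such that the null coordinate for `-ξ` is
bounded below by `-C` on `S`. The null line in direction `-ξ` through a point at height `C + 1` has
null coordinate `-(C + 1)`, so it misses `S`. -/
theorem domainOfDependence_ne_univ_of_concave (h : IsSpacelikeGraph S f) {a : ℝ} (ha : 0 < a)
    {g : Plane → Plane} {H : Plane → Plane →L[ℝ] Plane}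
    (hc : IsConvexSpacelike a (fun x => -f x) g H) :
    domainOfDependence S ≠ univ := by
  intro huniv
  obtain ⟨ξ, hξ, hfin⟩ := hc.finiteCircle_nonempty ha
  obtain ⟨C, hC⟩ := exists_legendre_eq_coe hfin.ne
  obtain ⟨q, hq, hval⟩ := exists_mink_eq_of_mem_domainOfDependence
    (S := S) (p := (C + 1) • timeVec) (by rw [huniv]; exact mem_univ _)
    (ξ := -ξ) (by rw [norm_neg]; exact hξ)
  rw [← h.eq_graphMap hq, mink_graphMap, mink_liftVec] at hval
  have := legendre_le_coe.1 hC.le (horiz q)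
  simp at hval
  linarith

/-! ## The Gauss map -/

theorem legendre_lt_top_of_ne_top (h : IsSpacelikeGraph S f)
    {φ : Metric.sphere (0 : Plane) 1 → EReal} (hbot : ∀ ξ, φ ξ ≠ ⊥)
    (hdom : domainOfDependence S = domainOf φ) {ξ : Metric.sphere (0 : Plane) 1}
    (hξ : φ ξ ≠ ⊤) : legendre f ξ < ⊤ := by
  have hz : φ ξ = ((φ ξ).toReal : EReal) := (EReal.coe_toReal hξ (hbot ξ)).symm
  refine (legendre_le_coe (t := (φ ξ).toReal).2 fun x => ?_).trans_lt (EReal.coe_lt_top _)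
  have h1 : graphMap f x ∈ domainOf φ := hdom ▸ subset_domainOfDependence S (h.graphMap_mem x)
  have h2 := (mem_chronFuture_nullPlane (by simp)).1 (h1 ξ _ hz.le)
  rw [mink_graphMap] at h2
  exact h2.le

/-- Where `φ` is finite it bounds the null coordinate on `S`, since `S` lies in its domain of
dependence. Where `φ` is infinite, that coordinate is unbounded on the domain, and null lines
transport its values to `S`. -/
theorem image_ne_top_eq (h : IsSpacelikeGraph S f)
    {φ : Metric.sphere (0 : Plane) 1 → EReal} (hφ : LowerSemicontinuous φ)
    (hbot : ∀ ξ, φ ξ ≠ ⊥) (hdom : domainOfDependence S = domainOf φ) :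
    Subtype.val '' {ξ | φ ξ ≠ ⊤} = finiteCircle f := by
  ext ξ
  constructor
  · rintro ⟨ξ, hξ, rfl⟩
    exact ⟨by simp, h.legendre_lt_top_of_ne_top hbot hdom hξ⟩
  · rintro ⟨hξ, hfin⟩
    refine ⟨⟨ξ, by simpa using hξ⟩, fun htop => ?_, rfl⟩
    obtain ⟨T, hT⟩ := exists_legendre_eq_coe hfin.ne
    obtain ⟨p, hp, hval⟩ := exists_mem_domainOf hφ hbot htop (T + 1)
    rw [← hdom] at hp
    obtain ⟨q, hq, hq2⟩ := exists_mink_eq_of_mem_domainOfDependence hp hξ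
    rw [hval, ← h.eq_graphMap hq, mink_graphMap] at hq2
    have := legendre_le_coe.1 hT.le (horiz q)
    linarith

/-- Injectivity makes the global inverse agree with the local one of the inverse function theorem.
-/
theorem _root_.IsConvexSpacelike.contDiffAt_invFun {a : ℝ} {f : Plane → ℝ} {g : Plane → Plane}
    {H : Plane → Plane →L[ℝ] Plane} (h : IsConvexSpacelike a f g H) {n : WithTop ℕ∞} (hn : 1 ≤ n)
    (hg : ContDiff ℝ n g) (x : Plane) : ContDiffAt ℝ n (Function.invFun g) (g x) := by
  have hn0 : n ≠ 0 := fun h0 => by simp [h0] at hn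
  have hd : HasFDerivAt g (h.hessEquiv x : Plane →L[ℝ] Plane) x := by
    rw [h.coe_hessEquiv]; exact h.hess x
  refine (hg.contDiffAt.to_localInverse hd hn0).congr_of_eventuallyEq ?_
  filter_upwards [(hg.contDiffAt.hasStrictFDerivAt' hd hn0).eventually_right_inverse] with y hy
  have hy' : g (hg.contDiffAt.localInverse hd hn0 y) = y := hy
  conv_lhs => rw [← hy']
  exact Function.leftInverse_invFun h.grad_injective _

theorem isDiffeoOnto_gaussMap (h : IsSpacelikeGraph S f) {a : ℝ} (ha : 0 < a)
    (hconv : IsConvexSpacelike a f (planeGrad f) (fderiv ℝ (planeGrad f))) {n : WithTop ℕ∞}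
    (hn : 1 ≤ n) (hf : ContDiff ℝ (n + 1) f) :
    IsDiffeoOnto n (gaussMap S) S
      {x | x ∈ hyperbolicPlane ∧ kleinProj x ∈ interior (convexHull ℝ (finiteCircle f))} := by
  rw [← hconv.range_grad_eq h.contDiff_grad ha]
  have hg : ContDiff ℝ n (planeGrad f) := contDiff_planeGrad hf le_rfl
  have hinv := Function.leftInverse_invFun hconv.grad_injective
  have hklein : ∀ p ∈ S, kleinProj (gaussMap S p) = planeGrad f (horiz p) := fun p hp => by
    rw [h.gaussMap_eq hp, kleinProj_unitNormal (h.norm_grad_lt _)]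
  have hleft : ∀ p ∈ S,
      graphMap f (Function.invFun (planeGrad f) (kleinProj (gaussMap S p))) = p := fun p hp => by
    rw [hklein p hp, hinv, h.eq_graphMap hp]
  have hright : ∀ x, x ∈ hyperbolicPlane ∧ kleinProj x ∈ range (planeGrad f) →
      gaussMap S (graphMap f (Function.invFun (planeGrad f) (kleinProj x))) = x := by
    rintro x ⟨hx, z, hz⟩
    rw [← hz, hinv, h.gaussMap_eq (h.graphMap_mem z), horiz_graphMap, hz]
    exact (eq_unitNormal_kleinProj hx).symm
  refine ⟨⟨fun p hp => ⟨?_, ?_⟩, fun p hp q hq hpq => ?_, fun x hx => ?_⟩, fun p hp => ?_,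
    fun x => graphMap f (Function.invFun (planeGrad f) (kleinProj x)), ⟨hleft, hright⟩,
    fun x hx => ?_⟩
  · rw [h.gaussMap_eq hp]; exact unitNormal_mem (h.norm_grad_lt _)
  · rw [hklein p hp]; exact ⟨_, rfl⟩
  · rw [← hleft p hp, ← hleft q hq, hpq]
  · exact ⟨_, h.graphMap_mem _, hright x hx⟩
  · have h1 : ContDiffAt ℝ n (fun q : Mink => unitNormal (planeGrad f (horiz q))) p :=
      ContDiffAt.comp (g := unitNormal) p (contDiffAt_unitNormal (h.norm_grad_lt (horiz p)))
        (hg.comp horiz.contDiff).contDiffAt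
    exact h1.contDiffWithinAt.congr (fun q hq => h.gaussMap_eq hq) (h.gaussMap_eq hp)
  · obtain ⟨hxh, z, hz⟩ := hx
    have hk : ContDiffAt ℝ n kleinProj x := by
      have e : kleinProj = fun x : Mink => (timeCoord x)⁻¹ • horiz x := funext kleinProj_eq
      rw [e]
      exact (timeCoord.contDiff.contDiffAt.inv hxh.2.ne').smul horiz.contDiff.contDiffAt
    have hi : ContDiffAt ℝ n (Function.invFun (planeGrad f)) (kleinProj x) := by
      rw [← hz]; exact hconv.contDiffAt_invFun hn hg z
    have hfn : ContDiff ℝ n f := hf.of_le le_self_add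
    have hgm : ContDiff ℝ n (graphMap f) :=
      horizIncl.contDiff.add (hfn.smul contDiff_const)
    exact (hgm.contDiffAt.comp x (hi.comp x hk)).contDiffWithinAt

end IsSpacelikeGraph

end

/-! ### The theorem: convex and concave graphs. -/

theorem theoremE (k : ℕ∞) (hk : 1 ≤ k) (S : Set Mink)
    (hS : IsProperSpacelikeSurface ((k : WithTop ℕ∞) + 1) S)
    (a b : ℝ) (ha : 0 < a)
    (hcurv : ∀ p ∈ S, a ≤ gaussianCurvature S p ∧ gaussianCurvature S p ≤ b) :
    (∀ φ : Metric.sphere (0 : Plane) 1 → EReal, LowerSemicontinuous φ → (∀ ξ, φ ξ ≠ ⊥) →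
      domainOfDependence S = domainOf φ →
      IsDiffeoOnto (k : WithTop ℕ∞) (gaussMap S) S
        {x | x ∈ hyperbolicPlane ∧
          kleinProj x ∈ interior (convexHull ℝ (Subtype.val '' {ξ | φ ξ ≠ ⊤}))}) ∧
    essDomain (supportFunction S) =
      convexHull ℝ {ξ | ξ ∈ Metric.sphere (0 : Plane) 1 ∧ supportFunction S ξ < ⊤} ∧
    (∀ ξ₁ ∈ Metric.sphere (0 : Plane) 1, ∀ ξ₂ ∈ Metric.sphere (0 : Plane) 1,
      segment ℝ ξ₁ ξ₂ ⊆ frontier (kleinProj '' (gaussMap S '' S)) →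
      ∀ y ∈ segment ℝ ξ₁ ξ₂,
        supportFunction S y = convEnvelope (restrictTo (supportFunction S) {ξ₁, ξ₂}) y) := by
  have hk' : (1 : WithTop ℕ∞) ≤ k := by exact_mod_cast hk
  obtain ⟨f, hf, hmem⟩ := hS.exists_eq_graph le_add_self
  have h2 : (2 : WithTop ℕ∞) ≤ (k : WithTop ℕ∞) + 1 := by
    rw [← one_add_one_eq_two]
    gcongr
  have hG : IsSpacelikeGraph S f := ⟨hf.of_le h2, hmem, hS.spacelike⟩
  rw [hG.essDomain_supportFunction, hG.supportFunction_lt_top_iff, hG.kleinProj_image]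
  rcases hG.isConvexSpacelike_or ha fun p hp => (hcurv p hp).1 with hconv | hconc
  · refine ⟨fun φ hφ hbot hdom => ?_, hconv.finiteDisk_eq ha, fun ξ₁ h₁ ξ₂ h₂ hseg y hy => ?_⟩
    · rw [hG.image_ne_top_eq hφ hbot hdom]
      exact hG.isDiffeoOnto_gaussMap ha hconv hk' hf
    · exact hG.supportFunction_eq_convEnvelope ha hconv (by simpa using h₁) (by simpa using h₂)
        hseg hy
  · have htop := IsSpacelikeGraph.legendre_eq_top_of_concave hconc
    refine ⟨fun φ hφ hbot hdom => ?_, ?_, fun ξ₁ h₁ ξ₂ h₂ hseg y hy => ?_⟩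
    · refine absurd ?_ (hG.domainOfDependence_ne_univ_of_concave ha hconc)
      rw [hdom]
      refine Set.eq_univ_of_forall fun p ξ z hz => ?_
      have h3 : φ ξ ≠ ⊤ := ne_top_of_le_ne_top (EReal.coe_ne_top z) hz
      have h4 := hG.legendre_lt_top_of_ne_top hbot hdom h3
      rw [htop] at h4
      exact absurd h4 (lt_irrefl _)
    · have e1 : finiteDisk f = ∅ := Set.eq_empty_of_forall_notMem fun y hy => hy.2.ne (htop y)
      have e2 : finiteCircle f = ∅ := Set.eq_empty_of_forall_notMem fun y hy => hy.2.ne (htop y)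
      rw [e1, e2, convexHull_empty]
    · have hyb : ‖y‖ ≤ 1 := by
        have := (convex_closedBall (0 : Plane) 1).segment_subset
          (Metric.sphere_subset_closedBall h₁) (Metric.sphere_subset_closedBall h₂) hy
        simpa using this
      have := hG.le_convEnvelope (y := y) (by simpa using h₁ : ‖ξ₁‖ = 1)
        (by simpa using h₂ : ‖ξ₂‖ = 1)
      rw [htop, top_le_iff] at this
      rw [hG.supportFunction_eq hyb, htop, this]
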